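/- Let $\mathfrak g$ be a finite-dimensional real nilpotent Lie algebra with derived algebra $\mathfrak g'=[\mathfrak g,\mathfrak g]$, and let $\mathbb P L$ denote the projective space of a linear space $L$. For an inner product $\langle\cdot,\cdot\rangle$ on $\mathfrak g$, let $\mathrm{Ric}$ be the Ricci tensor of the corresponding left-invariant Riemannian metric, regarded as a bilinear form on $\mathfrak g$, and let $\mathrm{ric}\in\mathrm{End}(\mathfrak g)$ be the Ricci operator, $\langle \mathrm{ric}\,X,Y\rangle=\mathrm{Ric}(X,Y)$. A point $u\in\mathbb P\mathfrak g$ is called Ricci-maximal (respectively, Ricci-minimal) if there exists an inner product on $\mathfrak g$ such that a nonzero vector $X$ on the line $u$ is an eigenvector of the Ricci operator of this inner product with the maximal (respectively, minimal) eigenvalue. Let $M,m\subset\mathbb P\mathfrak g$ be the sets of Ricci-maximal and of Ricci-minimal points, respectively, and let bars denote closures in $\mathbb P\mathfrak g$. Call $\mathfrak g$ two-step nilpotent if it is nonabelian and $[\mathfrak g,[\mathfrak g,\mathfrak g]]=0$. (a) (i) If $\mathfrak g$ is two-step nilpotent, then $\overline M=\mathbb P\mathfrak g'$. (ii) If $\mathfrak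 g$ is nonabelian, is not two-step nilpotent, and has a codimension one abelian ideal $\mathfrak a$, then $\overline M=\mathbb P\mathfrak a$. (iii) In all other cases (that is, if $\mathfrak g$ is abelian, or if $\mathfrak g$ is not two-step nilpotent and has no codimension one abelian ideal), $\overline M=\mathbb P\mathfrak g$. (b) $\overline m=\mathbb P\mathfrak g$. -/

import Mathlib

open scoped LinearAlgebra.Projectivization

noncomputable section

namespace RicciNil

section Projective

variable {V : Type*} [AddCommGroup V] [Module ℝ V]

/-- The topology of the real projective space of a topological vector space `V`: the quotient
topology induced by the projection from `V` without the origin. -/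
instance projectivizationTopology [TopologicalSpace V] : TopologicalSpace (ℙ ℝ V) :=
  TopologicalSpace.coinduced
    (Projectivization.mk' ℝ : {v : V // v ≠ 0} → ℙ ℝ V) inferInstance

/-- The projective space of the linear subspace `W`, as a subset of the projective space of `V`:
the set of all lines contained in `W`. -/
def projSet (W : Submodule ℝ V) : Set (ℙ ℝ V) := {p | p.submodule ≤ W}

/-- An inner product on the real vector space `V`. -/
structure InnerProd (V : Type*) [AddCommGroup V] [Module ℝ V] where
  /-- the underlying bilinear form -/
  form : LinearMap.BilinForm ℝ V
  symm : ∀ x y, form x y = form y x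
  pos : ∀ x, x ≠ 0 → 0 < form x x

theorem InnerProd.nondegenerate (B : InnerProd V) : B.form.Nondegenerate := by
  constructor
  · intro x hx
    by_contra h
    exact (B.pos x h).ne' (hx x)
  · intro x hx
    by_contra h
    exact (B.pos x h).ne' (hx x)

/-- The Riesz isomorphism of an inner product, `x ↦ ⟨x, ·⟩`. -/
def InnerProd.riesz [FiniteDimensional ℝ V] (B : InnerProd V) : V ≃ₗ[ℝ] Module.Dual ℝ V :=
  B.form.toDual B.nondegenerate

theorem InnerProd.riesz_symm_apply [FiniteDimensional ℝ V] (B : InnerProd V)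
    (f : Module.Dual ℝ V) (z : V) : B.form (B.riesz.symm f) z = f z :=
  LinearMap.BilinForm.apply_toDual_symm_apply (hB := B.nondegenerate) f z

end Projective

section Curvature

variable {g : Type*} [LieRing g] [LieAlgebra ℝ g]

/-- The right-hand side of the Koszul formula for left-invariant vector fields `x, y, z`:
`(⟨[x, y], z⟩ - ⟨[y, z], x⟩ + ⟨[z, x], y⟩) / 2`, as a linear form in `z`. -/
def koszul (B : InnerProd g) (x y : g) : Module.Dual ℝ g where
  toFun z := (B.form ⁅x, y⁆ z - B.form ⁅y, z⁆ x + B.form ⁅z, x⁆ y) / 2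
  map_add' z w := by simp only [lie_add, add_lie, map_add, LinearMap.add_apply]; ring
  map_smul' c z := by
    simp only [lie_smul, smul_lie, map_smul, LinearMap.smul_apply, smul_eq_mul,
      RingHom.id_apply]
    ring

variable [FiniteDimensional ℝ g]

/-- The Levi-Civita connection `∇_x y` of the left-invariant Riemannian metric that is given by an
inner product on the Lie algebra `g`, restricted to left-invariant vector fields. It is determined
by the Koszul formula. -/
def leviCivita (B : InnerProd g) : g →ₗ[ℝ] g →ₗ[ℝ] g :=
  LinearMap.mk₂ ℝ (fun x y => B.riesz.symm (koszul B x y))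
    (fun x x' y => by
      rw [← map_add]; congr 1; ext z
      simp only [koszul, LinearMap.coe_mk, AddHom.coe_mk, LinearMap.add_apply, lie_add, add_lie,
        map_add]
      ring)
    (fun c x y => by
      rw [← map_smul]; congr 1; ext z
      simp only [koszul, LinearMap.coe_mk, AddHom.coe_mk, LinearMap.smul_apply, lie_smul,
        smul_lie, map_smul, smul_eq_mul]
      ring)
    (fun x y y' => by
      rw [← map_add]; congr 1; ext z
      simp only [koszul, LinearMap.coe_mk, AddHom.coe_mk, LinearMap.add_apply, lie_add, add_lie,
        map_add]
      ring)
    (fun c x y => by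
      rw [← map_smul]; congr 1; ext z
      simp only [koszul, LinearMap.coe_mk, AddHom.coe_mk, LinearMap.smul_apply, lie_smul,
        smul_lie, map_smul, smul_eq_mul]
      ring)

theorem form_leviCivita (B : InnerProd g) (x y z : g) :
    B.form (leviCivita B x y) z
      = (B.form ⁅x, y⁆ z - B.form ⁅y, z⁆ x + B.form ⁅z, x⁆ y) / 2 :=
  B.riesz_symm_apply (koszul B x y) z

/-- The Riemann curvature operator
`R(x, y) z = ∇_x ∇_y z - ∇_y ∇_x z - ∇_[x, y] z`, as an endomorphism in `z`. -/
def curvature (B : InnerProd g) (x y : g) : Module.End ℝ g :=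
  leviCivita B x ∘ₗ leviCivita B y - leviCivita B y ∘ₗ leviCivita B x - leviCivita B ⁅x, y⁆

/-- The linear map `x ↦ R(x, y) z`. -/
def curvatureMap (B : InnerProd g) (y z : g) : Module.End ℝ g where
  toFun x := curvature B x y z
  map_add' x x' := by
    simp only [curvature, map_add, add_lie, LinearMap.sub_apply, LinearMap.add_apply,
      LinearMap.comp_apply]
    abel
  map_smul' c x := by
    simp only [curvature, map_smul, smul_lie, LinearMap.sub_apply, LinearMap.smul_apply,
      LinearMap.comp_apply, RingHom.id_apply, smul_sub]

/-- The Ricci tensor `Ric(y, z) = tr (x ↦ R(x, y) z)`. -/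
def ricci (B : InnerProd g) : LinearMap.BilinForm ℝ g :=
  LinearMap.mk₂ ℝ (fun y z => LinearMap.trace ℝ g (curvatureMap B y z))
    (fun y y' z => by
      rw [← map_add]; congr 1; ext x
      simp only [curvatureMap, curvature, LinearMap.coe_mk, AddHom.coe_mk, map_add, lie_add,
        LinearMap.sub_apply, LinearMap.add_apply, LinearMap.comp_apply]
      abel)
    (fun c y z => by
      rw [← map_smul]; congr 1; ext x
      simp only [curvatureMap, curvature, LinearMap.coe_mk, AddHom.coe_mk, map_smul, lie_smul,
        LinearMap.sub_apply, LinearMap.smul_apply, LinearMap.comp_apply, smul_sub])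
    (fun y z z' => by
      rw [← map_add]; congr 1; ext x
      simp only [curvatureMap, LinearMap.coe_mk, AddHom.coe_mk, map_add, LinearMap.add_apply])
    (fun c y z => by
      rw [← map_smul]; congr 1; ext x
      simp only [curvatureMap, LinearMap.coe_mk, AddHom.coe_mk, map_smul, LinearMap.smul_apply])

/-- The Ricci operator, `⟨ric x, y⟩ = Ric(x, y)`. -/
def ricciOp (B : InnerProd g) : Module.End ℝ g :=
  B.riesz.symm.toLinearMap ∘ₗ ricci B

theorem form_ricciOp (B : InnerProd g) (x y : g) :
    B.form (ricciOp B x) y = ricci B x y :=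
  B.riesz_symm_apply (ricci B x) y

variable (g)

/-- The set of Ricci-maximal points: lines spanned by an eigenvector of the Ricci operator of some
inner product, for its maximal eigenvalue. -/
def ricciMaximal : Set (ℙ ℝ g) :=
  {p | ∃ (B : InnerProd g) (x : g) (hx : x ≠ 0) (μ : ℝ),
    Projectivization.mk ℝ x hx = p ∧ ricciOp B x = μ • x ∧
      ∀ ν : ℝ, (ricciOp B).HasEigenvalue ν → ν ≤ μ}

/-- The set of Ricci-minimal points: lines spanned by an eigenvector of the Ricci operator of some
inner product, for its minimal eigenvalue. -/
def ricciMinimal : Set (ℙ ℝ g) :=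
  {p | ∃ (B : InnerProd g) (x : g) (hx : x ≠ 0) (μ : ℝ),
    Projectivization.mk ℝ x hx = p ∧ ricciOp B x = μ • x ∧
      ∀ ν : ℝ, (ricciOp B).HasEigenvalue ν → μ ≤ ν}

end Curvature

section LieNotions

variable {g : Type*} [LieRing g] [LieAlgebra ℝ g]

variable (g) in
/-- `g` is two-step nilpotent: `[g, [g, g]] = 0`, and `g` is not abelian. -/
def IsTwoStepNilpotent : Prop :=
  (∀ x y z : g, ⁅x, ⁅y, z⁆⁆ = 0) ∧ ∃ x y : g, ⁅x, y⁆ ≠ 0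

/-- `a` is an abelian ideal of `g` of codimension one. -/
def IsCodimOneAbelian (a : LieIdeal ℝ g) : Prop :=
  (∀ x ∈ a, ∀ y ∈ a, ⁅x, y⁆ = 0) ∧ Module.finrank ℝ (g ⧸ a.toSubmodule) = 1

variable (g) in
/-- The derived algebra `[g, g]`, the linear span of all brackets. -/
def derivedAlgebra : Submodule ℝ g :=
  (⁅(⊤ : LieIdeal ℝ g), (⊤ : LieIdeal ℝ g)⁆ : LieIdeal ℝ g).toSubmodule

end LieNotions

end RicciNil

end

/-! In an orthonormal basis the Ricci form of a nilpotent metric Lie algebra is Ric(x, x) = -1/2 Σ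
|[x, e_i]|² + 1/4 Σ ⟨[e_i, e_j], x⟩² (`ricci_eq`), because nilpotency kills both tr ad and the
Killing form. Everything positive therefore comes from pairing with brackets.

Upper bounds. If g is two-step, the maximal eigenvalue is positive, while a vector orthogonal to the
central subspace g' contributes only nonpositive terms. If a is an abelian ideal of codimension one,
the normal to a is Ricci-orthogonal to a and has negative Ricci curvature, while a central vector
shows that the maximal eigenvalue is nonnegative. Linear subspaces are closed in projective space,
so the bounds survive closure. In the two-step case an explicit inner product realizes every line of
g'.

Density by degeneration (`exists_tendsto_extremal`). Rescale a basis by b i ↦ s ^ d i • b i, let s →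
0, and let the inner products follow. The structure constants converge to those of a simpler model.
If in the model no extremal eigenvector has vanishing i₀-coordinate, then by compactness the
i₀-coordinates of the unit extremal eigenvectors stay away from zero in the moving frame. Undoing
the rescaling drives their lines to b i₀, provided that i₀ has strictly lowest weight.

For the maximum there are two models, a filiform one of dimension four and one of dimension five.
With an abelian ideal a, filiform models reach generic lines of a. In the remaining nonabelian case,
take x outside g' with (ad x)² ≠ 0, a dense condition. If x is not in the closure, neither model can
occur. Hence for some y and w = [x, y] with [x, w] ≠ 0, and for generic functionals φ, φ[x, p] =
φ[x, q] = 0 implies φ[p, q] = 0. This is a quadratic identity in φ, and it makes the centralizer of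
w an abelian ideal of codimension one (`exists_isCodimOneAbelian_of_notMem_closure`), a
contradiction.

For the minimum the model is the semidirect product of ℝx with an abelian hyperplane. It applies to
generic x unless all brackets are proportional, in which case a direct choice of metric works
(`mem_ricciMinimal_of_heisenberg`). -/

noncomputable section

namespace RicciNil

open Filter Topology

/-! ### Orthonormal bases, the spectral theorem and Rayleigh quotients. -/

section InnerProducts

variable {V : Type*} [AddCommGroup V] [Module ℝ V] {ι : Type*} [DecidableEq ι]

/-- The basis `f` is orthonormal for the inner product `B`. -/
def IsONB (B : InnerProd V) (f : Module.Basis ι ℝ V) : Prop :=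
  ∀ i j, B.form (f i) (f j) = if i = j then 1 else 0

/-- The inner product for which a given basis is orthonormal. -/
def InnerProd.ofBasis [Fintype ι] (f : Module.Basis ι ℝ V) : InnerProd V where
  form := LinearMap.mk₂ ℝ (fun x y => ∑ i, f.repr x i * f.repr y i)
    (fun x x' y => by simp [add_mul, Finset.sum_add_distrib])
    (fun c x y => by simp [Finset.mul_sum, mul_assoc])
    (fun x y y' => by simp [mul_add, Finset.sum_add_distrib])
    (fun c x y => by simp [Finset.mul_sum, mul_left_comm])
  symm x y := by simp [mul_comm]
  pos x hx := by
    simp only [LinearMap.mk₂_apply]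
    obtain ⟨i, hi⟩ : ∃ i, f.repr x i ≠ 0 := by
      by_contra! h
      exact hx (f.repr.map_eq_zero_iff.mp (Finsupp.ext h))
    exact Finset.sum_pos' (fun i _ => mul_self_nonneg _)
      ⟨i, Finset.mem_univ _, mul_self_pos.mpr hi⟩

theorem InnerProd.ofBasis_form [Fintype ι] (f : Module.Basis ι ℝ V) (x y : V) :
    (InnerProd.ofBasis f).form x y = ∑ i, f.repr x i * f.repr y i := rfl

theorem isONB_ofBasis [Fintype ι] (f : Module.Basis ι ℝ V) : IsONB (InnerProd.ofBasis f) f := by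
  intro i j
  rw [InnerProd.ofBasis_form]
  simp [Finsupp.single_apply]

theorem IsONB.repr_eq {B : InnerProd V} {f : Module.Basis ι ℝ V} [Fintype ι] (hf : IsONB B f)
    (x : V) (i : ι) : B.form x (f i) = f.repr x i := by
  conv_lhs => rw [← f.sum_repr x]
  simp only [map_sum, LinearMap.sum_apply, map_smul, LinearMap.smul_apply, hf _ _, smul_eq_mul]
  simp

theorem IsONB.form_eq {B : InnerProd V} {f : Module.Basis ι ℝ V} [Fintype ι] (hf : IsONB B f)
    (x y : V) : B.form x y = ∑ i, B.form x (f i) * B.form y (f i) := by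
  conv_lhs => rw [← f.sum_repr y]
  simp only [map_sum, map_smul, hf.repr_eq, smul_eq_mul, mul_comm]

theorem IsONB.sum_smul {B : InnerProd V} {f : Module.Basis ι ℝ V} [Fintype ι] (hf : IsONB B f)
    (x : V) : ∑ i, B.form x (f i) • f i = x := by
  simp [hf.repr_eq, f.sum_repr]

theorem IsONB.trace_eq {B : InnerProd V} {f : Module.Basis ι ℝ V} [Fintype ι] (hf : IsONB B f)
    (T : Module.End ℝ V) : LinearMap.trace ℝ V T = ∑ i, B.form (T (f i)) (f i) := by
  rw [LinearMap.trace_eq_matrix_trace ℝ f, Matrix.trace]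
  simp [LinearMap.toMatrix_apply, hf.repr_eq]

theorem InnerProd.form_self_eq_zero (B : InnerProd V) {x : V} : B.form x x = 0 ↔ x = 0 := by
  refine ⟨fun h => ?_, fun h => by simp [h]⟩
  by_contra hx
  exact (B.pos x hx).ne' h

theorem InnerProd.form_self_nonneg (B : InnerProd V) (x : V) : 0 ≤ B.form x x := by
  by_cases hx : x = 0
  · simp [hx]
  · exact (B.pos x hx).le

/-- The spectral theorem for an operator that is symmetric with respect to an inner product. -/
theorem exists_isONB_eigenvectors [FiniteDimensional ℝ V] (B : InnerProd V) (T : Module.End ℝ V)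
    (hT : ∀ x y, B.form (T x) y = B.form x (T y)) :
    ∃ (f : Module.Basis (Fin (Module.finrank ℝ V)) ℝ V) (l : Fin (Module.finrank ℝ V) → ℝ),
      IsONB B f ∧ ∀ i, T (f i) = l i • f i := by
  let core : InnerProductSpace.Core ℝ V :=
    { inner := fun x y => B.form x y
      conj_inner_symm := fun x y => B.symm y x
      re_inner_nonneg := fun x => B.form_self_nonneg x
      add_left := fun x y z => by simp
      smul_left := fun x y r => by simp
      definite := fun x h => B.form_self_eq_zero.mp h }
  let _ : NormedAddCommGroup V := core.toNormedAddCommGroup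
  let _ : InnerProductSpace ℝ V := InnerProductSpace.ofCore core.toCore
  have hs : T.IsSymmetric := fun x y => hT x y
  refine ⟨(hs.eigenvectorBasis rfl).toBasis, fun i => hs.eigenvalues rfl i, fun i j => ?_,
    fun i => ?_⟩
  · have := orthonormal_iff_ite.mp (hs.eigenvectorBasis rfl).orthonormal i j
    rw [OrthonormalBasis.coe_toBasis]
    exact this
  · simp

theorem exists_isONB [FiniteDimensional ℝ V] (B : InnerProd V) :
    ∃ f : Module.Basis (Fin (Module.finrank ℝ V)) ℝ V, IsONB B f :=
  let ⟨f, _, hf, _⟩ := exists_isONB_eigenvectors B 0 (by simp)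
  ⟨f, hf⟩

/-- A symmetric operator on a nonzero space has an eigenvector for its maximal eigenvalue. -/
theorem exists_top_eigenvector [FiniteDimensional ℝ V] [Nontrivial V] (B : InnerProd V)
    (T : Module.End ℝ V) (hT : ∀ x y, B.form (T x) y = B.form x (T y)) :
    ∃ (x : V) (μ : ℝ), x ≠ 0 ∧ T x = μ • x ∧ ∀ v, B.form (T v) v ≤ μ * B.form v v := by
  obtain ⟨f, l, hf, hl⟩ := exists_isONB_eigenvectors B T hT
  have : Nonempty (Fin (Module.finrank ℝ V)) := ⟨⟨0, Module.finrank_pos⟩⟩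
  obtain ⟨i, hi⟩ := Finite.exists_max l
  refine ⟨f i, l i, f.ne_zero i, hl i, fun v => ?_⟩
  rw [hf.form_eq, hf.form_eq v v, Finset.mul_sum]
  refine Finset.sum_le_sum fun j _ => ?_
  rw [hT, hl, map_smul, smul_eq_mul, mul_assoc]
  exact mul_le_mul_of_nonneg_right (hi j) (mul_self_nonneg _)

/-- A vector at which the Rayleigh quotient of a symmetric operator is maximal is an
eigenvector. -/
theorem eigenvector_of_rayleigh (B : InnerProd V) (T : Module.End ℝ V)
    (hT : ∀ x y, B.form (T x) y = B.form x (T y)) {x : V} {μ : ℝ}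
    (hx : B.form (T x) x = μ * B.form x x) (h : ∀ v, B.form (T v) v ≤ μ * B.form v v) :
    T x = μ • x := by
  set y := T x - μ • x with hy
  suffices B.form y y = 0 from sub_eq_zero.mp (B.form_self_eq_zero.mp this)
  have key : ∀ t : ℝ, 2 * t * B.form y y ≤ t ^ 2 * (μ * B.form y y - B.form (T y) y) := by
    intro t
    have h1 := h (x + t • y)
    have e1 : B.form (T x) y = B.form y y + μ * B.form x y := by
      nth_rw 2 [hy]
      simp
    simp only [map_add, map_smul, LinearMap.add_apply, LinearMap.smul_apply, smul_eq_mul] at h1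
    rw [hT y x, B.symm y (T x), e1, B.symm y x] at h1
    linarith
  by_contra hne
  have hpos : 0 < B.form y y := lt_of_le_of_ne (B.form_self_nonneg y) (Ne.symm hne)
  set c := μ * B.form y y - B.form (T y) y
  have hc : 0 ≤ c := sub_nonneg.mpr (h y)
  -- This value of t turns the inequality into 2(c + 1) ≤ c; the summand 1 covers c = 0.
  have h2 := key (B.form y y / (c + 1))
  have hc1 : 0 < c + 1 := by linarith
  rw [div_pow, mul_div_assoc', div_mul_eq_mul_div, div_mul_eq_mul_div,
    div_le_div_iff₀ hc1 (by positivity)] at h2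
  have h3 : 0 < (B.form y y) ^ 2 * (c + 1) := by positivity
  nlinarith

end InnerProducts

/-! ### The Ricci tensor of a nilpotent metric Lie algebra, and extremality in variational form. -/

section Ricci

variable {g : Type*} [LieRing g] [LieAlgebra ℝ g]

theorem trace_lie_eq_zero [LieRing.IsNilpotent g] (f : Module.End ℝ g) (x : g)
    (hf : ∀ y, f y = ⁅x, y⁆) : LinearMap.trace ℝ g f = 0 := by
  have : f = LieModule.toEnd ℝ g g x := LinearMap.ext hf
  rw [this]
  exact (LinearMap.isNilpotent_trace_of_isNilpotent
    (LieModule.isNilpotent_toEnd_of_isNilpotent ℝ g g x)).eq_zero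

theorem trace_lie_lie_eq_zero [LieRing.IsNilpotent g] (f : Module.End ℝ g) (x y : g)
    (hf : ∀ z, f z = ⁅x, ⁅y, z⁆⁆) : LinearMap.trace ℝ g f = 0 := by
  have : f = LieModule.toEnd ℝ g g x ∘ₗ LieModule.toEnd ℝ g g y := LinearMap.ext hf
  rw [this]
  exact (LinearMap.isNilpotent_trace_of_isNilpotent
    (LieModule.isNilpotent_toEnd_of_isNilpotent₂ ℝ g g x y)).eq_zero

variable [FiniteDimensional ℝ g]

theorem leviCivita_skew (B : InnerProd g) (x y z : g) :
    B.form (leviCivita B x y) z = - B.form y (leviCivita B x z) := by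
  rw [B.symm y, form_leviCivita, form_leviCivita, ← lie_skew z x, ← lie_skew y x, ← lie_skew z y]
  simp only [map_neg, LinearMap.neg_apply]
  ring

theorem leviCivita_torsion (B : InnerProd g) (x y : g) :
    leviCivita B x y = leviCivita B y x + ⁅x, y⁆ := by
  have h : ∀ z, B.form (leviCivita B x y - leviCivita B y x - ⁅x, y⁆) z = 0 := by
    intro z
    simp only [map_sub, LinearMap.sub_apply, form_leviCivita]
    rw [← lie_skew z y, ← lie_skew x z, ← lie_skew y x]
    simp only [map_neg, LinearMap.neg_apply]
    ring
  have := B.form_self_eq_zero.mp (h _)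
  rw [sub_sub] at this
  rw [sub_eq_zero.mp this]

variable [LieRing.IsNilpotent g] {ι : Type*} [Fintype ι] [DecidableEq ι]

/-- The Ricci tensor of a metric nilpotent Lie algebra in an orthonormal basis. -/
theorem ricci_eq {B : InnerProd g} {e : Module.Basis ι ℝ g} (he : IsONB B e) (x y : g) :
    ricci B x y = -(1 / 2) * ∑ i, B.form ⁅x, e i⁆ ⁅y, e i⁆
      + 1 / 4 * ∑ i, ∑ j, B.form ⁅e i, e j⁆ x * B.form ⁅e i, e j⁆ y := by
  -- The vector Σ ∇_{e_i} e_i represents the functional w ↦ tr ad w, which vanishes by nilpotency.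
  have hdiv : ∀ w, B.form w (∑ i, leviCivita B (e i) (e i)) = 0 := by
    intro w
    have h0 := trace_lie_eq_zero (LieModule.toEnd ℝ g g w) w (fun _ => rfl)
    rw [he.trace_eq] at h0
    rw [map_sum, ← h0]
    refine Finset.sum_congr rfl fun i _ => ?_
    rw [B.symm, form_leviCivita, ← lie_skew (e i) w, lie_self, LieModule.toEnd_apply_apply]
    simp only [map_neg, map_zero, LinearMap.zero_apply, LinearMap.neg_apply]
    ring
  have h1 : ricci B x y = ∑ i, (B.form (leviCivita B (e i) y) (leviCivita B (e i) x)
      - B.form ⁅e i, y⁆ ⁅e i, x⁆) - ∑ i, B.form ⁅⁅e i, x⁆, y⁆ (e i)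
      - B.form (leviCivita B x y) (∑ i, leviCivita B (e i) (e i)) := by
    have : ricci B x y = LinearMap.trace ℝ g (curvatureMap B x y) := rfl
    rw [this, he.trace_eq, map_sum, ← Finset.sum_sub_distrib, ← Finset.sum_sub_distrib]
    refine Finset.sum_congr rfl fun i _ => ?_
    have : curvatureMap B x y (e i) = leviCivita B (e i) (leviCivita B x y)
      - leviCivita B x (leviCivita B (e i) y) - leviCivita B ⁅e i, x⁆ y := rfl
    rw [this]
    simp only [map_sub, LinearMap.sub_apply]
    rw [leviCivita_skew B (e i) (leviCivita B x y), leviCivita_skew B x _ (e i),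
      leviCivita_torsion B x (e i)]
    have k1 := form_leviCivita B (e i) y ⁅e i, x⁆
    have k2 := form_leviCivita B ⁅e i, x⁆ y (e i)
    rw [← lie_skew x (e i), map_add, map_neg]
    rw [← lie_skew y (e i)] at k2
    rw [← lie_skew y ⁅e i, x⁆, ← lie_skew ⁅e i, x⁆ (e i)] at k1
    simp only [map_neg, LinearMap.neg_apply] at k1 k2
    linarith
  have h2 : ∑ i, B.form ⁅⁅e i, x⁆, y⁆ (e i) = 0 := by
    rw [← trace_lie_lie_eq_zero (LieModule.toEnd ℝ g g y ∘ₗ LieModule.toEnd ℝ g g x) y x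
      (fun _ => rfl), he.trace_eq]
    refine Finset.sum_congr rfl fun i _ => ?_
    rw [← lie_skew ⁅e i, x⁆ y, ← lie_skew (e i) x, lie_neg, neg_neg]
    rfl
  -- The left side is the Killing form written in coordinates.
  have h3 : ∑ i, ∑ j, B.form ⁅e i, y⁆ (e j) * B.form ⁅e j, x⁆ (e i) = 0 := by
    rw [← trace_lie_lie_eq_zero (LieModule.toEnd ℝ g g x ∘ₗ LieModule.toEnd ℝ g g y) x y
      (fun _ => rfl), he.trace_eq]
    refine Finset.sum_congr rfl fun i _ => ?_
    simp only [LinearMap.comp_apply, LieModule.toEnd_apply_apply]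
    conv_rhs => rw [← he.sum_smul ⁅y, e i⁆]
    simp only [lie_sum, lie_smul, map_sum, map_smul, LinearMap.sum_apply, LinearMap.smul_apply,
      smul_eq_mul]
    refine Finset.sum_congr rfl fun j _ => ?_
    rw [← lie_skew (e i) y, ← lie_skew (e j) x]
    simp only [map_neg, LinearMap.neg_apply, neg_mul_neg]
  have h4 : ∑ i, B.form (leviCivita B (e i) y) (leviCivita B (e i) x)
      = 1 / 2 * ∑ i, B.form ⁅x, e i⁆ ⁅y, e i⁆
      + 1 / 4 * ∑ i, ∑ j, B.form ⁅e i, e j⁆ x * B.form ⁅e i, e j⁆ y := by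
    -- By the Koszul formula the j-th coordinate of ∇_{e_i} z is (α z i j + α z j i - β z i j) / 2.
    -- In the expanded product the mixed αα terms vanish by `h3`, and the αβ terms combine because β
    -- is skew in i, j.
    set α : g → ι → ι → ℝ := fun z i j => B.form ⁅e i, z⁆ (e j) with hα
    set β : g → ι → ι → ℝ := fun z i j => B.form ⁅e i, e j⁆ z with hβ
    have hβs : ∀ z i j, β z i j = - β z j i := by
      intro z i j
      simp only [hβ]
      rw [← lie_skew (e i) (e j)]
      simp only [map_neg, LinearMap.neg_apply]
    have e1 : ∑ i, B.form (leviCivita B (e i) y) (leviCivita B (e i) x)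
      = ∑ i, ∑ j, 1 / 4 * ((α y i j + α y j i - β y i j) * (α x i j + α x j i - β x i j)) := by
      refine Finset.sum_congr rfl fun i _ => ?_
      rw [he.form_eq]
      refine Finset.sum_congr rfl fun j _ => ?_
      rw [form_leviCivita, form_leviCivita, ← lie_skew y (e j), ← lie_skew x (e j),
        ← lie_skew (e j) (e i)]
      simp only [map_neg, LinearMap.neg_apply, hα, hβ]
      ring
    have e2 : ∑ i, B.form ⁅x, e i⁆ ⁅y, e i⁆ = ∑ i, ∑ j, α y i j * α x i j := by
      refine Finset.sum_congr rfl fun i _ => ?_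
      rw [he.form_eq]
      refine Finset.sum_congr rfl fun j _ => ?_
      rw [← lie_skew x, ← lie_skew y]
      simp only [hα, map_neg, LinearMap.neg_apply, neg_mul_neg, mul_comm]
    have e3 : ∑ i, ∑ j, B.form ⁅e i, e j⁆ x * B.form ⁅e i, e j⁆ y
      = ∑ i, ∑ j, β y i j * β x i j := by simp [hβ, mul_comm]
    have s1 : ∑ i, ∑ j, α y j i * α x j i = ∑ i, ∑ j, α y i j * α x i j := Finset.sum_comm
    have s2 : ∑ i, ∑ j, α y j i * α x i j = 0 := by
      rw [Finset.sum_comm, ← h3]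
    have s2' : ∑ i, ∑ j, α y i j * α x j i = 0 := h3
    have s3 : ∀ u v : g, ∑ i, ∑ j, α u j i * β v i j = -∑ i, ∑ j, α u i j * β v i j := by
      intro u v
      rw [Finset.sum_comm, ← Finset.sum_neg_distrib]
      refine Finset.sum_congr rfl fun i _ => ?_
      rw [← Finset.sum_neg_distrib]
      refine Finset.sum_congr rfl fun j _ => ?_
      rw [hβs]; ring
    rw [e1, e2, e3]
    have e4 : ∑ i, ∑ j, 1 / 4 * ((α y i j + α y j i - β y i j) * (α x i j + α x j i - β x i j))
      = 1 / 4 * (∑ i, ∑ j, α y i j * α x i j + ∑ i, ∑ j, α y i j * α x j i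
        - ∑ i, ∑ j, α y i j * β x i j + ∑ i, ∑ j, α y j i * α x i j + ∑ i, ∑ j, α y j i * α x j i
        - ∑ i, ∑ j, α y j i * β x i j - ∑ i, ∑ j, α x i j * β y i j
        - ∑ i, ∑ j, α x j i * β y i j + ∑ i, ∑ j, β y i j * β x i j) := by
      simp only [← Finset.sum_add_distrib, ← Finset.sum_sub_distrib, Finset.mul_sum]
      refine Finset.sum_congr rfl fun i _ => Finset.sum_congr rfl fun j _ => ?_
      ring
    rw [e4, s1, s2, s2', s3, s3]
    ring
  have h5 : ∑ i, B.form ⁅e i, y⁆ ⁅e i, x⁆ = ∑ i, B.form ⁅x, e i⁆ ⁅y, e i⁆ := by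
    refine Finset.sum_congr rfl fun i _ => ?_
    rw [← lie_skew x, ← lie_skew y, B.symm]
    simp only [map_neg, LinearMap.neg_apply, neg_neg]
  rw [h1, hdiv, h2, Finset.sum_sub_distrib, h4, h5]
  ring

theorem ricci_symm (B : InnerProd g) (x y : g) : ricci B x y = ricci B y x := by
  obtain ⟨e, he⟩ := exists_isONB B
  rw [ricci_eq he, ricci_eq he]
  simp only [B.symm ⁅x, _⁆, mul_comm (B.form _ x)]

theorem ricciOp_symm (B : InnerProd g) (x y : g) :
    B.form (ricciOp B x) y = B.form x (ricciOp B y) := by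
  rw [B.symm x, form_ricciOp, form_ricciOp, ricci_symm]

/-- By the spectral theorem the largest eigenvalue is the maximum of the Rayleigh quotient. In this
form the set of eigenvalues no longer appears. -/
theorem mk_mem_ricciMaximal_iff {x : g} (hx : x ≠ 0) :
    Projectivization.mk ℝ x hx ∈ ricciMaximal g ↔ ∃ (B : InnerProd g) (μ : ℝ),
      ricciOp B x = μ • x ∧ ∀ v, ricci B v v ≤ μ * B.form v v := by
  constructor
  · rintro ⟨B, y, hy, μ, hyx, hμ, hmax⟩
    refine ⟨B, μ, ?_, fun v => ?_⟩
    · obtain ⟨a, rfl⟩ := (Projectivization.mk_eq_mk_iff' ℝ _ _ hx hy).mp hyx.symm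
      rw [map_smul, hμ, smul_comm]
    · have : Nontrivial g := ⟨x, 0, hx⟩
      obtain ⟨z, ν, hz, hzν, hv⟩ := exists_top_eigenvector B (ricciOp B) (ricciOp_symm B)
      have hle : ν ≤ μ := hmax ν (Module.End.hasEigenvalue_of_hasEigenvector
        ⟨Module.End.mem_eigenspace_iff.mpr hzν, hz⟩)
      rw [← form_ricciOp]
      exact (hv v).trans (mul_le_mul_of_nonneg_right hle (B.form_self_nonneg v))
  · rintro ⟨B, μ, hμ, h⟩
    refine ⟨B, x, hx, μ, rfl, hμ, fun ν hν => ?_⟩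
    obtain ⟨y, hy⟩ := hν.exists_hasEigenvector
    have h1 := h y
    rw [← form_ricciOp, hy.apply_eq_smul, map_smul, LinearMap.smul_apply, smul_eq_mul] at h1
    exact le_of_mul_le_mul_right h1 (B.pos y hy.2)

theorem mk_mem_ricciMinimal {x : g} (hx : x ≠ 0) (B : InnerProd g) (μ : ℝ)
    (hμ : ricciOp B x = μ • x) (h : ∀ v, μ * B.form v v ≤ ricci B v v) :
    Projectivization.mk ℝ x hx ∈ ricciMinimal g := by
  refine ⟨B, x, hx, μ, rfl, hμ, fun ν hν => ?_⟩
  obtain ⟨y, hy⟩ := hν.exists_hasEigenvector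
  have h1 := h y
  rw [← form_ricciOp, hy.apply_eq_smul, map_smul, LinearMap.smul_apply, smul_eq_mul] at h1
  exact le_of_mul_le_mul_right h1 (B.pos y hy.2)

/-- A minimizer of the Rayleigh quotient is automatically an eigenvector: apply
`eigenvector_of_rayleigh` to the negated Ricci operator. -/
theorem mk_mem_ricciMinimal_of_rayleigh {x : g} (hx : x ≠ 0) (B : InnerProd g) (μ : ℝ)
    (hμ : ricci B x x = μ * B.form x x) (h : ∀ v, μ * B.form v v ≤ ricci B v v) :
    Projectivization.mk ℝ x hx ∈ ricciMinimal g := by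
  refine mk_mem_ricciMinimal hx B μ ?_ h
  have := eigenvector_of_rayleigh B (-ricciOp B) (fun x y => by simp [ricciOp_symm]) (x := x)
    (μ := -μ) (by simp [form_ricciOp, hμ]) (fun v => by
      simpa [form_ricciOp] using h v)
  simpa using this

end Ricci

/-! ### Coordinates of extremal eigenvectors under perturbation. -/

section Compactness

variable {ι : Type*} [Fintype ι]

/-- If no eigenvector of `R₀` with eigenvalue at least `R₀ j j` has vanishing coordinate `i`, then
for matrices close to `R₀` this coordinate is bounded away from zero on unit eigenvectors. -/
theorem exists_eigenvector_coord_bound (R₀ : ι → ι → ℝ) (i j : ι)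
    (h : ∀ (u : ι → ℝ) (μ : ℝ), (∀ b, ∑ a, u a * R₀ a b = μ * u b) → R₀ j j ≤ μ → u i = 0 →
      u = 0) :
    ∃ δ > 0, ∀ᶠ R : ι → ι → ℝ in 𝓝 R₀, ∀ (u : ι → ℝ) (μ : ℝ),
      (∀ b, ∑ a, u a * R a b = μ * u b) → R j j ≤ μ → ∑ a, u a ^ 2 = 1 → δ ≤ |u i| := by
  set q : (ι → ι → ℝ) × (ι → ℝ) → ℝ := fun p => ∑ b, (∑ a, p.2 a * p.1 a b) * p.2 b with hq
  have hqc : Continuous q := by fun_prop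
  set S : Set (ι → ℝ) := {u | ∑ a, u a ^ 2 = 1} with hS
  have hScl : IsClosed S := isClosed_eq (by fun_prop) continuous_const
  have hSc : IsCompact S := by
    refine Metric.isCompact_of_isClosed_isBounded hScl
      ((Metric.isBounded_closedBall (x := (0 : ι → ℝ)) (r := 1)).subset fun u hu => ?_)
    rw [mem_closedBall_zero_iff, pi_norm_le_iff_of_nonneg zero_le_one]
    intro a
    rw [Real.norm_eq_abs, ← sq_le_one_iff_abs_le_one, ← (hu : ∑ a, u a ^ 2 = 1)]
    exact Finset.single_le_sum (f := fun a => u a ^ 2) (fun a _ => sq_nonneg _) (Finset.mem_univ a)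
  -- On unit vectors the eigenvalue equals the Rayleigh quotient `q`, so replacing μ by `q` makes
  -- the eigenvector condition closed in the pair (R, u).
  set F : Set ((ι → ι → ℝ) × (ι → ℝ)) :=
    {p | (∀ b, ∑ a, p.2 a * p.1 a b = q p * p.2 b) ∧ p.1 j j ≤ q p} with hF
  have hFc : IsClosed F := by
    have e : F = (⋂ b, {p | ∑ a, p.2 a * p.1 a b = q p * p.2 b}) ∩ {p | p.1 j j ≤ q p} := by
      ext p
      simp [hF]
    rw [e]
    refine IsClosed.inter (isClosed_iInter fun b => isClosed_eq (by fun_prop) ?_)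
      (isClosed_le (by fun_prop) hqc)
    exact hqc.mul (by fun_prop)
  have hK : IsCompact ((Metric.closedBall R₀ 1 ×ˢ S) ∩ F) :=
    ((isCompact_closedBall R₀ 1).prod hSc).inter_right hFc
  -- With the distance to R₀ added, the function is positive on the whole compact set: a zero would
  -- be an excluded eigenvector of R₀ itself. Within distance δ / 2 of R₀ the coordinate then keeps
  -- at least δ / 2.
  have hpos : ∃ δ > 0, ∀ p ∈ (Metric.closedBall R₀ 1 ×ˢ S) ∩ F, δ ≤ |p.2 i| + dist p.1 R₀ := by
    rcases Set.eq_empty_or_nonempty ((Metric.closedBall R₀ 1 ×ˢ S) ∩ F) with he | hne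
    · exact ⟨1, one_pos, by simp [he]⟩
    obtain ⟨p, hp, hmin⟩ := hK.exists_isMinOn hne
      (f := fun p => |p.2 i| + dist p.1 R₀) (by fun_prop)
    refine ⟨|p.2 i| + dist p.1 R₀, ?_, fun p' hp' => hmin hp'⟩
    by_contra hle
    have h1 := abs_nonneg (p.2 i)
    have h2 : 0 ≤ dist p.1 R₀ := dist_nonneg
    have h3 : p.1 = R₀ := dist_eq_zero.mp (by linarith)
    have h4 : p.2 i = 0 := abs_eq_zero.mp (by linarith)
    have h5 := h p.2 (q p) (by rw [← h3]; exact hp.2.1) (by rw [← h3]; exact hp.2.2) h4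
    have h6 : ∑ a, p.2 a ^ 2 = 1 := hp.1.2
    rw [h5] at h6
    simp at h6
  obtain ⟨δ, hδ, hb⟩ := hpos
  refine ⟨δ / 2, by positivity, ?_⟩
  filter_upwards [Metric.ball_mem_nhds R₀ one_pos, Metric.ball_mem_nhds R₀ (half_pos hδ)] with
    R hR1 hR2 u μ hu hμ h1
  have hqμ : q (R, u) = μ := by
    simp only [hq, hu]
    calc ∑ b, μ * u b * u b = μ * ∑ b, u b ^ 2 := by
          rw [Finset.mul_sum]
          exact Finset.sum_congr rfl fun b _ => by ring
      _ = μ := by rw [h1, mul_one]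
  have := hb (R, u) ⟨⟨Metric.ball_subset_closedBall hR1, h1⟩, by
    refine ⟨fun b => ?_, ?_⟩
    · rw [hqμ]; exact hu b
    · rw [hqμ]; exact hμ⟩
  have hd : dist R R₀ < δ / 2 := hR2
  simp only at this
  linarith

end Compactness

/-! ### Closures in projective space through representatives. -/

section Projective

variable {V : Type*} [AddCommGroup V] [Module ℝ V] [TopologicalSpace V]

/-- Open sets of the quotient topology pull back to open sets of nonzero vectors, so convergence of
representatives suffices. The set `M` may itself be a closure, which permits iterated limits. -/
theorem mk_mem_closure_of_tendsto {α : Type*} {l : Filter α} [l.NeBot] {M : Set (ℙ ℝ V)} {T : V}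
    (hT : T ≠ 0) (y : α → V) (hy : Tendsto y l (𝓝 T))
    (h : ∀ᶠ s in l, ∀ hs : y s ≠ 0, Projectivization.mk ℝ (y s) hs ∈ M)
    (h0 : ∀ᶠ s in l, y s ≠ 0) :
    Projectivization.mk ℝ T hT ∈ closure M := by
  rw [mem_closure_iff]
  intro U hU hTU
  have hU' : IsOpen ((Projectivization.mk' ℝ : {v : V // v ≠ 0} → ℙ ℝ V) ⁻¹' U) := hU
  obtain ⟨O, hO, hOU⟩ := isOpen_induced_iff.mp hU'
  have hTO : T ∈ O := by
    have : (⟨T, hT⟩ : {v : V // v ≠ 0}) ∈ Subtype.val ⁻¹' O := by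
      rw [hOU]; exact hTU
    exact this
  obtain ⟨s, hs1, hs2, hs3⟩ := (h.and (h0.and (hy (hO.mem_nhds hTO)))).exists
  refine ⟨Projectivization.mk ℝ (y s) hs2, ?_, hs1 hs2⟩
  have : (⟨y s, hs2⟩ : {v : V // v ≠ 0}) ∈ Subtype.val ⁻¹' O := hs3
  rw [hOU] at this
  exact this

end Projective

/-! ### Degeneration of metrics by weighted rescaling of a basis. -/

section Contraction

variable {g : Type*} [LieRing g] [LieAlgebra ℝ g] [FiniteDimensional ℝ g] [LieRing.IsNilpotent g]
  {ι : Type*} [Fintype ι]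

/-- The matrix of the Ricci tensor in an orthonormal basis with the structure constants `C`. -/
def ricciMat (C : ι → ι → ι → ℝ) (a b : ι) : ℝ :=
  -(1 / 2) * ∑ i, ∑ k, C a i k * C b i k + 1 / 4 * ∑ i, ∑ j, C i j a * C i j b

theorem continuous_ricciMat : Continuous (ricciMat : (ι → ι → ι → ℝ) → ι → ι → ℝ) := by
  unfold ricciMat
  fun_prop

variable [DecidableEq ι]

theorem ricci_ofBasis (f : Module.Basis ι ℝ g) (a b : ι) :
    ricci (InnerProd.ofBasis f) (f a) (f b) = ricciMat (fun i j k => f.repr ⁅f i, f j⁆ k) a b := by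
  have hf := isONB_ofBasis f
  rw [ricci_eq hf, ricciMat]
  simp only [hf.repr_eq, InnerProd.ofBasis_form f ⁅f a, _⁆]

omit [DecidableEq ι] in
theorem ricci_eq_sum (B : InnerProd g) (f : Module.Basis ι ℝ g) (x : g) (b : ι) :
    ricci B x (f b) = ∑ a, f.repr x a * ricci B (f a) (f b) := by
  conv_lhs => rw [← f.sum_repr x]
  simp only [map_sum, map_smul, LinearMap.sum_apply, LinearMap.smul_apply, smul_eq_mul]

/-- The rescaling `b i ↦ s ^ d i • b i` of a basis. -/
def scaling (b : Module.Basis ι ℝ g) (d : ι → ℕ) (s : ℝ) (hs : s ≠ 0) : g ≃ₗ[ℝ] g :=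
  b.equiv (b.unitsSMul fun i => (Units.mk0 s hs) ^ d i) (Equiv.refl ι)

omit [FiniteDimensional ℝ g] [LieRing.IsNilpotent g] [Fintype ι] [DecidableEq ι] in
theorem scaling_apply (b : Module.Basis ι ℝ g) (d : ι → ℕ) (s : ℝ) (hs : s ≠ 0) (i : ι) :
    scaling b d s hs (b i) = s ^ d i • b i := by
  simp [scaling, Module.Basis.unitsSMul_apply, Units.smul_def]

omit [FiniteDimensional ℝ g] [LieRing.IsNilpotent g] [Fintype ι] [DecidableEq ι] in
theorem scaling_symm_apply (b : Module.Basis ι ℝ g) (d : ι → ℕ) (s : ℝ) (hs : s ≠ 0) (i : ι) :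
    (scaling b d s hs).symm (b i) = (s ^ d i)⁻¹ • b i := by
  rw [LinearEquiv.symm_apply_eq, map_smul, scaling_apply, smul_smul,
    inv_mul_cancel₀ (pow_ne_zero _ hs), one_smul]

omit [FiniteDimensional ℝ g] [LieRing.IsNilpotent g] [DecidableEq ι] in
theorem repr_scaling (b : Module.Basis ι ℝ g) (d : ι → ℕ) (s : ℝ) (hs : s ≠ 0) (x : g) (i : ι) :
    b.repr (scaling b d s hs x) i = s ^ d i * b.repr x i := by
  classical
  conv_lhs => rw [← b.sum_repr x]
  simp only [map_sum, map_smul, scaling_apply, Module.Basis.repr_self, Finsupp.coe_finsetSum,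
    Finset.sum_apply, Finsupp.smul_apply, smul_eq_mul, Finsupp.single_apply]
  simp [mul_comm]

-- Rescaling multiplies the coefficient of b k in [b i, b j] by s ^ (d i + d j - d k). So
-- coefficients of positive excess weight disappear in the limit, those of excess zero persist, and
-- those of negative excess must be absent from the start. Here `br` only records the limit; the
-- Jacobi identity is not needed for it.
omit [FiniteDimensional ℝ g] [LieRing.IsNilpotent g] [DecidableEq ι] in
theorem tendsto_scaled_structure (b f : Module.Basis ι ℝ g) (d : ι → ℕ) (br : g →ₗ[ℝ] g →ₗ[ℝ] g)
    (hbr : ∀ i j k, (d k < d i + d j ∧ b.repr (br (b i) (b j)) k = 0)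
      ∨ (b.repr ⁅b i, b j⁆ k = 0 ∧ b.repr (br (b i) (b j)) k = 0)
      ∨ (d k = d i + d j ∧ b.repr (br (b i) (b j)) k = b.repr ⁅b i, b j⁆ k))
    (h : ℝ → g ≃ₗ[ℝ] g) (hh : ∀ s (hs : s ≠ 0), h s = scaling b d s hs) (i j k : ι) :
    Tendsto (fun s => (f.map (h s)).repr ⁅f.map (h s) i, f.map (h s) j⁆ k) (𝓝[>] 0)
      (𝓝 (f.repr (br (f i) (f j)) k)) := by
  have key : ∀ x y : g, (br x y) = ∑ p, ∑ q, ∑ m,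
      (b.repr x p * b.repr y q * b.repr (br (b p) (b q)) m) • b m := by
    intro x y
    conv_lhs => rw [← b.sum_repr x, ← b.sum_repr y]
    have e : ∀ p q, ∑ m, (b.repr x p * b.repr y q * b.repr (br (b p) (b q)) m) • b m
        = b.repr x p • b.repr y q • br (b p) (b q) := by
      intro p q
      simp only [mul_smul, ← Finset.smul_sum, b.sum_repr]
    simp only [e]
    simp only [map_sum, map_smul, LinearMap.sum_apply, LinearMap.smul_apply, Finset.smul_sum]
    rw [Finset.sum_comm]
    exact Finset.sum_congr rfl fun p _ => Finset.sum_congr rfl fun q _ => smul_comm _ _ _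
  have key2 : ∀ s : ℝ, s ≠ 0 → (h s).symm ⁅h s (f i), h s (f j)⁆ = ∑ p, ∑ q, ∑ m,
      (b.repr (f i) p * b.repr (f j) q *
        (s ^ d p * s ^ d q * b.repr ⁅b p, b q⁆ m * (s ^ d m)⁻¹)) • b m := by
    intro s hs
    conv_lhs => rw [← b.sum_repr (f i), ← b.sum_repr (f j)]
    rw [hh s hs]
    simp only [map_sum, map_smul, scaling_apply, sum_lie, lie_sum, smul_lie, lie_smul,
      Finset.smul_sum]
    rw [Finset.sum_comm]
    refine Finset.sum_congr rfl fun p _ => Finset.sum_congr rfl fun q _ => ?_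
    conv_lhs => rw [← b.sum_repr ⁅b p, b q⁆]
    simp only [map_sum, map_smul, scaling_symm_apply, Finset.smul_sum, smul_smul]
    refine Finset.sum_congr rfl fun m _ => ?_
    congr 1
    ring
  have e1 : ∀ s, (f.map (h s)).repr ⁅f.map (h s) i, f.map (h s) j⁆ k
      = f.repr ((h s).symm ⁅h s (f i), h s (f j)⁆) k := fun s => rfl
  simp only [e1]
  have e2 : ∀ (c : ι → ι → ι → ℝ), f.repr (∑ p, ∑ q, ∑ m,
      (b.repr (f i) p * b.repr (f j) q * c p q m) • b m) k
      = ∑ p, ∑ q, ∑ m, (b.repr (f i) p * b.repr (f j) q * c p q m) * f.repr (b m) k := by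
    intro c
    simp only [map_sum, map_smul, Finsupp.coe_finsetSum, Finset.sum_apply, Finsupp.smul_apply,
      smul_eq_mul]
  rw [key, e2 fun p q m => b.repr (br (b p) (b q)) m]
  have hev : ∀ᶠ s : ℝ in 𝓝[>] 0, ∑ p, ∑ q, ∑ m, (b.repr (f i) p * b.repr (f j) q *
        (s ^ d p * s ^ d q * b.repr ⁅b p, b q⁆ m * (s ^ d m)⁻¹)) * f.repr (b m) k
      = f.repr ((h s).symm ⁅h s (f i), h s (f j)⁆) k := by
    filter_upwards [self_mem_nhdsWithin] with s hs
    rw [key2 s (ne_of_gt hs), e2 fun p q m => s ^ d p * s ^ d q * b.repr ⁅b p, b q⁆ m * (s ^ d m)⁻¹]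
  refine Tendsto.congr' hev (tendsto_finsetSum _ fun p _ => tendsto_finsetSum _ fun q _ =>
    tendsto_finsetSum _ fun m _ => Tendsto.mul_const _ (Tendsto.const_mul _ ?_))
  rcases hbr p q m with ⟨h1, h2⟩ | ⟨h1, h2⟩ | ⟨h1, h2⟩
  · rw [h2]
    have hev : ∀ᶠ s : ℝ in 𝓝[>] 0, s ^ (d p + d q - d m) * b.repr ⁅b p, b q⁆ m
        = s ^ d p * s ^ d q * b.repr ⁅b p, b q⁆ m * (s ^ d m)⁻¹ := by
      filter_upwards [self_mem_nhdsWithin] with s hs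
      have hs : s ≠ 0 := ne_of_gt hs
      rw [← pow_add, pow_sub₀ s hs h1.le]
      ring
    refine Tendsto.congr' hev ?_
    have : Tendsto (fun s : ℝ => s ^ (d p + d q - d m) * b.repr ⁅b p, b q⁆ m) (𝓝 0)
        (𝓝 ((0 : ℝ) ^ (d p + d q - d m) * b.repr ⁅b p, b q⁆ m)) := by
      apply Continuous.tendsto
      fun_prop
    rw [zero_pow (by omega), zero_mul] at this
    exact this.mono_left nhdsWithin_le_nhds
  · simp [h1, h2]
  · rw [h2]
    refine Tendsto.congr' ?_ tendsto_const_nhds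
    filter_upwards [self_mem_nhdsWithin] with s hs
    have hs : s ≠ 0 := ne_of_gt hs
    rw [← pow_add, ← h1]
    field_simp

/-- Degeneration of the metric: the inner products for which the basis `f`, rescaled by
`b i ↦ s ^ d i • b i`, is orthonormal, have Ricci eigenvectors with extremal eigenvalue that tend to
`b i₀`, provided that the limiting structure constants allow no such eigenvector in the
complementary hyperplane. The sign `σ` distinguishes between the maximum and the minimum. -/
theorem exists_tendsto_extremal [TopologicalSpace g] [IsTopologicalAddGroup g]
    [ContinuousSMul ℝ g] (σ : ℝ) (hσ : σ ≠ 0) (b f : Module.Basis ι ℝ g) (d : ι → ℕ)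
    (br : g →ₗ[ℝ] g →ₗ[ℝ] g)
    (hbr : ∀ i j k, (d k < d i + d j ∧ b.repr (br (b i) (b j)) k = 0)
      ∨ (b.repr ⁅b i, b j⁆ k = 0 ∧ b.repr (br (b i) (b j)) k = 0)
      ∨ (d k = d i + d j ∧ b.repr (br (b i) (b j)) k = b.repr ⁅b i, b j⁆ k))
    (i₀ j₀ : ι) (hd : ∀ i, i ≠ i₀ → d i₀ < d i)
    (hf : ∀ i, b.repr (f i) i₀ = if i = i₀ then 1 else 0)
    (C : ι → ι → ι → ℝ) (hC : ∀ i j k, f.repr (br (f i) (f j)) k = C i j k)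
    (h : ∀ (u : ι → ℝ) (μ : ℝ), (∀ k, ∑ a, u a * ricciMat C a k = μ * u k) →
      σ * ricciMat C j₀ j₀ ≤ σ * μ → u i₀ = 0 → u = 0) :
    ∃ y : ℝ → g, Tendsto y (𝓝[>] 0) (𝓝 (b i₀)) ∧ ∀ᶠ s in 𝓝[>] 0, y s ≠ 0 ∧
      ∃ (B : InnerProd g) (μ : ℝ), ricciOp B (y s) = μ • y s ∧
        ∀ v, σ * ricci B v v ≤ σ * (μ * B.form v v) := by
  have : Nontrivial g := ⟨b i₀, 0, b.ne_zero i₀⟩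
  set H : ℝ → g ≃ₗ[ℝ] g := fun s => if hs : s ≠ 0 then scaling b d s hs else LinearEquiv.refl ℝ g
    with hH
  have hh : ∀ s (hs : s ≠ 0), H s = scaling b d s hs := fun s hs => by simp [hH, hs]
  set F : ℝ → Module.Basis ι ℝ g := fun s => f.map (H s) with hFdef
  set Cs : ℝ → ι → ι → ι → ℝ := fun s i j k => (F s).repr ⁅F s i, F s j⁆ k with hCs
  have hlim : Tendsto Cs (𝓝[>] 0) (𝓝 C) := by
    simp only [tendsto_pi_nhds]
    intro i j k
    rw [← hC]
    exact tendsto_scaled_structure b f d br hbr H hh i j k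
  obtain ⟨δ, hδ, hev⟩ := exists_eigenvector_coord_bound (fun a c => σ * ricciMat C a c) i₀ j₀ (by
    intro u μ hu hμ h0
    refine h u (μ / σ) (fun k => ?_) (by rwa [mul_div_cancel₀ _ hσ]) h0
    rw [div_mul_eq_mul_div, ← hu k, eq_div_iff hσ, Finset.sum_mul]
    exact Finset.sum_congr rfl fun a _ => by ring)
  have hev2 : ∀ᶠ s in 𝓝[>] (0 : ℝ), ∀ (u : ι → ℝ) (μ : ℝ),
      (∀ k, ∑ a, u a * (σ * ricciMat (Cs s) a k) = μ * u k) → σ * ricciMat (Cs s) j₀ j₀ ≤ μ →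
      ∑ a, u a ^ 2 = 1 → δ ≤ |u i₀| := by
    refine Tendsto.eventually ?_ hev
    have hc : Continuous fun C : ι → ι → ι → ℝ => fun a c => σ * ricciMat C a c :=
      continuous_pi fun a => continuous_pi fun c => continuous_const.mul
        ((continuous_apply c).comp ((continuous_apply a).comp continuous_ricciMat))
    exact (hc.tendsto C).comp hlim
  have htop : ∀ s, ∃ (x : g) (μ : ℝ), ∑ a, (F s).repr x a ^ 2 = 1 ∧
      ricciOp (InnerProd.ofBasis (F s)) x = μ • x ∧
      ∀ v, σ * ricci (InnerProd.ofBasis (F s)) v v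
        ≤ σ * (μ * (InnerProd.ofBasis (F s)).form v v) := by
    intro s
    set B := InnerProd.ofBasis (F s)
    obtain ⟨x, μ, hx, hxμ, hv⟩ := exists_top_eigenvector B (σ • ricciOp B)
      (fun x y => by simp [ricciOp_symm])
    have hN : 0 < B.form x x := B.pos x hx
    refine ⟨(Real.sqrt (B.form x x))⁻¹ • x, μ / σ, ?_, ?_, fun v => ?_⟩
    · have e : B.form x x = ∑ a, (F s).repr x a ^ 2 := by
        rw [InnerProd.ofBasis_form]
        exact Finset.sum_congr rfl fun a _ => (sq _).symm
      simp only [map_smul, Finsupp.smul_apply, smul_eq_mul, mul_pow, ← Finset.mul_sum, ← e]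
      rw [inv_pow, Real.sq_sqrt hN.le, inv_mul_cancel₀ hN.ne']
    · rw [map_smul, smul_comm]
      congr 1
      rw [LinearMap.smul_apply] at hxμ
      rw [div_eq_inv_mul, mul_smul, ← hxμ, smul_smul, inv_mul_cancel₀ hσ, one_smul]
    · have := hv v
      simp only [LinearMap.smul_apply, map_smul, form_ricciOp, smul_eq_mul] at this
      calc _ ≤ _ := this
        _ = _ := by field_simp
  choose x μ hx1 hxμ hxv using htop
  set u : ℝ → ι → ℝ := fun s a => (F s).repr (x s) a with hu
  -- The extremal eigenvalue dominates the diagonal entry at `j₀`, as seen by testing on the unit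
  -- vector `F s j₀`; so the compactness bound applies.
  have hmain : ∀ᶠ s in 𝓝[>] (0 : ℝ), δ ≤ |u s i₀| := by
    filter_upwards [hev2] with s hs
    refine hs (u s) (σ * μ s) (fun k => ?_) ?_ (hx1 s)
    · have e := ricci_eq_sum (InnerProd.ofBasis (F s)) (F s) (x s) k
      rw [← form_ricciOp, hxμ, map_smul, LinearMap.smul_apply, (isONB_ofBasis (F s)).repr_eq,
        smul_eq_mul] at e
      simp only [ricci_ofBasis] at e
      rw [mul_assoc, e, Finset.mul_sum]
      exact Finset.sum_congr rfl fun a _ => by simp only [hu, hCs]; ring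
    · have e := hxv s (F s j₀)
      rw [ricci_ofBasis, isONB_ofBasis (F s) j₀ j₀, if_pos rfl, mul_one] at e
      exact e
  -- Relative to the i₀-coordinate, whose modulus is at least s ^ d i₀ * δ, the m-th one is O(s ^ (d
  -- m - d i₀)). Hence normalizing the i₀-coordinate to 1 gives vectors tending to b i₀.
  have hcoord : ∀ s, s ≠ 0 → ∀ m, b.repr (x s) m = s ^ d m * ∑ a, u s a * b.repr (f a) m := by
    intro s hs m
    conv_lhs => rw [← (F s).sum_repr (x s)]
    simp only [map_sum, map_smul, Finsupp.coe_finsetSum, Finset.sum_apply, Finsupp.smul_apply,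
      smul_eq_mul, hFdef, Module.Basis.map_apply, hh s hs, repr_scaling, Finset.mul_sum]
    refine Finset.sum_congr rfl fun a _ => ?_
    simp only [hu, hFdef, hh s hs]
    ring
  have hu1 : ∀ s a, |u s a| ≤ 1 := by
    intro s a
    rw [← sq_le_one_iff_abs_le_one, ← hx1 s]
    exact Finset.single_le_sum (f := fun a => u s a ^ 2) (fun a _ => sq_nonneg _)
      (Finset.mem_univ a)
  have hcoord0 : ∀ s, s ≠ 0 → b.repr (x s) i₀ = s ^ d i₀ * u s i₀ := by
    intro s hs
    rw [hcoord s hs]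
    simp [hf]
  refine ⟨fun s => (b.repr (x s) i₀)⁻¹ • x s, ?_, ?_⟩
  · have hy : ∀ s, (b.repr (x s) i₀)⁻¹ • x s
        = ∑ m, ((b.repr (x s) i₀)⁻¹ * b.repr (x s) m) • b m := by
      intro s
      simp only [mul_smul, ← Finset.smul_sum, b.sum_repr]
    simp only [hy]
    have e : b i₀ = ∑ m, (if m = i₀ then (1 : ℝ) else 0) • b m := by simp
    rw [e]
    refine tendsto_finsetSum _ fun m _ => Tendsto.smul_const ?_ _
    by_cases hm : m = i₀
    · rw [if_pos hm]
      refine Tendsto.congr' ?_ tendsto_const_nhds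
      filter_upwards [hmain, self_mem_nhdsWithin] with s hs hs0
      have hs0 : s ≠ 0 := ne_of_gt hs0
      have : u s i₀ ≠ 0 := by
        intro h0
        rw [h0, abs_zero] at hs
        linarith
      rw [hm, inv_mul_cancel₀]
      rw [hcoord0 s hs0]
      exact mul_ne_zero (pow_ne_zero _ hs0) this
    · rw [if_neg hm]
      set A := ∑ a, |b.repr (f a) m| with hA
      refine squeeze_zero_norm' (a := fun s => s ^ (d m - d i₀) * (A / δ)) ?_ ?_
      · filter_upwards [hmain, self_mem_nhdsWithin] with s hs hs0
        have hs00 : 0 < s := hs0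
        have hs0 : s ≠ 0 := ne_of_gt hs0
        rw [hcoord0 s hs0, hcoord s hs0, pow_sub₀ s hs0 (hd m hm).le]
        have h1 : |∑ a, u s a * b.repr (f a) m| ≤ A := by
          refine (Finset.abs_sum_le_sum_abs _ _).trans (Finset.sum_le_sum fun a _ => ?_)
          rw [abs_mul]
          exact mul_le_of_le_one_left (abs_nonneg _) (hu1 s a)
        have h2 : |∑ a, u s a * b.repr (f a) m| / |u s i₀| ≤ A / δ :=
          div_le_div₀ (le_trans (abs_nonneg _) h1) h1 hδ hs
        rw [Real.norm_eq_abs, abs_mul, abs_inv, abs_mul, abs_mul, abs_of_pos (pow_pos hs00 _),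
          abs_of_pos (pow_pos hs00 _)]
        calc (s ^ d i₀ * |u s i₀|)⁻¹ * (s ^ d m * |∑ a, u s a * b.repr (f a) m|)
            = s ^ d m * (s ^ d i₀)⁻¹ * (|∑ a, u s a * b.repr (f a) m| / |u s i₀|) := by
              rw [mul_inv, div_eq_mul_inv]; ring
          _ ≤ _ := mul_le_mul_of_nonneg_left h2 (by positivity)
      · have : Tendsto (fun s : ℝ => s ^ (d m - d i₀) * (A / δ)) (𝓝 0)
            (𝓝 ((0 : ℝ) ^ (d m - d i₀) * (A / δ))) := by
          apply Continuous.tendsto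
          fun_prop
        have hlt := hd m hm
        rw [zero_pow (by omega), zero_mul] at this
        exact this.mono_left nhdsWithin_le_nhds
  · filter_upwards [hmain, self_mem_nhdsWithin] with s hs hs0
    have hs0 : s ≠ 0 := ne_of_gt hs0
    have hne : b.repr (x s) i₀ ≠ 0 := by
      rw [hcoord0 s hs0]
      refine mul_ne_zero (pow_ne_zero _ hs0) fun h0 => ?_
      rw [h0, abs_zero] at hs
      linarith
    refine ⟨smul_ne_zero (inv_ne_zero hne) fun h0 => hne (by simp [h0]),
      InnerProd.ofBasis (F s), μ s, ?_, hxv s⟩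
    rw [map_smul, hxμ, smul_comm]

theorem mk_mem_closure_ricciMaximal [TopologicalSpace g] {y : ℝ → g} {T : g} (hT : T ≠ 0)
    (hy : Tendsto y (𝓝[>] 0) (𝓝 T)) (h : ∀ᶠ s in 𝓝[>] 0, y s ≠ 0 ∧
      ∃ (B : InnerProd g) (μ : ℝ), ricciOp B (y s) = μ • y s ∧
        ∀ v, 1 * ricci B v v ≤ 1 * (μ * B.form v v)) :
    Projectivization.mk ℝ T hT ∈ closure (ricciMaximal g) := by
  refine mk_mem_closure_of_tendsto hT y hy (h.mono fun s hs h0 => ?_) (h.mono fun s hs => hs.1)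
  obtain ⟨_, B, μ, h1, h2⟩ := hs
  exact (mk_mem_ricciMaximal_iff h0).mpr ⟨B, μ, h1, by simpa using h2⟩

theorem mk_mem_closure_ricciMinimal [TopologicalSpace g] {y : ℝ → g} {T : g} (hT : T ≠ 0)
    (hy : Tendsto y (𝓝[>] 0) (𝓝 T)) (h : ∀ᶠ s in 𝓝[>] 0, y s ≠ 0 ∧
      ∃ (B : InnerProd g) (μ : ℝ), ricciOp B (y s) = μ • y s ∧
        ∀ v, -1 * ricci B v v ≤ -1 * (μ * B.form v v)) :
    Projectivization.mk ℝ T hT ∈ closure (ricciMinimal g) := by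
  refine mk_mem_closure_of_tendsto hT y hy (h.mono fun s hs h0 => ?_) (h.mono fun s hs => hs.1)
  obtain ⟨_, B, μ, h1, h2⟩ := hs
  exact mk_mem_ricciMinimal h0 B μ h1 fun v => by linarith [h2 v]

end Contraction

/-! ### Structure constants extended by zero. -/

section Tables

variable {m κ : Type*}

/-- Extension of structure constants by zero. -/
def extTable (C : m → m → m → ℝ) : m ⊕ κ → m ⊕ κ → m ⊕ κ → ℝ
  | .inl i, .inl j, .inl k => C i j k
  | _, _, _ => 0

variable [Fintype m] [Fintype κ]

theorem ricciMat_extTable (C : m → m → m → ℝ) (a b : m) :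
    ricciMat (extTable C : m ⊕ κ → _) (.inl a) (.inl b) = ricciMat C a b := by
  simp [ricciMat, extTable]

theorem ricciMat_extTable_inr (C : m → m → m → ℝ) (a : m ⊕ κ) (b : κ) :
    ricciMat (extTable C : m ⊕ κ → _) a (.inr b) = 0 := by
  rcases a with a | a <;> simp [ricciMat, extTable]

theorem ricciMat_extTable_inr_left (C : m → m → m → ℝ) (b : m ⊕ κ) (a : κ) :
    ricciMat (extTable C : m ⊕ κ → _) (.inr a) b = 0 := by
  rcases b with b | b <;> simp [ricciMat, extTable]

/-- The added directions lie in the kernel of the Ricci matrix, while the positive diagonal entry at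
`j₀` forces μ > 0. So an eigenvector to be excluded has no components there, and only the small
table must be examined. -/
theorem extTable_eigenvector (C : m → m → m → ℝ) (i₀ j₀ : m) (hC : 0 < ricciMat C j₀ j₀)
    (h : ∀ (u : m → ℝ) (μ : ℝ), 0 < μ → (∀ k, ∑ a, u a * ricciMat C a k = μ * u k) → u i₀ = 0 →
      u = 0)
    (u : m ⊕ κ → ℝ) (μ : ℝ)
    (hu : ∀ k, ∑ a, u a * ricciMat (extTable C : m ⊕ κ → _) a k = μ * u k)
    (hμ : 1 * ricciMat (extTable C : m ⊕ κ → _) (.inl j₀) (.inl j₀) ≤ 1 * μ)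
    (h0 : u (.inl i₀) = 0) : u = 0 := by
  rw [ricciMat_extTable, one_mul, one_mul] at hμ
  have hμ0 : 0 < μ := hC.trans_le hμ
  have h1 := h (fun a => u (.inl a)) μ hμ0 (fun k => by
    rw [← hu (.inl k), Fintype.sum_sum_type]
    simp [ricciMat_extTable, ricciMat_extTable_inr_left]) h0
  ext a
  rcases a with a | a
  · exact congrFun h1 a
  · have := hu (.inr a)
    simp only [ricciMat_extTable_inr, mul_zero, Finset.sum_const_zero] at this
    simpa [hμ0.ne'] using this.symm

end Tables

/-! ### Adapted bases, shears and rank-one brackets. -/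

section Bases

universe u

variable {V : Type u} [AddCommGroup V] [Module ℝ V]

/-- A linearly independent family in the kernel of `φ` and a vector `z` with `φ z = 1` extend to a
basis for which `φ` is a coordinate function. -/
theorem exists_basis_extending [FiniteDimensional ℝ V] {n : ℕ} (v : Fin n → V)
    (hv : LinearIndependent ℝ v) (φ : Module.Dual ℝ V) (hφ : ∀ i, φ (v i) = 0) (z : V)
    (hz : φ z = 1) :
    ∃ (κ : Type u) (_ : Fintype κ) (_ : DecidableEq κ) (b : Module.Basis (Fin (n + 1) ⊕ κ) ℝ V),
      (∀ i : Fin n, b (.inl i.castSucc) = v i) ∧ b (.inl (Fin.last n)) = z ∧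
        ∀ x, b.repr x (.inl (Fin.last n)) = φ x := by
  classical
  set w : Fin n → LinearMap.ker φ := fun i => ⟨v i, hφ i⟩ with hw
  have hwi : LinearIndependent ℝ w := by
    refine LinearIndependent.of_comp (LinearMap.ker φ).subtype ?_
    exact hv
  set bK := Module.Basis.sumExtend hwi with hbK
  have : Finite (Fin n ⊕ Module.Basis.sumExtendIndex hwi) := Module.Finite.finite_basis bK
  have hfin : Finite (Module.Basis.sumExtendIndex hwi) := Finite.of_injective (Sum.inr : _ → Fin n ⊕ _) Sum.inr_injective
  -- The space splits as ker φ ⊕ ℝz; extending `v` inside ker φ makes φ the coordinate dual to z.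
  let e : (LinearMap.ker φ × ℝ) ≃ₗ[ℝ] V :=
    LinearEquiv.ofBijective
      ((LinearMap.ker φ).subtype.coprod (LinearMap.toSpanSingleton ℝ V z)) (by
        constructor
        · rw [← LinearMap.ker_eq_bot, LinearMap.ker_eq_bot']
          rintro ⟨k, t⟩ hkt
          simp only [LinearMap.coprod_apply, Submodule.subtype_apply,
            LinearMap.toSpanSingleton_apply] at hkt
          have h1 : φ (k + t • z) = 0 := by rw [hkt, map_zero]
          have hk : φ k = 0 := k.2
          rw [map_add, map_smul, hk, hz, zero_add, smul_eq_mul, mul_one] at h1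
          subst h1
          simpa using hkt
        · intro x
          refine ⟨(⟨x - φ x • z, by simp [hz]⟩, φ x), by simp⟩)
  have he : ∀ p, e p = p.1 + p.2 • z := fun p => rfl
  have hbw : ∀ i, bK (.inl i) = w i := by
    intro i
    simp only [hbK, Module.Basis.sumExtend, Module.Basis.reindex_apply, Module.Basis.coe_extend]
    rfl
  let r : (Fin n ⊕ Module.Basis.sumExtendIndex hwi) ⊕ Unit ≃
      Fin (n + 1) ⊕ Module.Basis.sumExtendIndex hwi :=
    (Equiv.sumAssoc _ _ _).trans (((Equiv.refl _).sumCongr (Equiv.sumComm _ _)).trans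
      ((Equiv.sumAssoc _ _ _).symm.trans
        (((Equiv.refl (Fin n)).sumCongr (Equiv.ofUnique Unit (Fin 1))).trans finSumFinEquiv
          |>.sumCongr (Equiv.refl _))))
  set b := ((bK.prod (Module.Basis.singleton Unit ℝ)).map e).reindex r with hb
  have h1 : ∀ i : Fin n, b (.inl i.castSucc) = v i := by
    intro i
    have : r.symm (.inl i.castSucc) = .inl (.inl i) := by
      rw [Equiv.symm_apply_eq]
      rfl
    rw [hb, Module.Basis.reindex_apply, this]
    simp [he, hbw, hw]
  have h2 : b (.inl (Fin.last n)) = z := by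
    have : r.symm (.inl (Fin.last n)) = .inr () := by
      rw [Equiv.symm_apply_eq]
      rfl
    rw [hb, Module.Basis.reindex_apply, this]
    simp [he]
  have h3 : ∀ k, φ (b (.inr k)) = 0 := by
    intro k
    have : r.symm (.inr k) = .inl (.inr k) := by
      rw [Equiv.symm_apply_eq]
      rfl
    rw [hb, Module.Basis.reindex_apply, this]
    simp [he]
  refine ⟨_, Fintype.ofFinite _, inferInstance, b, h1, h2, fun x => ?_⟩
  have : b.coord (.inl (Fin.last n)) = φ := by
    refine b.ext fun i => ?_
    rw [Module.Basis.coord_apply, Module.Basis.repr_self, Finsupp.single_apply]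
    rcases i with i | i
    · refine Fin.lastCases ?_ (fun i => ?_) i
      · rw [h2, hz, if_pos rfl]
      · rw [h1, hφ, if_neg]
        simp
    · rw [h3]
      simp
  exact LinearMap.congr_fun this x

variable {ι : Type*}

/-- The change of basis `b i ↦ b i + δ (b i)` with `δ ∘ δ = 0`. -/
def shear (b : Module.Basis ι ℝ V) (δ : V →ₗ[ℝ] V) (hδ : ∀ x, δ (δ x) = 0) : Module.Basis ι ℝ V :=
  b.map (LinearEquiv.ofLinearMap (LinearMap.id + δ) (LinearMap.id - δ)
    (by ext x; simp [hδ]) (by ext x; simp [hδ]))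

theorem shear_apply (b : Module.Basis ι ℝ V) (δ : V →ₗ[ℝ] V) (hδ : ∀ x, δ (δ x) = 0) (i : ι) :
    shear b δ hδ i = b i + δ (b i) := rfl

/-- The alternating bilinear map `(x, y) ↦ (α x β y - β x α y) z`. -/
def wedgeBracket (α β : Module.Dual ℝ V) (z : V) : V →ₗ[ℝ] V →ₗ[ℝ] V :=
  LinearMap.mk₂ ℝ (fun x y => (α x * β y - β x * α y) • z)
    (fun x x' y => by simp only [map_add]; module)
    (fun c x y => by simp only [map_smul, smul_eq_mul]; module)
    (fun x y y' => by simp only [map_add]; module)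
    (fun c x y => by simp only [map_smul, smul_eq_mul]; module)

theorem wedgeBracket_apply (α β : Module.Dual ℝ V) (x y z : V) :
    wedgeBracket α β z x y = (α x * β y - β x * α y) • z := rfl

end Bases

/-! ### The Ricci matrices of the two models in sheared frames. -/

/-- The structure constants of the basis `e₀, e₁, e₂, e₃` with `[e₀, e₁] = e₂ + e₃` and
`[e₀, e₂] = e₃`. -/
def filiformTable : Fin 4 → Fin 4 → Fin 4 → ℝ :=
  ![![![0, 0, 0, 0], ![0, 0, 1, 1], ![0, 0, 0, 1], ![0, 0, 0, 0]],
    ![![0, 0, -1, -1], ![0, 0, 0, 0], ![0, 0, 0, 0], ![0, 0, 0, 0]],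
    ![![0, 0, 0, -1], ![0, 0, 0, 0], ![0, 0, 0, 0], ![0, 0, 0, 0]],
    ![![0, 0, 0, 0], ![0, 0, 0, 0], ![0, 0, 0, 0], ![0, 0, 0, 0]]]

theorem ricciMat_filiformTable_pos : 0 < ricciMat filiformTable 3 3 := by
  simp [ricciMat, filiformTable, Fin.sum_univ_four]
  norm_num

/-- Row 0 gives u₀ = 0 because its diagonal entry is negative. The nonzero off-diagonal entries
(1,2) and (2,3) then propagate u₁ = 0 to u₂ and u₃. -/
theorem filiformTable_eigenvector (u : Fin 4 → ℝ) (μ : ℝ) (hμ : 0 < μ)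
    (hu : ∀ k, ∑ a, u a * ricciMat filiformTable a k = μ * u k) (h0 : u 1 = 0) : u = 0 := by
  have e0 := hu 0
  have e1 := hu 1
  have e2 := hu 2
  simp [ricciMat, filiformTable, Fin.sum_univ_four, h0] at e0 e1 e2
  have u0 : u 0 = 0 := by
    have : (μ + 3 / 2) * u 0 = 0 := by linarith
    rcases mul_eq_zero.mp this with h | h
    · linarith
    · exact h
  have u2 : u 2 = 0 := by linarith
  have u3 : u 3 = 0 := by
    rw [u2] at e2
    linarith
  ext i
  fin_cases i <;> simp [u0, h0, u2, u3]

/-- The structure constants of the basis `e₀, …, e₄` with `[e₀, e₁] = e₂ + e₄`, `[e₀, e₂] = e₄`,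
`[e₀, e₃] = e₄` and `[e₁, e₃] = e₄`. -/
def fiveTable : Fin 5 → Fin 5 → Fin 5 → ℝ :=
  ![![![0, 0, 0, 0, 0], ![0, 0, 1, 0, 1], ![0, 0, 0, 0, 1], ![0, 0, 0, 0, 1], ![0, 0, 0, 0, 0]],
    ![![0, 0, -1, 0, -1], ![0, 0, 0, 0, 0], ![0, 0, 0, 0, 0], ![0, 0, 0, 0, 1], ![0, 0, 0, 0, 0]],
    ![![0, 0, 0, 0, -1], ![0, 0, 0, 0, 0], ![0, 0, 0, 0, 0], ![0, 0, 0, 0, 0], ![0, 0, 0, 0, 0]],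
    ![![0, 0, 0, 0, -1], ![0, 0, 0, 0, -1], ![0, 0, 0, 0, 0], ![0, 0, 0, 0, 0], ![0, 0, 0, 0, 0]],
    ![![0, 0, 0, 0, 0], ![0, 0, 0, 0, 0], ![0, 0, 0, 0, 0], ![0, 0, 0, 0, 0], ![0, 0, 0, 0, 0]]]

theorem ricciMat_fiveTable_pos : 0 < ricciMat fiveTable 4 4 := by
  simp [ricciMat, fiveTable, Fin.sum_univ_five]
  norm_num

/-- With u₀ = 0, row 0 reads u₁ = u₃. Comparing rows 1 and 3 gives u₃ = 0, either of them then gives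
u₂ = 0, and row 2 gives u₄ = 0. -/
theorem fiveTable_eigenvector (u : Fin 5 → ℝ) (μ : ℝ) (hμ : 0 < μ)
    (hu : ∀ k, ∑ a, u a * ricciMat fiveTable a k = μ * u k) (h0 : u 0 = 0) : u = 0 := by
  have e0 := hu 0
  have e1 := hu 1
  have e2 := hu 2
  have e3 := hu 3
  simp [ricciMat, fiveTable, Fin.sum_univ_five, h0] at e0 e1 e2 e3
  have h13 : u 1 = u 3 := by linarith
  rw [h13] at e1 e2 e3
  have u3 : u 3 = 0 := by linarith
  rw [u3] at h13 e2 e3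
  have u2 : u 2 = 0 := by linarith
  rw [u2] at e2
  have u4 : u 4 = 0 := by linarith
  ext i
  fin_cases i <;> simp [h0, h13, u2, u3, u4]

/-! ### Degeneration to the filiform model. -/

section Models

universe u
variable {g : Type u} [LieRing g] [LieAlgebra ℝ g] [FiniteDimensional ℝ g]
  [LieRing.IsNilpotent g]
  [TopologicalSpace g] [IsTopologicalAddGroup g] [ContinuousSMul ℝ g]

set_option maxHeartbeats 1000000 in
/-- Degeneration to the four-dimensional filiform algebra `[x, t] = w`, `[x, w] = z`. -/
theorem mem_closure_ricciMaximal_of_filiform {x t : g} (ht : t ≠ 0) (φ : Module.Dual ℝ g)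
    (hφx : φ x = 0) (hφt : φ t = 0) (hφw : φ ⁅x, t⁆ = 0) (hφz : φ ⁅x, ⁅x, t⁆⁆ = 1)
    (hφtw : φ ⁅t, ⁅x, t⁆⁆ = 0) :
    Projectivization.mk ℝ t ht ∈ closure (ricciMaximal g) := by
  set w := ⁅x, t⁆ with hw
  set z := ⁅x, w⁆ with hz
  have hli : LinearIndependent ℝ ![x, t, w] := by
    rw [Fintype.linearIndependent_iff]
    intro c hc
    simp only [Fin.sum_univ_three, Matrix.cons_val_zero, Matrix.cons_val_one,
      Matrix.cons_val_two, Matrix.head_cons, Matrix.tail_cons] at hc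
    have h2 : c 2 = 0 := by
      have := congrArg (fun v => φ ⁅x, v⁆) hc
      simpa [hφw, hφz, ← hw, ← hz] using this
    rw [h2, zero_smul, add_zero] at hc
    have hw0 : w ≠ 0 := by
      intro h0
      rw [hz, h0] at hφz
      simp at hφz
    have h1 : c 1 = 0 := by
      have := congrArg (fun v => ⁅x, v⁆) hc
      simpa [← hw, hw0] using this
    have h0 : c 0 = 0 := by
      rw [h1, zero_smul, add_zero] at hc
      have hx0 : x ≠ 0 := by
        intro h0
        rw [hw, h0] at hw0
        simp at hw0
      simpa [hx0] using hc
    intro i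
    fin_cases i <;> assumption
  obtain ⟨κ, _, _, b, hb, hbz, hbφ⟩ := exists_basis_extending ![x, t, w] hli φ
    (by intro i; fin_cases i <;> simp [hφx, hφt, hφw]) z hφz
  have b0 : b (.inl 0) = x := hb 0
  have b1 : b (.inl 1) = t := hb 1
  have b2 : b (.inl 2) = w := hb 2
  have b3 : b (.inl 3) = z := hbz
  have r3 : ∀ v, b.repr v (.inl 3) = φ v := hbφ
  set br : g →ₗ[ℝ] g →ₗ[ℝ] g := wedgeBracket (b.coord (.inl 0)) (b.coord (.inl 1)) w
    + wedgeBracket (b.coord (.inl 0)) (b.coord (.inl 2)) z with hbr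
  -- In the frame x, t, w, z itself the Ricci matrix of the model is diagonal, and its top
  -- eigenvector z has no t-component. Replacing w by w - z creates the off-diagonal entries that
  -- link z to t.
  set δ : g →ₗ[ℝ] g := LinearMap.toSpanSingleton ℝ g (-z) ∘ₗ b.coord (.inl 2) with hδdef
  have hδ : ∀ v, δ (δ v) = 0 := by
    intro v
    simp [hδdef, ← b3]
  have hco : ∀ p : Fin 4, p ≠ 3 → ∀ i, b.repr (shear b δ hδ i) (.inl p)
      = if i = .inl p then 1 else 0 := by
    intro p hp i
    have : (3 : Fin 4) ≠ p := hp.symm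
    simp only [shear_apply, hδdef, ← b3, map_add, Finsupp.add_apply, LinearMap.comp_apply,
      LinearMap.toSpanSingleton_apply, map_smul, map_neg, Finsupp.smul_apply, Finsupp.neg_apply,
      Module.Basis.repr_self, Finsupp.single_apply]
    simp [this]
  have fz : (shear b δ hδ).repr z = Finsupp.single (.inl 3) 1 := by
    rw [← (shear b δ hδ).repr_self, shear_apply, ← b3]
    simp [hδdef]
  have fw : (shear b δ hδ).repr w = Finsupp.single (.inl 2) 1 + Finsupp.single (.inl 3) 1 := by
    rw [← (shear b δ hδ).repr_self, ← fz, ← map_add, shear_apply, b2]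
    simp [hδdef, ← b2]
  -- The weights keep [x, t] = w (4 + 3 = 7) and [x, w] = z (4 + 7 = 11), and t is the unique
  -- lightest vector. Weight 9 puts every bracket with an extra basis vector at 12 or more, above
  -- the maximum 11. Only [t, w], of weight 10, could hit z with negative excess, and `hφtw`
  -- excludes this.
  set d : Fin 4 ⊕ κ → ℕ := Sum.elim ![4, 3, 7, 11] (fun _ => 9) with hd
  have hd11 : ∀ i, d i ≤ 11 := by
    rintro (i | i)
    · fin_cases i <;> simp [hd]
    · simp [hd]
  have hd3 : ∀ i, 3 ≤ d i := by
    rintro (i | i)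
    · fin_cases i <;> simp [hd]
    · simp [hd]
  obtain ⟨y, hy1, hy2⟩ := exists_tendsto_extremal 1 one_ne_zero b (shear b δ hδ) d br (by
      have hsym : ∀ i j k, ((d k < d i + d j ∧ b.repr (br (b i) (b j)) k = 0)
          ∨ (b.repr ⁅b i, b j⁆ k = 0 ∧ b.repr (br (b i) (b j)) k = 0)
          ∨ (d k = d i + d j ∧ b.repr (br (b i) (b j)) k = b.repr ⁅b i, b j⁆ k)) →
          ((d k < d j + d i ∧ b.repr (br (b j) (b i)) k = 0)
          ∨ (b.repr ⁅b j, b i⁆ k = 0 ∧ b.repr (br (b j) (b i)) k = 0)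
          ∨ (d k = d j + d i ∧ b.repr (br (b j) (b i)) k = b.repr ⁅b j, b i⁆ k)) := by
        intro i j k h
        have e1 : br (b j) (b i) = - br (b i) (b j) := by
          simp only [hbr, LinearMap.add_apply, wedgeBracket_apply]
          module
        rw [← lie_skew (b j) (b i), e1, add_comm (d j)]
        simpa only [map_neg, Finsupp.neg_apply, neg_eq_zero, neg_inj] using h
      have h01 : ∀ k, (b.repr ⁅b (.inl 0), b (.inl 1)⁆ k = 0 ∧
            b.repr (br (b (.inl 0)) (b (.inl 1))) k = 0)
          ∨ (d k = d (.inl 0) + d (.inl 1) ∧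
            b.repr (br (b (.inl 0)) (b (.inl 1))) k = b.repr ⁅b (.inl 0), b (.inl 1)⁆ k) := by
        intro k
        have e : br (b (.inl 0)) (b (.inl 1)) = w := by simp [hbr, wedgeBracket_apply]
        rw [e, b0, b1, ← hw, ← b2, Module.Basis.repr_self, Finsupp.single_apply]
        by_cases hk : Sum.inl 2 = k
        · right; subst hk; simp [hd]
        · left; simp [hk]
      have h02 : ∀ k, (b.repr ⁅b (.inl 0), b (.inl 2)⁆ k = 0 ∧
            b.repr (br (b (.inl 0)) (b (.inl 2))) k = 0)
          ∨ (d k = d (.inl 0) + d (.inl 2) ∧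
            b.repr (br (b (.inl 0)) (b (.inl 2))) k = b.repr ⁅b (.inl 0), b (.inl 2)⁆ k) := by
        intro k
        have e : br (b (.inl 0)) (b (.inl 2)) = z := by simp [hbr, wedgeBracket_apply]
        rw [e, b0, b2, ← hz, ← b3, Module.Basis.repr_self, Finsupp.single_apply]
        by_cases hk : Sum.inl 3 = k
        · right; subst hk; simp [hd]
        · left; simp [hk]
      have h12 : ∀ k, (d k < d (.inl 1) + d (.inl 2) ∧
            b.repr (br (b (.inl 1)) (b (.inl 2))) k = 0)
          ∨ (b.repr ⁅b (.inl 1), b (.inl 2)⁆ k = 0 ∧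
            b.repr (br (b (.inl 1)) (b (.inl 2))) k = 0) := by
        intro k
        have e : br (b (.inl 1)) (b (.inl 2)) = 0 := by simp [hbr, wedgeBracket_apply]
        rw [e]
        rcases k with k | k
        · fin_cases k
          · left; simp [hd]
          · left; simp [hd]
          · left; simp [hd]
          · right; simp [r3, b1, b2, hφtw]
        · left; simp [hd]
      have hr : ∀ i j, br (b (.inr i)) (b j) = 0 := by
        intro i j
        simp [hbr, wedgeBracket_apply]
      have hii : ∀ i k, (b.repr ⁅b i, b i⁆ k = 0 ∧ b.repr (br (b i) (b i)) k = 0) := by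
        intro i k
        simp [hbr, wedgeBracket_apply, mul_comm]
      have hinr : ∀ i j k, (d k < d (.inr i) + d j ∧ b.repr (br (b (.inr i)) (b j)) k = 0) := by
        intro i j k
        refine ⟨?_, by simp [hr]⟩
        have h1 := hd11 k
        have h2 := hd3 j
        have h3 : d (.inr i) = 9 := rfl
        omega
      have hbig : ∀ i k, (d k < d (.inl 3) + d i ∧ b.repr (br (b (.inl 3)) (b i)) k = 0) := by
        intro i k
        refine ⟨?_, by simp [hbr, wedgeBracket_apply]⟩
        have h1 := hd11 k
        have h2 := hd3 i
        have h3 : d (.inl 3) = 11 := rfl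
        omega
      intro i j k
      rcases i with i | i
      · rcases j with j | j
        · fin_cases i <;> fin_cases j
          · exact .inr (.inl (hii _ k))
          · exact .inr (h01 k)
          · exact .inr (h02 k)
          · exact hsym _ _ _ (.inl (hbig _ k))
          · exact hsym _ _ _ (.inr (h01 k))
          · exact .inr (.inl (hii _ k))
          · exact (h12 k).imp_right .inl
          · exact hsym _ _ _ (.inl (hbig _ k))
          · exact hsym _ _ _ (.inr (h02 k))
          · exact hsym _ _ _ ((h12 k).imp_right .inl)
          · exact .inr (.inl (hii _ k))
          · exact hsym _ _ _ (.inl (hbig _ k))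
          · exact .inl (hbig _ k)
          · exact .inl (hbig _ k)
          · exact .inl (hbig _ k)
          · exact .inl (hbig _ k)
        · exact hsym _ _ _ (.inl (hinr j (.inl i) k))
      · exact .inl (hinr i j k)) (.inl 1) (.inl 3) (by
      rintro (i | i) hi
      · fin_cases i
        · simp [hd]
        · exact absurd rfl hi
        · simp [hd]
        · simp [hd]
      · simp [hd]) (by
      intro i
      exact hco 1 (by decide) i) (extTable filiformTable) (by
      intro i j k
      simp only [hbr, LinearMap.add_apply, wedgeBracket_apply, Module.Basis.coord_apply,
        hco 0 (by decide), hco 1 (by decide), hco 2 (by decide), map_add, map_smul, fw, fz,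
        Finsupp.add_apply, Finsupp.smul_apply, Finsupp.single_apply, smul_eq_mul]
      rcases i with i | i <;> rcases j with j | j <;> rcases k with k | k
      · fin_cases i <;> fin_cases j <;> fin_cases k <;> simp [extTable, filiformTable]
      all_goals simp [extTable])
    (extTable_eigenvector filiformTable 1 3 ricciMat_filiformTable_pos filiformTable_eigenvector)
  rw [b1] at hy1
  exact mk_mem_closure_ricciMaximal ht hy1 hy2

end Models

/-! ### Degeneration to the five-dimensional model. -/

section Models

universe u
variable {g : Type u} [LieRing g] [LieAlgebra ℝ g] [FiniteDimensional ℝ g]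
  [LieRing.IsNilpotent g]
  [TopologicalSpace g] [IsTopologicalAddGroup g] [ContinuousSMul ℝ g]

set_option maxHeartbeats 2000000 in
/-- Degeneration to the five-dimensional algebra `[x, y] = w`, `[x, w] = z`, `[y, q] = z`. -/
theorem mem_closure_ricciMaximal_of_five {x y q : g} (hx : x ≠ 0) (φ : Module.Dual ℝ g)
    (hφx : φ x = 0) (hφy : φ y = 0) (hφw : φ ⁅x, y⁆ = 0) (hφq : φ q = 0)
    (hφz : φ ⁅x, ⁅x, y⁆⁆ = 1) (hφyq : φ ⁅y, q⁆ = 1) (hφxq : φ ⁅x, q⁆ = 0) :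
    Projectivization.mk ℝ x hx ∈ closure (ricciMaximal g) := by
  set w := ⁅x, y⁆ with hw
  set z := ⁅x, w⁆ with hz
  have hli : LinearIndependent ℝ ![x, y, w, q] := by
    rw [Fintype.linearIndependent_iff]
    intro c hc
    simp only [Fin.sum_univ_four, Matrix.cons_val] at hc
    have h2 : c 2 = 0 := by
      have := congrArg (fun v => φ ⁅x, v⁆) hc
      simpa [hφw, hφz, hφxq, ← hw, ← hz] using this
    rw [h2, zero_smul, add_zero] at hc
    have h3 : c 3 = 0 := by
      have := congrArg (fun v => φ ⁅y, v⁆) hc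
      have hyx : ⁅y, x⁆ = -w := (lie_skew y x).symm
      simpa [hφyq, hyx, hφw] using this
    rw [h3, zero_smul, add_zero] at hc
    have hw0 : w ≠ 0 := by
      intro h0
      rw [hz, h0] at hφz
      simp at hφz
    have h1 : c 1 = 0 := by
      have := congrArg (fun v => ⁅x, v⁆) hc
      simpa [← hw, hw0] using this
    have h0 : c 0 = 0 := by
      rw [h1, zero_smul, add_zero] at hc
      simpa [hx] using hc
    intro i
    fin_cases i <;> assumption
  obtain ⟨κ, _, _, b, hb, hbz, hbφ⟩ := exists_basis_extending ![x, y, w, q] hli φ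
    (by intro i; fin_cases i <;> simp [hφx, hφy, hφw, hφq]) z hφz
  have b0 : b (.inl 0) = x := hb 0
  have b1 : b (.inl 1) = y := hb 1
  have b2 : b (.inl 2) = w := hb 2
  have b3 : b (.inl 3) = q := hb 3
  have b4 : b (.inl 4) = z := hbz
  have r4 : ∀ v, b.repr v (.inl 4) = φ v := hbφ
  set br : g →ₗ[ℝ] g →ₗ[ℝ] g := wedgeBracket (b.coord (.inl 0)) (b.coord (.inl 1)) w
    + wedgeBracket (b.coord (.inl 0)) (b.coord (.inl 2)) z
    + wedgeBracket (b.coord (.inl 1)) (b.coord (.inl 3)) z with hbr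
  -- The new frame is x + y, y, w - z, q, z. Mixing y into x gives the first row of the Ricci matrix
  -- its nonzero off-diagonal entries.
  set δ : g →ₗ[ℝ] g := LinearMap.toSpanSingleton ℝ g (-z) ∘ₗ b.coord (.inl 2)
    + LinearMap.toSpanSingleton ℝ g y ∘ₗ b.coord (.inl 0) with hδdef
  have hδ : ∀ v, δ (δ v) = 0 := by
    intro v
    simp [hδdef, ← b4, ← b1]
  have hco : ∀ p : Fin 5, p ≠ 4 → p ≠ 1 → ∀ i, b.repr (shear b δ hδ i) (.inl p)
      = if i = .inl p then 1 else 0 := by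
    intro p hp hp1 i
    have h4 : (4 : Fin 5) ≠ p := hp.symm
    have h1 : (1 : Fin 5) ≠ p := hp1.symm
    simp only [shear_apply, hδdef, ← b4, ← b1, map_add, Finsupp.add_apply, LinearMap.add_apply,
      LinearMap.comp_apply, LinearMap.toSpanSingleton_apply, map_smul, map_neg,
      Finsupp.smul_apply, Finsupp.neg_apply, Module.Basis.repr_self, Finsupp.single_apply]
    simp [h4, h1]
  have hco1 : ∀ i, b.repr (shear b δ hδ i) (.inl 1)
      = (if i = .inl 1 then 1 else 0) + if i = .inl 0 then 1 else 0 := by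
    intro i
    simp only [shear_apply, hδdef, ← b4, ← b1, map_add, Finsupp.add_apply, LinearMap.add_apply,
      LinearMap.comp_apply, LinearMap.toSpanSingleton_apply, map_smul, map_neg,
      Finsupp.smul_apply, Finsupp.neg_apply, Module.Basis.repr_self, Finsupp.single_apply,
      Module.Basis.coord_apply]
    simp
  have fz : (shear b δ hδ).repr z = Finsupp.single (.inl 4) 1 := by
    rw [← (shear b δ hδ).repr_self, shear_apply, ← b4]
    simp [hδdef]
  have fw : (shear b δ hδ).repr w = Finsupp.single (.inl 2) 1 + Finsupp.single (.inl 4) 1 := by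
    rw [← (shear b δ hδ).repr_self, ← fz, ← map_add, shear_apply, b2]
    simp [hδdef, ← b2]
  -- The weights satisfy 3 + 4 = 7 and 3 + 7 = 4 + 6 = 10, which keeps the three brackets of the
  -- model, and x is the lightest vector. Brackets with an extra vector have weight at least 11 >
  -- 10. The only dangerous one is [x, q], of weight 9, whose z-coefficient is zero by `hφxq`.
  set d : Fin 5 ⊕ κ → ℕ := Sum.elim ![3, 4, 7, 6, 10] (fun _ => 8) with hd
  have hd11 : ∀ i, d i ≤ 10 := by
    rintro (i | i)
    · fin_cases i <;> simp [hd]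
    · simp [hd]
  have hd3 : ∀ i, 3 ≤ d i := by
    rintro (i | i)
    · fin_cases i <;> simp [hd]
    · simp [hd]
  obtain ⟨y, hy1, hy2⟩ := exists_tendsto_extremal 1 one_ne_zero b (shear b δ hδ) d br (by
      have hsym : ∀ i j k, ((d k < d i + d j ∧ b.repr (br (b i) (b j)) k = 0)
          ∨ (b.repr ⁅b i, b j⁆ k = 0 ∧ b.repr (br (b i) (b j)) k = 0)
          ∨ (d k = d i + d j ∧ b.repr (br (b i) (b j)) k = b.repr ⁅b i, b j⁆ k)) →
          ((d k < d j + d i ∧ b.repr (br (b j) (b i)) k = 0)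
          ∨ (b.repr ⁅b j, b i⁆ k = 0 ∧ b.repr (br (b j) (b i)) k = 0)
          ∨ (d k = d j + d i ∧ b.repr (br (b j) (b i)) k = b.repr ⁅b j, b i⁆ k)) := by
        intro i j k h
        have e1 : br (b j) (b i) = - br (b i) (b j) := by
          simp only [hbr, LinearMap.add_apply, wedgeBracket_apply]
          module
        rw [← lie_skew (b j) (b i), e1, add_comm (d j)]
        simpa only [map_neg, Finsupp.neg_apply, neg_eq_zero, neg_inj] using h
      have h01 : ∀ k, (b.repr ⁅b (.inl 0), b (.inl 1)⁆ k = 0 ∧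
            b.repr (br (b (.inl 0)) (b (.inl 1))) k = 0)
          ∨ (d k = d (.inl 0) + d (.inl 1) ∧
            b.repr (br (b (.inl 0)) (b (.inl 1))) k = b.repr ⁅b (.inl 0), b (.inl 1)⁆ k) := by
        intro k
        have e : br (b (.inl 0)) (b (.inl 1)) = w := by simp [hbr, wedgeBracket_apply]
        rw [e, b0, b1, ← hw, ← b2, Module.Basis.repr_self, Finsupp.single_apply]
        by_cases hk : Sum.inl 2 = k
        · right; subst hk; simp [hd]
        · left; simp [hk]
      have h02 : ∀ k, (b.repr ⁅b (.inl 0), b (.inl 2)⁆ k = 0 ∧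
            b.repr (br (b (.inl 0)) (b (.inl 2))) k = 0)
          ∨ (d k = d (.inl 0) + d (.inl 2) ∧
            b.repr (br (b (.inl 0)) (b (.inl 2))) k = b.repr ⁅b (.inl 0), b (.inl 2)⁆ k) := by
        intro k
        have e : br (b (.inl 0)) (b (.inl 2)) = z := by simp [hbr, wedgeBracket_apply]
        rw [e, b0, b2, ← hz, ← b4, Module.Basis.repr_self, Finsupp.single_apply]
        by_cases hk : Sum.inl 4 = k
        · right; subst hk; simp [hd]
        · left; simp [hk]
      have h03 : ∀ k, (d k < d (.inl 0) + d (.inl 3) ∧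
            b.repr (br (b (.inl 0)) (b (.inl 3))) k = 0)
          ∨ (b.repr ⁅b (.inl 0), b (.inl 3)⁆ k = 0 ∧
            b.repr (br (b (.inl 0)) (b (.inl 3))) k = 0) := by
        intro k
        have e : br (b (.inl 0)) (b (.inl 3)) = 0 := by simp [hbr, wedgeBracket_apply]
        rw [e]
        rcases k with k | k
        · fin_cases k
          · left; simp [hd]
          · left; simp [hd]
          · left; simp [hd]
          · left; simp [hd]
          · right; simp [r4, b0, b3, hφxq]
        · left; simp [hd]
      have h13 : ∀ k, (d k < d (.inl 1) + d (.inl 3) ∧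
            b.repr (br (b (.inl 1)) (b (.inl 3))) k = 0)
          ∨ (d k = d (.inl 1) + d (.inl 3) ∧
            b.repr (br (b (.inl 1)) (b (.inl 3))) k = b.repr ⁅b (.inl 1), b (.inl 3)⁆ k) := by
        intro k
        have e : br (b (.inl 1)) (b (.inl 3)) = z := by simp [hbr, wedgeBracket_apply]
        rw [e]
        rcases k with k | k
        · fin_cases k
          · left; simp [hd, ← b4]
          · left; simp [hd, ← b4]
          · left; simp [hd, ← b4]
          · left; simp [hd, ← b4]
          · right; simp [hd, r4, b1, b3, hφyq, hφz]
        · left; simp [hd, ← b4]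
      have hzero : ∀ i j, 11 ≤ d i + d j → br (b i) (b j) = 0 → ∀ k,
          (d k < d i + d j ∧ b.repr (br (b i) (b j)) k = 0) := by
        intro i j hij h0 k
        refine ⟨?_, by simp [h0]⟩
        have h1 := hd11 k
        omega
      have hii : ∀ i k, (b.repr ⁅b i, b i⁆ k = 0 ∧ b.repr (br (b i) (b i)) k = 0) := by
        intro i k
        simp [hbr, wedgeBracket_apply, mul_comm]
      have hinr : ∀ i j k, (d k < d (.inr i) + d j ∧ b.repr (br (b (.inr i)) (b j)) k = 0) := by
        intro i j k
        refine hzero _ _ ?_ (by simp [hbr, wedgeBracket_apply]) k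
        have h2 := hd3 j
        have h3 : d (.inr i) = 8 := rfl
        omega
      have hbig : ∀ i k, (d k < d (.inl 4) + d i ∧ b.repr (br (b (.inl 4)) (b i)) k = 0) := by
        intro i k
        refine hzero _ _ ?_ (by simp [hbr, wedgeBracket_apply]) k
        have h2 := hd3 i
        have h3 : d (.inl 4) = 10 := rfl
        omega
      have h12 := hzero (.inl 1) (.inl 2) (by simp [hd]) (by simp [hbr, wedgeBracket_apply])
      have h23 := hzero (.inl 2) (.inl 3) (by simp [hd]) (by simp [hbr, wedgeBracket_apply])
      intro i j k
      rcases i with i | i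
      · rcases j with j | j
        · fin_cases i <;> fin_cases j
          · exact .inr (.inl (hii _ k))
          · exact .inr (h01 k)
          · exact .inr (h02 k)
          · exact (h03 k).imp_right .inl
          · exact hsym _ _ _ (.inl (hbig _ k))
          · exact hsym _ _ _ (.inr (h01 k))
          · exact .inr (.inl (hii _ k))
          · exact .inl (h12 k)
          · exact (h13 k).imp_right .inr
          · exact hsym _ _ _ (.inl (hbig _ k))
          · exact hsym _ _ _ (.inr (h02 k))
          · exact hsym _ _ _ (.inl (h12 k))
          · exact .inr (.inl (hii _ k))
          · exact .inl (h23 k)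
          · exact hsym _ _ _ (.inl (hbig _ k))
          · exact hsym _ _ _ ((h03 k).imp_right .inl)
          · exact hsym _ _ _ ((h13 k).imp_right .inr)
          · exact hsym _ _ _ (.inl (h23 k))
          · exact .inr (.inl (hii _ k))
          · exact hsym _ _ _ (.inl (hbig _ k))
          · exact .inl (hbig _ k)
          · exact .inl (hbig _ k)
          · exact .inl (hbig _ k)
          · exact .inl (hbig _ k)
          · exact .inl (hbig _ k)
        · exact hsym _ _ _ (.inl (hinr j (.inl i) k))
      · exact .inl (hinr i j k)) (.inl 0) (.inl 4) (by
      rintro (i | i) hi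
      · fin_cases i
        · exact absurd rfl hi
        · simp [hd]
        · simp [hd]
        · simp [hd]
        · simp [hd]
      · simp [hd]) (by
      intro i
      exact hco 0 (by decide) (by decide) i) (extTable fiveTable) (by
      intro i j k
      simp only [hbr, LinearMap.add_apply, wedgeBracket_apply, Module.Basis.coord_apply,
        hco 0 (by decide) (by decide), hco1, hco 2 (by decide) (by decide),
        hco 3 (by decide) (by decide), map_add, map_smul, fw, fz,
        Finsupp.add_apply, Finsupp.smul_apply, Finsupp.single_apply, smul_eq_mul]
      rcases i with i | i <;> rcases j with j | j <;> rcases k with k | k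
      · fin_cases i <;> fin_cases j <;> fin_cases k <;> simp [extTable, fiveTable]
      all_goals simp [extTable])
    (extTable_eigenvector fiveTable 0 4 ricciMat_fiveTable_pos fiveTable_eigenvector)
  rw [b0] at hy1
  exact mk_mem_closure_ricciMaximal hx hy1 hy2

end Models

/-! ### Ricci-minimal lines: the semidirect model and the case of proportional brackets. -/

section Minimal

universe u
variable {g : Type u} [LieRing g] [LieAlgebra ℝ g]

theorem sum_comm_pairs {ι : Type*} [Fintype ι] (f : ι → ι → ι → ι → ℝ) :
    ∑ i, ∑ k, ∑ c, ∑ a, f i k c a = ∑ c, ∑ a, ∑ i, ∑ k, f i k c a := by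
  calc ∑ i, ∑ k, ∑ c, ∑ a, f i k c a = ∑ i, ∑ c, ∑ k, ∑ a, f i k c a :=
        Finset.sum_congr rfl fun _ _ => Finset.sum_comm
    _ = ∑ c, ∑ i, ∑ k, ∑ a, f i k c a := Finset.sum_comm
    _ = ∑ c, ∑ i, ∑ a, ∑ k, f i k c a :=
        Finset.sum_congr rfl fun _ _ => Finset.sum_congr rfl fun _ _ => Finset.sum_comm
    _ = _ := Finset.sum_congr rfl fun _ _ => Finset.sum_comm

/-- The value of the Ricci quadratic form at u, as a difference of sums of squares; this is what
permits comparison by Cauchy–Schwarz. -/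
theorem sum_ricciMat {ι : Type*} [Fintype ι] (C : ι → ι → ι → ℝ) (u : ι → ℝ) :
    ∑ c, (∑ a, u a * ricciMat C a c) * u c = -(1 / 2) * ∑ i, ∑ k, (∑ a, u a * C a i k) ^ 2
      + 1 / 4 * ∑ i, ∑ j, (∑ a, u a * C i j a) ^ 2 := by
  have e : ∀ F : ι → ℝ, (∑ a, u a * F a) ^ 2 = ∑ c, ∑ a, u a * u c * (F a * F c) := by
    intro F
    rw [sq, Finset.sum_mul_sum, Finset.sum_comm]
    exact Finset.sum_congr rfl fun _ _ => Finset.sum_congr rfl fun _ _ => by ring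
  have h1 : ∑ i, ∑ k, (∑ a, u a * C a i k) ^ 2
      = ∑ c, ∑ a, u a * u c * ∑ i, ∑ k, C a i k * C c i k := by
    simp only [e, Finset.mul_sum]
    exact sum_comm_pairs fun i k c a => u a * u c * (C a i k * C c i k)
  have h2 : ∑ i, ∑ j, (∑ a, u a * C i j a) ^ 2
      = ∑ c, ∑ a, u a * u c * ∑ i, ∑ j, C i j a * C i j c := by
    simp only [e, Finset.mul_sum]
    exact sum_comm_pairs fun i j c a => u a * u c * (C i j a * C i j c)
  rw [h1, h2, Finset.mul_sum, Finset.mul_sum, ← Finset.sum_add_distrib]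
  refine Finset.sum_congr rfl fun c _ => ?_
  rw [Finset.mul_sum, Finset.mul_sum, ← Finset.sum_add_distrib, Finset.sum_mul]
  refine Finset.sum_congr rfl fun a _ => ?_
  rw [ricciMat]
  ring

theorem eq_smul_of_cauchy_schwarz_eq {ι : Type*} [Fintype ι] (u D : ι → ℝ)
    (hu : 0 < ∑ a, u a ^ 2) (h : (∑ a, u a ^ 2) * ∑ a, D a ^ 2 = (∑ a, u a * D a) ^ 2) (a : ι) :
    D a = (∑ a, u a * D a) / (∑ a, u a ^ 2) * u a := by
  set l := (∑ a, u a * D a) / (∑ a, u a ^ 2) with hl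
  have e : ∑ a, (D a - l * u a) ^ 2 = 0 := by
    have e1 : ∑ a, (D a - l * u a) ^ 2
        = ∑ a, D a ^ 2 - 2 * l * ∑ a, u a * D a + l ^ 2 * ∑ a, u a ^ 2 := by
      simp only [Finset.mul_sum, ← Finset.sum_add_distrib, ← Finset.sum_sub_distrib]
      exact Finset.sum_congr rfl fun _ _ => by ring
    rw [e1, hl]
    field_simp
    linarith
  have := (Finset.sum_eq_zero_iff_of_nonneg fun a _ => sq_nonneg _).mp e a (Finset.mem_univ a)
  linarith [pow_eq_zero_iff (two_ne_zero) |>.mp this]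

/-- The operator ad v is nilpotent, so zero is its only possible eigenvalue. -/
theorem eq_zero_of_lie_eq_smul [LieRing.IsNilpotent g] {v w : g} {c : ℝ}
    (h : ⁅v, w⁆ = c • w) (hw : w ≠ 0) : c = 0 := by
  have h2 : ∀ n, ((LieModule.toEnd ℝ g g v) ^ n) w = c ^ n • w := by
    intro n
    induction n with
    | zero => simp
    | succ n ih =>
      rw [pow_succ', Module.End.mul_apply, ih, map_smul, LieModule.toEnd_apply_apply, h,
        smul_smul, pow_succ]
  obtain ⟨n, hn⟩ := LieModule.isNilpotent_toEnd_of_isNilpotent ℝ g g v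
  have h3 := h2 n
  rw [hn, LinearMap.zero_apply] at h3
  exact eq_zero_of_pow_eq_zero ((smul_eq_zero.mp h3.symm).resolve_right hw)

variable [FiniteDimensional ℝ g] [LieRing.IsNilpotent g]

set_option maxHeartbeats 1000000 in
/-- Degeneration to the semidirect product of a line and an abelian ideal. -/
theorem mem_closure_ricciMinimal [TopologicalSpace g] [IsTopologicalAddGroup g]
    [ContinuousSMul ℝ g] {x y₁ y₂ : g} (hx : x ≠ 0)
    (hli : ∀ c c₁ c₂ : ℝ, c • x + c₁ • ⁅x, y₁⁆ + c₂ • ⁅x, y₂⁆ = 0 → c₁ = 0 ∧ c₂ = 0) :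
    Projectivization.mk ℝ x hx ∈ closure (ricciMinimal g) := by
  obtain ⟨φ, hφ⟩ := Module.Projective.exists_dual_eq_one ℝ hx
  obtain ⟨κ, _, _, b, -, hbx, hbφ⟩ := exists_basis_extending (n := 0) ![]
    linearIndependent_empty_type φ (fun i => i.elim0) x hφ
  set i₀ : Fin (0 + 1) ⊕ κ := .inl (Fin.last 0) with hi₀
  set P : g →ₗ[ℝ] g := LinearMap.id - LinearMap.toSpanSingleton ℝ g x ∘ₗ φ with hP
  have hPφ : ∀ v, φ (P v) = 0 := fun v => by simp [hP, hφ]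
  have hPk : ∀ v k, k ≠ i₀ → b.repr (P v) k = b.repr v k := by
    intro v k hk
    simp [hP, ← hbx, hk.symm]
  have hP' : ∀ v, v = P v + φ v • x := fun v => by simp [hP]
  set br : g →ₗ[ℝ] g →ₗ[ℝ] g := LinearMap.mk₂ ℝ
    (fun u v => φ u • P ⁅x, v⁆ - φ v • P ⁅x, u⁆)
    (fun u u' v => by simp only [map_add, lie_add]; module)
    (fun c u v => by simp only [map_smul, lie_smul, smul_eq_mul]; module)
    (fun u v v' => by simp only [map_add, lie_add]; module)
    (fun c u v => by simp only [map_smul, lie_smul, smul_eq_mul]; module) with hbrdef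
  have hbr : ∀ u v, br u v = φ u • P ⁅x, v⁆ - φ v • P ⁅x, u⁆ := fun u v => rfl
  have hφb : ∀ i, φ (b i) = if i = i₀ then 1 else 0 := by
    intro i
    rw [← hbφ, b.repr_self, Finsupp.single_apply]
  have hx0 : b.repr (b i₀) = b.repr x := by rw [hbx]
  set D : Fin (0 + 1) ⊕ κ → Fin (0 + 1) ⊕ κ → ℝ := fun a k => b.repr (P ⁅x, b a⁆) k with hD
  have hD0 : ∀ k, D i₀ k = 0 := by
    intro k
    simp [hD, hbx]
  have hDk0 : ∀ a, D a i₀ = 0 := by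
    intro a
    simp only [hD]
    rw [hbφ, hPφ]
  set C : Fin (0 + 1) ⊕ κ → Fin (0 + 1) ⊕ κ → Fin (0 + 1) ⊕ κ → ℝ := fun i j k =>
    (if i = i₀ then D j k else 0) - (if j = i₀ then D i k else 0) with hC
  have hbC : ∀ i j k, b.repr (br (b i) (b j)) k = C i j k := by
    intro i j k
    simp only [hbr, hφb, hC, hD, map_sub, map_smul, Finsupp.sub_apply, Finsupp.smul_apply,
      smul_eq_mul, ite_mul, one_mul, zero_mul]
  set S := ∑ k, ∑ a, D a k ^ 2 with hS
  have hR00 : ricciMat C i₀ i₀ = -(1 / 2) * S := by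
    have e1 : ∀ i k, C i₀ i k * C i₀ i k = D i k ^ 2 := by
      intro i k
      by_cases hi : i = i₀
      · simp [hC, hi, hD0]
      · simp [hC, hi, sq]
    have e2 : ∀ i j, C i j i₀ = 0 := by
      intro i j
      simp [hC, hDk0]
    simp only [ricciMat, e1, e2, mul_zero, Finset.sum_const_zero, add_zero]
    rw [hS, Finset.sum_comm]
  -- Weight 0 on x and 1 on ker φ: brackets inside ker φ and x-components of [x, ·] disappear, while
  -- the operator `D` induced by ad x on ker φ survives.
  obtain ⟨y, hy1, hy2⟩ := exists_tendsto_extremal (-1) (by norm_num) b b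
    (fun i => if i = i₀ then 0 else 1) br (by
      intro i j k
      rw [hbC]
      by_cases hi : i = i₀ <;> by_cases hj : j = i₀ <;> by_cases hk : k = i₀
      · right; left; simp [hi, hj, hC]
      · right; left; simp [hi, hj, hC]
      · left; simp [hi, hj, hk, hC, hDk0]
      · right; right
        refine ⟨by simp [hi, hj, hk], ?_⟩
        simp only [hi, hj, hC, hD, if_true, if_false, sub_zero]
        rw [hPk _ _ hk, hbx]
      · left; simp [hi, hj, hk, hC, hDk0]
      · right; right
        refine ⟨by simp [hi, hj, hk], ?_⟩
        simp only [hi, hj, hC, hD, if_true, if_false, zero_sub]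
        rw [hPk _ _ hk, hbx, ← lie_skew, map_neg, Finsupp.neg_apply, neg_neg]
      · left; simp [hi, hj, hk, hC]
      · left; simp [hi, hj, hk, hC])
    i₀ i₀ (by intro i hi; simp [hi]) (by
      intro i
      rw [hbφ, hφb]) C hbC (by
      intro u μ hu hμ hu0
      by_contra hne
      have hN : 0 < ∑ a, u a ^ 2 := by
        obtain ⟨a, ha⟩ := Function.ne_iff.mp hne
        exact Finset.sum_pos' (fun a _ => sq_nonneg _)
          ⟨a, Finset.mem_univ _, sq_pos_of_ne_zero ha⟩
      have h1 : μ * ∑ a, u a ^ 2 = ∑ c, (∑ a, u a * ricciMat C a c) * u c := by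
        simp only [hu]
        rw [Finset.mul_sum]
        exact Finset.sum_congr rfl fun _ _ => by ring
      rw [sum_ricciMat] at h1
      have h2 : ∑ i, ∑ k, (∑ a, u a * C a i k) ^ 2 = ∑ k, (∑ a, u a * D a k) ^ 2 := by
        rw [Finset.sum_eq_single i₀]
        · refine Finset.sum_congr rfl fun k _ => ?_
          rw [← neg_sq, ← Finset.sum_neg_distrib]
          congr 1
          refine Finset.sum_congr rfl fun a _ => ?_
          by_cases ha : a = i₀
          · simp [ha, hu0]
          · simp [hC, ha]
        · intro i _ hi
          refine Finset.sum_eq_zero fun k _ => ?_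
          rw [Finset.sum_eq_zero, zero_pow two_ne_zero]
          intro a _
          by_cases ha : a = i₀
          · simp [ha, hu0]
          · simp [hC, ha, hi]
        · simp
      have h3 : 0 ≤ ∑ i, ∑ j, (∑ a, u a * C i j a) ^ 2 :=
        Finset.sum_nonneg fun _ _ => Finset.sum_nonneg fun _ _ => sq_nonneg _
      -- A vector orthogonal to x that is as negative as x must satisfy |Du| ≥ ‖D‖ |u| in the
      -- Hilbert–Schmidt norm. Equality then holds in each Cauchy–Schwarz inequality, so D has rank
      -- at most one.
      have h4 : ∑ k, ((∑ a, u a ^ 2) * ∑ a, D a k ^ 2 - (∑ a, u a * D a k) ^ 2) ≤ 0 := by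
        rw [Finset.sum_sub_distrib, ← Finset.mul_sum, ← hS]
        have : μ * ∑ a, u a ^ 2 ≤ -(1 / 2) * S * ∑ a, u a ^ 2 :=
          mul_le_mul_of_nonneg_right (by linarith) hN.le
        rw [h2] at h1
        linarith
      have h5 : ∀ k, 0 ≤ (∑ a, u a ^ 2) * ∑ a, D a k ^ 2 - (∑ a, u a * D a k) ^ 2 := fun k =>
        sub_nonneg.mpr (Finset.sum_mul_sq_le_sq_mul_sq _ _ _)
      have h6 : ∀ k a, D a k = (∑ a, u a * D a k) / (∑ a, u a ^ 2) * u a := by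
        intro k a
        have h7 := (Finset.sum_eq_zero_iff_of_nonneg fun k _ => h5 k).mp
          (le_antisymm h4 (Finset.sum_nonneg fun k _ => h5 k)) k (Finset.mem_univ k)
        exact eq_smul_of_cauchy_schwarz_eq u (fun a => D a k) hN (sub_eq_zero.mp h7) a
      set Λ : g := ∑ k, ((∑ a, u a * D a k) / (∑ a, u a ^ 2)) • b k with hΛ
      have h8 : ∀ a, P ⁅x, b a⁆ = u a • Λ := by
        intro a
        rw [← b.sum_repr (P ⁅x, b a⁆), hΛ, Finset.smul_sum]
        refine Finset.sum_congr rfl fun k _ => ?_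
        rw [smul_smul]
        congr 1
        rw [mul_comm]
        exact h6 k a
      have h9 : ∀ v, ∃ α : ℝ, P ⁅x, v⁆ = α • Λ := by
        intro v
        refine ⟨∑ a, b.repr v a * u a, ?_⟩
        conv_lhs => rw [← b.sum_repr v]
        simp only [lie_sum, lie_smul, map_sum, map_smul, h8, Finset.sum_smul, mul_smul]
      obtain ⟨α₁, hα₁⟩ := h9 y₁
      obtain ⟨α₂, hα₂⟩ := h9 y₂
      have e1 := hP' ⁅x, y₁⁆
      have e2 := hP' ⁅x, y₂⁆
      rw [hα₁] at e1
      rw [hα₂] at e2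
      generalize φ ⁅x, y₁⁆ = β₁ at e1
      generalize φ ⁅x, y₂⁆ = β₂ at e2
      clear_value Λ
      -- Both [x, y₁] and [x, y₂] lie in the span of x and Λ; eliminating Λ gives a forbidden
      -- relation.
      obtain ⟨h10, h11⟩ := hli (α₁ * β₂ - α₂ * β₁) α₂ (-α₁) (by
        rw [e1, e2]
        module)
      rw [h10, zero_smul, zero_add] at e2
      have := (hli (-β₂) 0 1 (by
        rw [e2]
        module)).2
      exact one_ne_zero this)
  rw [hbx] at hy1
  exact mk_mem_closure_ricciMinimal hx hy1 hy2

/-- If all brackets are multiples of `w`, then every noncentral line is Ricci-minimal. -/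
theorem mem_ricciMinimal_of_heisenberg {w x y : g} (hw : ∀ u v : g, ∃ c : ℝ, ⁅u, v⁆ = c • w)
    (hx : x ≠ 0) (hxy : ⁅x, y⁆ ≠ 0) : Projectivization.mk ℝ x hx ∈ ricciMinimal g := by
  set w' := ⁅x, y⁆ with hw'
  obtain ⟨φ, hφ⟩ := Module.Projective.exists_dual_eq_one ℝ hxy
  have hbr : ∀ u v : g, ⁅u, v⁆ = φ ⁅u, v⁆ • w' := by
    intro u v
    obtain ⟨c, hc⟩ := hw u v
    obtain ⟨c', hc'⟩ := hw x y
    rw [← hw'] at hc'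
    rw [hc'] at hφ
    rw [hc, hc', map_smul, smul_smul, smul_eq_mul]
    rw [map_smul, smul_eq_mul] at hφ
    rw [mul_assoc, mul_comm _ c', hφ, mul_one]
  set ω : g → g → ℝ := fun u v => φ ⁅u, v⁆ with hω
  have hxy1 : ω x y = 1 := hφ
  have hyx1 : ω y x = -1 := by
    simp only [hω]
    rw [← lie_skew, map_neg, hφ]
  -- The ω-orthogonal complement of the hyperbolic pair x, y; it complements their span and contains
  -- the central vector w', so w' will be orthogonal to x.
  set p : Submodule ℝ g := LinearMap.ker (φ ∘ₗ LieModule.toEnd ℝ g g x)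
    ⊓ LinearMap.ker (φ ∘ₗ LieModule.toEnd ℝ g g y) with hp
  have hpx : ∀ v ∈ p, ω x v = 0 := fun v hv => hv.1
  have hpy : ∀ v ∈ p, ω y v = 0 := fun v hv => hv.2
  have hskew : ∀ u v, ω u v = -ω v u := by
    intro u v
    simp only [hω]
    rw [← lie_skew, map_neg]
  have hwp : w' ∈ p := by
    have key : ∀ v : g, ⁅v, w'⁆ = 0 := by
      intro v
      have h1 := hbr v w'
      rw [h1, eq_zero_of_lie_eq_smul h1 hxy, zero_smul]
    exact ⟨by simp [key], by simp [key]⟩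
  let e : (p × (ℝ × ℝ)) ≃ₗ[ℝ] g := LinearEquiv.ofBijective
    (p.subtype.coprod ((LinearMap.toSpanSingleton ℝ g x).coprod (LinearMap.toSpanSingleton ℝ g y)))
    (by
      constructor
      · rw [← LinearMap.ker_eq_bot, LinearMap.ker_eq_bot']
        rintro ⟨k, s, t⟩ hkt
        simp only [LinearMap.coprod_apply, Submodule.subtype_apply,
          LinearMap.toSpanSingleton_apply] at hkt
        have h1 : ω x (k + (s • x + t • y)) = 0 := by rw [hkt]; simp [hω]
        have h2 : ω y (k + (s • x + t • y)) = 0 := by rw [hkt]; simp [hω]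
        have a1 : ω x (k + (s • x + t • y)) = ω x k + t * ω x y := by simp [hω]
        have a2 : ω y (k + (s • x + t • y)) = ω y k + s * ω y x := by simp [hω]
        rw [a1, hpx _ k.2, hxy1] at h1
        rw [a2, hpy _ k.2, hyx1] at h2
        have ht : t = 0 := by linarith
        have hs : s = 0 := by linarith
        subst ht hs
        simpa using hkt
      · intro v
        refine ⟨(⟨v - (-(ω y v) • x + ω x v • y), ?_⟩, -(ω y v), ω x v), by simp⟩
        have a1 : ω x (v - (-(ω y v) • x + ω x v • y)) = ω x v - ω x v * ω x y := by simp [hω]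
        have a2 : ω y (v - (-(ω y v) • x + ω x v • y)) = ω y v + ω y v * ω y x := by
          simp [hω]
        rw [hxy1] at a1
        rw [hyx1] at a2
        exact ⟨by change ω x _ = 0; rw [a1]; ring, by change ω y _ = 0; rw [a2]; ring⟩)
  have he : ∀ q, e q = q.1 + (q.2.1 • x + q.2.2 • y) := fun q => rfl
  set cb := Module.finBasis ℝ p with hcb
  set S : ℝ := ∑ i, ∑ k, ω (cb k) (cb i) ^ 2 with hS
  have hS0 : 0 ≤ S := by positivity
  -- With `s • cb i` declared orthonormal, the Hilbert–Schmidt norm squared of ω on p becomes s⁴S,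
  -- which this s makes at most 1. The plane of x and y, where ω has norm 1, then dominates.
  set s : ℝ := 1 / (1 + S) with hs
  have hs0 : 0 < s := by positivity
  have hs1 : s ≤ 1 := by
    rw [hs, div_le_one (by positivity)]
    linarith
  have hsS : s ^ 4 * S ≤ 1 := by
    have h1 : s * S ≤ 1 := by
      rw [hs, div_mul_eq_mul_div, div_le_one (by positivity)]
      linarith
    calc s ^ 4 * S = s ^ 3 * (s * S) := by ring
      _ ≤ 1 * 1 := mul_le_mul (pow_le_one₀ hs0.le hs1) h1 (by positivity) zero_le_one
      _ = 1 := one_mul 1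
  set f : Module.Basis _ ℝ g := ((cb.isUnitSMul (w := fun _ => s)
    (fun _ => isUnit_iff_ne_zero.mpr hs0.ne')).prod (Module.Basis.finTwoProd ℝ)).map e with hf
  have f0 : f (.inr 0) = x := by simp [hf, he]
  have f1 : f (.inr 1) = y := by simp [hf, he]
  have fl : ∀ i, f (.inl i) = s • (cb i : g) := by
    intro i
    simp [hf, he, Module.Basis.isUnitSMul_apply]
  set B := InnerProd.ofBasis f with hB
  have hon : IsONB B f := isONB_ofBasis f
  set Ω := B.form w' w' with hΩ
  have hΩ0 : 0 ≤ Ω := B.form_self_nonneg w'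
  have hform : ∀ u v u' v' : g, B.form ⁅u, v⁆ ⁅u', v'⁆ = ω u v * ω u' v' * Ω := by
    intro u v u' v'
    rw [hbr u v, hbr u' v']
    simp only [map_smul, LinearMap.smul_apply, smul_eq_mul, hω, hΩ]
    ring
  have hwx : B.form w' x = 0 := by
    have : w' = e (⟨w', hwp⟩, 0, 0) := by simp [he]
    rw [← f0, hon.repr_eq, this]
    simp [hf]
  have hωx : ω x x = 0 := by simp [hω]
  have hωy : ω y y = 0 := by simp [hω]
  refine mk_mem_ricciMinimal_of_rayleigh hx B (-(1 / 2) * Ω) ?_ fun v => ?_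
  · have hxx : B.form x x = 1 := by
      rw [← f0, hon]
      simp
    rw [ricci_eq hon, hxx]
    have e2 : ∀ i j, B.form ⁅f i, f j⁆ x = 0 := by
      intro i j
      rw [hbr, map_smul, LinearMap.smul_apply, hwx, smul_zero]
    have e3 : ∀ i, ω x (cb i) = 0 := fun i => hpx _ (cb i).2
    simp only [e2, mul_zero, Finset.sum_const_zero, add_zero, hform, Fintype.sum_sum_type, fl,
      Fin.sum_univ_two, f0, f1, hωx, hxy1]
    have e4 : ∀ i, ω x (s • (cb i : g)) = 0 := by
      intro i
      have : ω x (s • (cb i : g)) = s * ω x (cb i) := by simp [hω]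
      rw [this, e3, mul_zero]
    simp [e4]
  · rw [ricci_eq hon]
    have h1 : 0 ≤ ∑ i, ∑ j, B.form ⁅f i, f j⁆ v * B.form ⁅f i, f j⁆ v :=
      Finset.sum_nonneg fun _ _ => Finset.sum_nonneg fun _ _ => mul_self_nonneg _
    suffices h : ∑ i, B.form ⁅v, f i⁆ ⁅v, f i⁆ ≤ Ω * B.form v v by linarith
    simp only [hform, ← Finset.sum_mul]
    rw [mul_comm Ω]
    refine mul_le_mul_of_nonneg_right ?_ hΩ0
    set z := f.repr v with hz
    have hv : v = ∑ k, (z (.inl k) * s) • (cb k : g) + (z (.inr 0) • x + z (.inr 1) • y) := by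
      conv_lhs => rw [← f.sum_repr v]
      simp only [Fintype.sum_sum_type, fl, Fin.sum_univ_two, f0, f1, smul_smul, hz]
    have hωlin : ∀ u : g, ω v u = ∑ k, z (.inl k) * s * ω (cb k) u
        + (z (.inr 0) * ω x u + z (.inr 1) * ω y u) := by
      intro u
      conv_lhs => rw [hv]
      simp [hω, sum_lie]
    have ex : ω v x = -z (.inr 1) := by
      rw [hωlin, hωx, hyx1, Finset.sum_eq_zero]
      · ring
      · intro k _
        rw [hskew, hpx _ (cb k).2]
        ring
    have ey : ω v y = z (.inr 0) := by
      rw [hωlin, hωy, hxy1, Finset.sum_eq_zero]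
      · ring
      · intro k _
        rw [hskew, hpy _ (cb k).2]
        ring
    have ec : ∀ i, ω v (s • (cb i : g)) = s ^ 2 * ∑ k, z (.inl k) * ω (cb k) (cb i) := by
      intro i
      have : ω v (s • (cb i : g)) = s * ω v (cb i) := by simp [hω]
      rw [this, hωlin, hpx _ (cb i).2, hpy _ (cb i).2, Finset.mul_sum]
      simp only [mul_zero, add_zero, Finset.mul_sum]
      exact Finset.sum_congr rfl fun _ _ => by ring
    have hvv : B.form v v = ∑ k, z (.inl k) ^ 2 + (z (.inr 0) ^ 2 + z (.inr 1) ^ 2) := by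
      rw [hB, InnerProd.ofBasis_form, Fintype.sum_sum_type, Fin.sum_univ_two]
      simp only [hz, sq]
    rw [hvv, Fintype.sum_sum_type]
    simp only [fl, Fin.sum_univ_two, f0, f1, ex, ey, ec]
    have hle : ∑ i, (s ^ 2 * ∑ k, z (.inl k) * ω (cb k) (cb i)) *
        (s ^ 2 * ∑ k, z (.inl k) * ω (cb k) (cb i)) ≤ ∑ k, z (.inl k) ^ 2 := by
      calc _ ≤ ∑ i, s ^ 4 * ((∑ k, z (.inl k) ^ 2) * ∑ k, ω (cb k) (cb i) ^ 2) := by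
            refine Finset.sum_le_sum fun i _ => ?_
            have := mul_le_mul_of_nonneg_left (Finset.sum_mul_sq_le_sq_mul_sq Finset.univ
              (fun k => z (.inl k)) (fun k => ω (cb k) (cb i))) (pow_nonneg hs0.le 4)
            linarith
        _ = (s ^ 4 * S) * ∑ k, z (.inl k) ^ 2 := by
            rw [← Finset.mul_sum, ← Finset.mul_sum, ← hS]
            ring
        _ ≤ 1 * ∑ k, z (.inl k) ^ 2 :=
            mul_le_mul_of_nonneg_right hsS (Finset.sum_nonneg fun _ _ => sq_nonneg _)
        _ = _ := one_mul _
    linarith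

end Minimal

/-! ### Generic conditions along affine lines, and recurrences of nilpotent operators. -/

section Density

variable {V : Type*} [AddCommGroup V] [Module ℝ V]

/-- Independence is generic along an affine family. -/
theorem eventually_linearIndependent {n : ℕ} (a b : Fin n → V) (hb : LinearIndependent ℝ b) :
    ∀ᶠ t in 𝓝[≠] (0 : ℝ), LinearIndependent ℝ fun i => a i + t • b i := by
  obtain ⟨π, hπ⟩ := (Fintype.linearCombination ℝ b).exists_leftInverse_of_injective
    (LinearMap.ker_eq_bot.mpr (linearIndependent_iff_injective_fintypeLinearCombination.mp hb))
  set E : Module.End ℝ (Fin n → ℝ) := π ∘ₗ Fintype.linearCombination ℝ a with hE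
  have hfin : {t : ℝ | E.HasEigenvalue (-t)}.Finite :=
    (Module.End.finite_hasEigenvalue E).preimage neg_injective.injOn
  have h0 : {t : ℝ | E.HasEigenvalue (-t)} ∩ {0}ᶜ ⊆ {t : ℝ | E.HasEigenvalue (-t)} :=
    Set.inter_subset_left
  have h1 : ({t : ℝ | E.HasEigenvalue (-t)} ∩ {0}ᶜ)ᶜ ∈ 𝓝 (0 : ℝ) :=
    (hfin.subset h0).isClosed.isOpen_compl.mem_nhds (by simp)
  filter_upwards [mem_nhdsWithin_of_mem_nhds h1, self_mem_nhdsWithin] with t ht ht0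
  rw [Fintype.linearIndependent_iff]
  intro c hc
  -- Applying the left inverse of b to a relation at parameter t makes -t an eigenvalue of `E`; this
  -- happens for finitely many t only.
  have h2 : E c = (-t) • c := by
    have h3 : Fintype.linearCombination ℝ a c + t • Fintype.linearCombination ℝ b c = 0 := by
      rw [← hc]
      simp only [Fintype.linearCombination_apply, smul_add, Finset.sum_add_distrib,
        Finset.smul_sum]
      congr 1
      exact Finset.sum_congr rfl fun _ _ => smul_comm _ _ _
    have h4 := congrArg π h3
    have h5 : π (Fintype.linearCombination ℝ b c) = c := LinearMap.congr_fun hπ c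
    rw [map_add, map_smul, h5, map_zero] at h4
    rw [neg_smul]
    exact eq_neg_of_add_eq_zero_left h4
  by_contra hne
  have hc0 : c ≠ 0 := fun h => hne fun i => congrFun h i
  exact ht ⟨Module.End.hasEigenvalue_of_hasEigenvector
    (Module.End.hasEigenvector_iff.mpr ⟨Module.End.mem_eigenspace_iff.mpr h2, hc0⟩), ht0⟩

theorem eventually_add_smul_ne_zero (a : V) {b : V} (hb : b ≠ 0) :
    ∀ᶠ t in 𝓝[≠] (0 : ℝ), a + t • b ≠ 0 := by
  filter_upwards [eventually_linearIndependent (fun _ : Fin 1 => a) (fun _ => b)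
    (linearIndependent_unique_iff.mpr hb)] with t ht
  exact ht.ne_zero 0

theorem tendsto_add_smul_zero [TopologicalSpace V] [IsTopologicalAddGroup V]
    [ContinuousSMul ℝ V] (a b : V) :
    Tendsto (fun t : ℝ => a + t • b) (𝓝[≠] 0) (𝓝 a) := by
  have h : Continuous fun t : ℝ => a + t • b := by fun_prop
  have := h.tendsto 0
  simp only [zero_smul, add_zero] at this
  exact this.mono_left nhdsWithin_le_nhds

/-- Two-term recurrences of a nilpotent operator degenerate. -/
theorem eq_zero_of_isNilpotent_of_recurrence {E : Module.End ℝ V} (hE : IsNilpotent E) {u : V}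
    (hu : u ≠ 0) {a b : ℝ} (h : E (E u) = a • E u + b • u) : b = 0 ∧ (E u = 0 ∨ a = 0) := by
  have hex : ∃ n, (E ^ n) u = 0 := by
    obtain ⟨n, hn⟩ := hE
    exact ⟨n, by rw [hn, LinearMap.zero_apply]⟩
  classical
  have hs := Nat.find_spec hex
  have hm := fun k => Nat.find_min hex (m := k)
  generalize Nat.find hex = n at hs hm
  have hrec : ∀ k, (E ^ (k + 2)) u = a • (E ^ (k + 1)) u + b • (E ^ k) u := by
    intro k
    rw [pow_add, pow_add, Module.End.mul_apply, Module.End.mul_apply, pow_one, pow_two,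
      Module.End.mul_apply, h, map_add, map_smul, map_smul]
  match n, hs, hm with
  | 0, hs, _ => exact absurd hs hu
  | 1, hs, _ =>
    rw [pow_one] at hs
    rw [hs, map_zero, smul_zero, zero_add] at h
    exact ⟨(smul_eq_zero.mp h.symm).resolve_right hu, .inl hs⟩
  | k + 2, hs, hm =>
    -- Since E ^ (k + 2) is the first power to kill u, the recurrence one step further isolates b,
    -- and the preceding one then isolates a.
    have h1 := hrec (k + 1)
    rw [hs, show k + 1 + 2 = 1 + (k + 2) by ring, pow_add, Module.End.mul_apply, hs, map_zero,
      smul_zero, zero_add] at h1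
    have hk := hm (k + 1) (by omega)
    have hb := (smul_eq_zero.mp h1.symm).resolve_right hk
    have h2 := hrec k
    rw [hs, hb, zero_smul, add_zero] at h2
    exact ⟨hb, .inr ((smul_eq_zero.mp h2.symm).resolve_right hk)⟩

end Density

/-! ### Density of the Ricci-minimal lines. -/

section Minimal

universe u
variable {g : Type u} [LieRing g] [LieAlgebra ℝ g]

/-- In a relation among x, [x, y], [x, v] the coefficient of x would be an eigenvalue of a nilpotent
ad, so it vanishes. Hence each ad x has rank at most one. Two image lines are compared through a
common second entry, with x + u in place of u when [u, y] = 0. -/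
theorem exists_forall_lie_eq_smul [LieRing.IsNilpotent g]
    (h : ∀ x y₁ y₂ : g, ¬ LinearIndependent ℝ ![x, ⁅x, y₁⁆, ⁅x, y₂⁆]) {x y : g}
    (hxy : ⁅x, y⁆ ≠ 0) (u v : g) : ∃ c : ℝ, ⁅u, v⁆ = c • ⁅x, y⁆ := by
  have key : ∀ x y : g, ⁅x, y⁆ ≠ 0 → ∀ v, ∃ c : ℝ, ⁅x, v⁆ = c • ⁅x, y⁆ := by
    intro x y hxy v
    have hx : x ≠ 0 := by
      rintro rfl
      simp at hxy
    have h1 := h x y v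
    rw [Fintype.linearIndependent_iff] at h1
    push Not at h1
    obtain ⟨c, hc, hne⟩ := h1
    simp only [Fin.sum_univ_three, Matrix.cons_val_zero, Matrix.cons_val_one,
      Matrix.cons_val] at hc
    have h0 : c 0 = 0 := by
      refine eq_zero_of_lie_eq_smul (v := c 1 • y + c 2 • v) (w := x) ?_ hx
      rw [← lie_skew]
      simp only [lie_add, lie_smul]
      rw [neg_eq_iff_add_eq_zero, ← hc]
      abel
    rw [h0, zero_smul, zero_add] at hc
    by_cases h2 : c 2 = 0
    · rw [h2, zero_smul, add_zero] at hc
      have h3 := (smul_eq_zero.mp hc).resolve_right hxy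
      obtain ⟨i, hi⟩ := hne
      fin_cases i <;> simp_all
    · refine ⟨-(c 1 / c 2), ?_⟩
      have : c 2 • ⁅x, v⁆ = c 2 • (-(c 1 / c 2)) • ⁅x, y⁆ := by
        rw [smul_smul, show c 2 * -(c 1 / c 2) = -c 1 by field_simp, neg_smul]
        exact eq_neg_of_add_eq_zero_right hc
      exact smul_right_injective g h2 this
  obtain ⟨c, hc⟩ : ∃ c : ℝ, ⁅u, y⁆ = c • ⁅x, y⁆ := by
    have hyx : ⁅y, x⁆ ≠ 0 := by rwa [← lie_skew, neg_ne_zero]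
    obtain ⟨c, hc⟩ := key y x hyx u
    refine ⟨c, ?_⟩
    rw [← lie_skew, hc, ← lie_skew x y, smul_neg]
  by_cases h0 : ⁅u, y⁆ = 0
  · obtain ⟨c₁, hc₁⟩ := key (x + u) y (by rwa [add_lie, h0, add_zero]) v
    obtain ⟨c₂, hc₂⟩ := key x y hxy v
    refine ⟨c₁ - c₂, ?_⟩
    rw [add_lie, add_lie, h0, add_zero, hc₂] at hc₁
    rw [sub_smul, ← hc₁]
    abel
  · obtain ⟨c₁, hc₁⟩ := key u y h0 v
    exact ⟨c₁ * c, by rw [hc₁, hc, smul_smul]⟩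

variable [FiniteDimensional ℝ g]

theorem ricci_eq_zero_of_abelian [LieRing.IsNilpotent g] (h : ∀ x y : g, ⁅x, y⁆ = 0)
    (B : InnerProd g) (x y : g) : ricci B x y = 0 := by
  obtain ⟨f, hf⟩ := exists_isONB B
  rw [ricci_eq hf]
  simp [h]

variable [LieRing.IsNilpotent g]

/-- A single independent triple x₀, [x₀, y₁], [x₀, y₂] makes independence generic on every line
through x in direction x₀, and the semidirect model applies. Without such a triple all brackets are
proportional and generic vectors are noncentral. For abelian g the Ricci form is zero. -/
theorem closure_ricciMinimal [TopologicalSpace g] [IsTopologicalAddGroup g]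
    [ContinuousSMul ℝ g] : closure (ricciMinimal g) = Set.univ := by
  refine Set.eq_univ_of_forall fun p => ?_
  induction p with | _ x hx
  by_cases hab : ∀ x y : g, ⁅x, y⁆ = 0
  · refine subset_closure (mk_mem_ricciMinimal_of_rayleigh hx
      (InnerProd.ofBasis (Module.finBasis ℝ g)) 0 ?_ fun v => ?_)
    · rw [ricci_eq_zero_of_abelian hab, zero_mul]
    · rw [ricci_eq_zero_of_abelian hab, zero_mul]
  push Not at hab
  obtain ⟨x₀, y₀, hxy⟩ := hab
  rw [← closure_closure]
  by_cases hli : ∃ x₀ y₁ y₂ : g, LinearIndependent ℝ ![x₀, ⁅x₀, y₁⁆, ⁅x₀, y₂⁆]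
  · obtain ⟨x₀, y₁, y₂, hli⟩ := hli
    have h1 := eventually_linearIndependent ![x, ⁅x, y₁⁆, ⁅x, y₂⁆] _ hli
    refine mk_mem_closure_of_tendsto hx _ (tendsto_add_smul_zero x x₀) ?_ ?_
    · filter_upwards [h1] with t ht h0
      refine mem_closure_ricciMinimal (y₁ := y₁) (y₂ := y₂) h0 fun c c₁ c₂ hc => ?_
      rw [Fintype.linearIndependent_iff] at ht
      have := ht ![c, c₁, c₂] (by
        rw [← hc]
        simp [Fin.sum_univ_three])
      exact ⟨this 1, this 2⟩
    · filter_upwards [h1] with t ht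
      exact ht.ne_zero 0
  · push Not at hli
    have h1 := eventually_add_smul_ne_zero ⁅x, y₀⁆ hxy
    have h2 : ∀ t : ℝ, ⁅x + t • x₀, y₀⁆ = ⁅x, y₀⁆ + t • ⁅x₀, y₀⁆ := fun t => by simp
    refine mk_mem_closure_of_tendsto hx _ (tendsto_add_smul_zero x x₀) ?_ ?_
    · filter_upwards [h1] with t ht h0
      exact subset_closure (mem_ricciMinimal_of_heisenberg (exists_forall_lie_eq_smul hli hxy) h0
        (by rwa [h2]))
    · filter_upwards [h1] with t ht h0
      rw [← h2, h0, zero_lie] at ht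
      exact ht rfl

end Minimal

/-! ### Projective subspaces are closed; orthogonal decomposition. -/

section Projective

variable {V : Type*} [AddCommGroup V] [Module ℝ V]

theorem mk_mem_projSet {W : Submodule ℝ V} {x : V} (hx : x ≠ 0) :
    Projectivization.mk ℝ x hx ∈ projSet W ↔ x ∈ W := by
  change (Projectivization.mk ℝ x hx).submodule ≤ W ↔ x ∈ W
  rw [Projectivization.submodule_mk, Submodule.span_singleton_le_iff_mem]

theorem isClosed_projSet [FiniteDimensional ℝ V] [TopologicalSpace V] [IsTopologicalAddGroup V]
    [ContinuousSMul ℝ V] [T2Space V] (W : Submodule ℝ V) : IsClosed (projSet W) := by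
  refine isClosed_coinduced.mpr ?_
  have h : (Projectivization.mk' ℝ : {v : V // v ≠ 0} → ℙ ℝ V) ⁻¹' projSet W
      = Subtype.val ⁻¹' (W : Set V) := by
    ext v
    exact mk_mem_projSet v.2
  rw [h]
  exact W.closed_of_finiteDimensional.preimage continuous_subtype_val

theorem InnerProd.exists_orthogonal_decomposition [FiniteDimensional ℝ V] (B : InnerProd V)
    (W : Submodule ℝ V) (x : V) : ∃ w ∈ W, ∀ u ∈ W, B.form u (x - w) = 0 := by
  have hrefl : B.form.IsRefl := fun u v h => by rw [B.symm, h]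
  let BW : InnerProd W :=
    { form := B.form.restrict W
      symm := fun u v => B.symm u v
      pos := fun u hu => B.pos u (by simpa using hu) }
  have hc := LinearMap.BilinForm.isCompl_orthogonal_of_restrict_nondegenerate hrefl
    (W := W) BW.nondegenerate
  obtain ⟨w, hw, v, hv, hwv⟩ := Submodule.mem_sup.mp
    (hc.sup_eq_top ▸ Submodule.mem_top : x ∈ W ⊔ B.form.orthogonal W)
  refine ⟨w, hw, fun u hu => ?_⟩
  rw [← hwv, add_sub_cancel_left]
  exact hv u hu

end Projective

/-! ### Where Ricci-maximal lines must lie. -/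

section UpperBounds

universe u
variable {g : Type u} [LieRing g] [LieAlgebra ℝ g]

theorem lie_mem_derivedAlgebra (x y : g) : ⁅x, y⁆ ∈ derivedAlgebra g :=
  LieSubmodule.lie_mem_lie (I := ⊤) (N := ⊤) (LieSubmodule.mem_top x) (LieSubmodule.mem_top y)

theorem derivedAlgebra_eq_span :
    derivedAlgebra g = Submodule.span ℝ {z : g | ∃ x y : g, ⁅x, y⁆ = z} := by
  rw [derivedAlgebra, LieSubmodule.lieIdeal_oper_eq_linear_span']
  simp

theorem derivedAlgebra_le {W : Submodule ℝ g} (h : ∀ x y : g, ⁅x, y⁆ ∈ W) :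
    derivedAlgebra g ≤ W := by
  rw [derivedAlgebra_eq_span, Submodule.span_le]
  rintro _ ⟨x, y, rfl⟩
  exact h x y

theorem lie_eq_zero_of_mem_derivedAlgebra (h : ∀ x y z : g, ⁅x, ⁅y, z⁆⁆ = 0) {z : g}
    (hz : z ∈ derivedAlgebra g) (x : g) : ⁅x, z⁆ = 0 := by
  have : derivedAlgebra g ≤ LinearMap.ker (LieModule.toEnd ℝ g g x) :=
    derivedAlgebra_le fun y z => h x y z
  exact this hz

theorem IsCodimOneAbelian.exists_sub_smul_mem {a : LieIdeal ℝ g} (ha : IsCodimOneAbelian a) {v : g}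
    (hv : v ∉ a) (u : g) : ∃ c : ℝ, u - c • v ∈ a := by
  have hv' : (Submodule.Quotient.mk v : g ⧸ a.toSubmodule) ≠ 0 := fun h =>
    hv ((Submodule.Quotient.mk_eq_zero _).mp h)
  obtain ⟨c, hc⟩ := (finrank_eq_one_iff_of_nonzero' _ hv').mp ha.2 (Submodule.Quotient.mk u)
  refine ⟨c, ?_⟩
  rw [← Submodule.Quotient.mk_smul] at hc
  exact (Submodule.Quotient.eq _).mp hc.symm

theorem IsCodimOneAbelian.exists_notMem {a : LieIdeal ℝ g} (ha : IsCodimOneAbelian a) :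
    ∃ v, v ∉ a := by
  by_contra! h
  have : a.toSubmodule = ⊤ := eq_top_iff.mpr fun v _ => h v
  have h1 := ha.2
  rw [this, Module.finrank_zero_of_subsingleton] at h1
  exact zero_ne_one h1

theorem IsCodimOneAbelian.lie_mem {a : LieIdeal ℝ g} (ha : IsCodimOneAbelian a) (x y : g) :
    ⁅x, y⁆ ∈ a := by
  obtain ⟨v, hv⟩ := ha.exists_notMem
  obtain ⟨c, hc⟩ := ha.exists_sub_smul_mem hv x
  obtain ⟨d, hd⟩ := ha.exists_sub_smul_mem hv y
  have h : ⁅x, y⁆ = ⁅x, y - d • v⁆ - d • ⁅v, x - c • v⁆ := by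
    simp only [lie_sub, lie_smul, lie_self, smul_zero, sub_zero]
    rw [← lie_skew x v]
    module
  rw [h]
  exact a.sub_mem (LieSubmodule.lie_mem _ hd) (a.smul_mem _ (LieSubmodule.lie_mem _ hc))

theorem exists_central_ne_zero [LieRing.IsNilpotent g] [Nontrivial g] : ∃ z : g, z ≠ 0 ∧ ∀ x : g, ⁅x, z⁆ = 0 := by
  have : Nontrivial (LieAlgebra.center ℝ g) := LieAlgebra.non_trivial_center_of_isNilpotent
  obtain ⟨z, hz⟩ := exists_ne (0 : LieAlgebra.center ℝ g)
  exact ⟨z, by simpa using hz, fun x => z.2 x⟩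

variable [FiniteDimensional ℝ g] [LieRing.IsNilpotent g]

theorem ricci_eq_of_central {ι : Type*} [Fintype ι] [DecidableEq ι] {B : InnerProd g} {e : Module.Basis ι ℝ g}
    (he : IsONB B e) {z : g} (hz : ∀ x : g, ⁅x, z⁆ = 0) (y : g) :
    ricci B z y = 1 / 4 * ∑ i, ∑ j, B.form ⁅e i, e j⁆ z * B.form ⁅e i, e j⁆ y := by
  have hz' : ∀ x : g, ⁅z, x⁆ = 0 := fun x => by rw [← lie_skew, hz, neg_zero]
  rw [ricci_eq he]
  simp [hz']

theorem ricci_eq_of_orthogonal {ι : Type*} [Fintype ι] [DecidableEq ι] {B : InnerProd g} {e : Module.Basis ι ℝ g}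
    (he : IsONB B e) {v : g} (hv : ∀ x y : g, B.form ⁅x, y⁆ v = 0) (y : g) :
    ricci B v y = -(1 / 2) * ∑ i, B.form ⁅v, e i⁆ ⁅y, e i⁆ := by
  rw [ricci_eq he]
  simp [hv]

/-- A nonzero bracket is central and cannot be orthogonal to all brackets, so its Ricci curvature is
positive and μ > 0. For the component v of x orthogonal to g', the number μ|v|² = Ric(x, v) is
nonpositive, because the other component is central; so v = 0. -/
theorem mem_derivedAlgebra_of_mem_ricciMaximal (h : IsTwoStepNilpotent g) {x : g} (hx : x ≠ 0)
    (hM : Projectivization.mk ℝ x hx ∈ ricciMaximal g) : x ∈ derivedAlgebra g := by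
  obtain ⟨B, μ, hμ, hmax⟩ := (mk_mem_ricciMaximal_iff hx).mp hM
  obtain ⟨e, he⟩ := exists_isONB B
  obtain ⟨h0, p, q, hpq⟩ := h
  have hμ0 : 0 < μ := by
    set z := ⁅p, q⁆ with hz
    have h1 : 0 < ricci B z z := by
      rw [ricci_eq_of_central he fun x => h0 x p q]
      have hnn : ∀ i, 0 ≤ ∑ j, B.form ⁅e i, e j⁆ z * B.form ⁅e i, e j⁆ z := fun i =>
        Finset.sum_nonneg fun j _ => mul_self_nonneg _
      refine mul_pos (by norm_num) (lt_of_le_of_ne (Finset.sum_nonneg fun i _ => hnn i) ?_)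
      intro hs
      have h2 : ∀ i j, B.form ⁅e i, e j⁆ z = 0 := by
        intro i j
        have h3 := (Finset.sum_eq_zero_iff_of_nonneg fun i _ => hnn i).mp hs.symm i
          (Finset.mem_univ i)
        have h4 := (Finset.sum_eq_zero_iff_of_nonneg fun j _ => mul_self_nonneg _).mp h3 j
          (Finset.mem_univ j)
        exact mul_self_eq_zero.mp h4
      have h5 : ∀ p q : g, B.form ⁅p, q⁆ z = 0 := by
        intro p q
        rw [← e.sum_repr p, ← e.sum_repr q]
        simp only [sum_lie, lie_sum, smul_lie, lie_smul, map_sum, map_smul, LinearMap.sum_apply,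
          LinearMap.smul_apply, h2, smul_zero, Finset.sum_const_zero]
      exact hpq (B.form_self_eq_zero.mp (h5 p q))
    by_contra hneg
    exact (h1.trans_le (hmax z)).not_ge
      (mul_nonpos_of_nonpos_of_nonneg (not_lt.mp hneg) (B.form_self_nonneg z))
  obtain ⟨w, hw, hort⟩ := B.exists_orthogonal_decomposition (derivedAlgebra g) x
  set v := x - w with hv
  have h1 : ricci B x v = μ * B.form x v := by
    rw [← form_ricciOp, hμ, map_smul, LinearMap.smul_apply, smul_eq_mul]
  have h2 : B.form x v = B.form v v := by
    rw [show x = v + w by rw [hv]; abel, map_add, LinearMap.add_apply, hort w hw, add_zero]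
  have hwl : ∀ u : g, ⁅w, u⁆ = 0 := fun u => by
    rw [← lie_skew, lie_eq_zero_of_mem_derivedAlgebra h0 hw, neg_zero]
  have h3 : ricci B x v = -(1 / 2) * ∑ i, B.form ⁅v, e i⁆ ⁅v, e i⁆ := by
    rw [ricci_symm, ricci_eq_of_orthogonal he fun x y => hort _ (lie_mem_derivedAlgebra x y)]
    congr 1
    refine Finset.sum_congr rfl fun i _ => ?_
    conv_lhs => rw [show x = v + w by rw [hv]; abel, add_lie, hwl, add_zero]
  have h4 : 0 ≤ ∑ i, B.form ⁅v, e i⁆ ⁅v, e i⁆ :=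
    Finset.sum_nonneg fun i _ => B.form_self_nonneg _
  have h5 : v = 0 := by
    by_contra hne
    have := mul_pos hμ0 (B.pos v hne)
    rw [← h2, ← h1, h3] at this
    linarith
  rw [sub_eq_zero.mp (hv.symm.trans h5)]
  exact hw

/-- Here μ ≥ 0 by testing on a central vector. If v is the normal component of x and w the other
one, then ad w sees only the v-direction, so Ric(v, w) is a multiple of ⟨[v, v], [w, v]⟩ = 0. Hence
μ|v|² = Ric(v, v), which is negative if v ≠ 0, since a central v would make g abelian. -/
theorem IsCodimOneAbelian.mem_of_mem_ricciMaximal {a : LieIdeal ℝ g} (ha : IsCodimOneAbelian a)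
    (hab : ∃ x y : g, ⁅x, y⁆ ≠ 0) {x : g} (hx : x ≠ 0)
    (hM : Projectivization.mk ℝ x hx ∈ ricciMaximal g) : x ∈ a := by
  obtain ⟨B, μ, hμ, hmax⟩ := (mk_mem_ricciMaximal_iff hx).mp hM
  obtain ⟨e, he⟩ := exists_isONB B
  obtain ⟨p, q, hpq⟩ := hab
  have : Nontrivial g := ⟨x, 0, hx⟩
  have hμ0 : 0 ≤ μ := by
    obtain ⟨z, hz, hzc⟩ := exists_central_ne_zero (g := g)
    have h1 : 0 ≤ ricci B z z := by
      rw [ricci_eq_of_central he hzc]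
      exact mul_nonneg (by norm_num)
        (Finset.sum_nonneg fun _ _ => Finset.sum_nonneg fun _ _ => mul_self_nonneg _)
    exact nonneg_of_mul_nonneg_left (h1.trans (hmax z)) (B.pos z hz)
  obtain ⟨w, hw, hort⟩ := B.exists_orthogonal_decomposition a.toSubmodule x
  set v := x - w with hv
  have hxv : x = v + w := by rw [hv]; abel
  by_contra hxa
  have hva : v ∉ a := fun h => hxa (by rw [hxv]; exact a.add_mem h hw)
  have hv0 : v ≠ 0 := fun h => hva (h ▸ a.zero_mem)
  have hvo : ∀ x y, B.form ⁅x, y⁆ v = 0 := fun x y => hort _ (ha.lie_mem x y)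
  have h1 : ricci B x v = μ * B.form x v := by
    rw [← form_ricciOp, hμ, map_smul, LinearMap.smul_apply, smul_eq_mul]
  have h2 : B.form x v = B.form v v := by
    conv_lhs => rw [hxv, map_add, LinearMap.add_apply, hort w hw, add_zero]
  have hwl : ∀ u : g, ⁅w, u⁆ = (B.form u v / B.form v v) • ⁅w, v⁆ := by
    intro u
    obtain ⟨c, hc⟩ := ha.exists_sub_smul_mem hva u
    have h3 : B.form u v = c * B.form v v := by
      have := hort _ hc
      simp only [map_sub, map_smul, LinearMap.sub_apply, LinearMap.smul_apply, smul_eq_mul] at this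
      linarith
    have h4 := ha.1 w hw _ hc
    rw [lie_sub, lie_smul, sub_eq_zero] at h4
    rw [h4, h3, mul_div_assoc, div_self (B.pos v hv0).ne', mul_one]
  have h3 : ricci B v w = 0 := by
    rw [ricci_eq_of_orthogonal he hvo]
    have h4 : ∑ i, B.form ⁅v, e i⁆ ⁅w, e i⁆ = (1 / B.form v v) * B.form ⁅v, v⁆ ⁅w, v⁆ := by
      conv_rhs => enter [2, 1, 2, 2]; rw [← he.sum_smul v]
      rw [lie_sum, map_sum, LinearMap.sum_apply, Finset.mul_sum]
      refine Finset.sum_congr rfl fun i _ => ?_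
      rw [hwl, lie_smul]
      simp only [map_smul, LinearMap.smul_apply, smul_eq_mul]
      rw [B.symm (e i) v]
      ring
    rw [h4]
    simp
  have h4 : ricci B v v = -(1 / 2) * ∑ i, B.form ⁅v, e i⁆ ⁅v, e i⁆ :=
    ricci_eq_of_orthogonal he hvo v
  have h5 : 0 < ∑ i, B.form ⁅v, e i⁆ ⁅v, e i⁆ := by
    refine lt_of_le_of_ne (Finset.sum_nonneg fun i _ => B.form_self_nonneg _) fun hs => ?_
    have h6 : ∀ i, ⁅v, e i⁆ = 0 := fun i => B.form_self_eq_zero.mp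
      ((Finset.sum_eq_zero_iff_of_nonneg fun i _ => B.form_self_nonneg _).mp hs.symm i
        (Finset.mem_univ i))
    have h7 : ∀ u : g, ⁅v, u⁆ = 0 := by
      intro u
      rw [← e.sum_repr u, lie_sum]
      exact Finset.sum_eq_zero fun i _ => by rw [lie_smul, h6, smul_zero]
    have h8 : ∀ u : g, ⁅u, v⁆ = 0 := fun u => by rw [← lie_skew, h7, neg_zero]
    obtain ⟨c, hc⟩ := ha.exists_sub_smul_mem hva p
    obtain ⟨d, hd⟩ := ha.exists_sub_smul_mem hva q
    have h9 := ha.1 _ hc _ hd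
    rw [lie_sub, sub_lie, sub_lie] at h9
    simp only [lie_smul, smul_lie, h7, h8, smul_zero, sub_zero] at h9
    exact hpq h9
  have h6 : ricci B x v = ricci B v v := by
    conv_lhs => rw [hxv, map_add, LinearMap.add_apply, ricci_symm B w v, h3, add_zero]
  have := mul_nonneg hμ0 (B.form_self_nonneg v)
  rw [← h2, ← h1, h6, h4] at this
  linarith

end UpperBounds

/-! ### Realizing every line of the derived algebra in the two-step case. -/

section TwoStep

universe u
variable {g : Type u} [LieRing g] [LieAlgebra ℝ g] [FiniteDimensional ℝ g]
  [LieRing.IsNilpotent g]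

/-- In a two-step nilpotent algebra, a suitable inner product has Ricci operator `1 / 4` on the
derived algebra and a nonpositive one on its orthogonal complement. -/
theorem mem_ricciMaximal_of_mem_derivedAlgebra (h : ∀ x y z : g, ⁅x, ⁅y, z⁆⁆ = 0) {x : g}
    (hx : x ≠ 0) (hxW : x ∈ derivedAlgebra g) :
    Projectivization.mk ℝ x hx ∈ ricciMaximal g := by
  set W := derivedAlgebra g with hW
  obtain ⟨V, hWV⟩ := W.exists_isCompl
  set v := Module.finBasis ℝ V with hv
  let bw : ∀ i j, W := fun i j => ⟨⁅(v i : g), (v j : g)⁆, lie_mem_derivedAlgebra _ _⟩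
  have hcentral : ∀ u ∈ W, ∀ y : g, ⁅y, u⁆ = 0 := fun u hu y =>
    lie_eq_zero_of_mem_derivedAlgebra h hu y
  have hcentral' : ∀ u ∈ W, ∀ y : g, ⁅u, y⁆ = 0 := fun u hu y => by
    rw [← lie_skew, hcentral u hu, neg_zero]
  -- Up to the factor 1/4 this is the positive part of the Ricci form, seen on functionals of W. It
  -- is definite because the brackets of the complement V span W.
  let Q : InnerProd (Module.Dual ℝ W) :=
    { form := LinearMap.mk₂ ℝ (fun φ ψ => ∑ i, ∑ j, φ (bw i j) * ψ (bw i j))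
        (fun _ _ _ => by simp only [LinearMap.add_apply, add_mul, Finset.sum_add_distrib])
        (fun _ _ _ => by
          simp only [LinearMap.smul_apply, smul_eq_mul, mul_assoc, Finset.mul_sum])
        (fun _ _ _ => by simp only [LinearMap.add_apply, mul_add, Finset.sum_add_distrib])
        (fun _ _ _ => by
          simp only [LinearMap.smul_apply, smul_eq_mul, mul_left_comm, Finset.mul_sum])
      symm := fun φ ψ => by simp only [LinearMap.mk₂_apply, mul_comm]
      pos := fun φ hφ => by
        have hnn : ∀ i, 0 ≤ ∑ j, φ (bw i j) * φ (bw i j) := fun i =>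
          Finset.sum_nonneg fun j _ => mul_self_nonneg _
        rw [LinearMap.mk₂_apply]
        refine lt_of_le_of_ne (Finset.sum_nonneg fun i _ => hnn i) fun hs => hφ ?_
        have h2 : ∀ i j, φ (bw i j) = 0 := by
          intro i j
          have h3 := (Finset.sum_eq_zero_iff_of_nonneg fun i _ => hnn i).mp hs.symm i
            (Finset.mem_univ i)
          exact mul_self_eq_zero.mp ((Finset.sum_eq_zero_iff_of_nonneg
            fun j _ => mul_self_nonneg _).mp h3 j (Finset.mem_univ j))
        have h4 : W ≤ (LinearMap.ker φ).map W.subtype := by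
          refine derivedAlgebra_le fun p q => ?_
          obtain ⟨p₁, hp₁, p₂, hp₂, rfl⟩ := Submodule.mem_sup.mp
            (hWV.sup_eq_top ▸ Submodule.mem_top : p ∈ W ⊔ V)
          obtain ⟨q₁, hq₁, q₂, hq₂, rfl⟩ := Submodule.mem_sup.mp
            (hWV.sup_eq_top ▸ Submodule.mem_top : q ∈ W ⊔ V)
          rw [add_lie, hcentral' p₁ hp₁, lie_add, hcentral q₁ hq₁, zero_add, zero_add]
          have e1 : p₂ = ∑ i, v.repr ⟨p₂, hp₂⟩ i • (v i : g) := by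
            conv_lhs => rw [show p₂ = V.subtype ⟨p₂, hp₂⟩ from rfl, ← v.sum_repr ⟨p₂, hp₂⟩]
            simp only [map_sum, map_smul, Submodule.subtype_apply]
          have e2 : q₂ = ∑ i, v.repr ⟨q₂, hq₂⟩ i • (v i : g) := by
            conv_lhs => rw [show q₂ = V.subtype ⟨q₂, hq₂⟩ from rfl, ← v.sum_repr ⟨q₂, hq₂⟩]
            simp only [map_sum, map_smul, Submodule.subtype_apply]
          rw [e1, e2, sum_lie]
          refine Submodule.sum_mem _ fun i _ => ?_
          rw [lie_sum]
          refine Submodule.sum_mem _ fun j _ => ?_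
          rw [smul_lie, lie_smul]
          exact Submodule.smul_mem _ _ (Submodule.smul_mem _ _ ⟨bw i j, h2 i j, rfl⟩)
        ext u
        obtain ⟨u', hu', hu''⟩ := h4 u.2
        rw [show u = u' from Subtype.ext hu''.symm]
        exact hu' }
  obtain ⟨ψ, hψ⟩ := exists_isONB Q
  -- The metric on W is chosen dual to Q, so the positive part of the Ricci form becomes exactly 1/4
  -- of the squared norm of the W-component.
  set z : Module.Basis _ ℝ W := ψ.dualBasis.map (Module.evalEquiv ℝ W).symm with hz
  have hzψ : ∀ (u : W) k, z.repr u k = ψ k u := by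
    intro u k
    simp [hz]
  set f := (v.prod z).map (Submodule.prodEquivOfIsCompl V W hWV.symm) with hf
  have fl : ∀ i, f (.inl i) = v i := fun i => by simp [hf]
  have fr : ∀ k, f (.inr k) = z k := fun k => by simp [hf]
  have hfW : ∀ u : W, (Submodule.prodEquivOfIsCompl V W hWV.symm).symm (u : g) = (0, u) := by
    intro u
    rw [LinearEquiv.symm_apply_eq]
    simp
  have reprl : ∀ (u : W) i, f.repr (u : g) (.inl i) = 0 := by
    intro u i
    simp [hf]
  have reprr : ∀ (u : W) k, f.repr (u : g) (.inr k) = ψ k u := by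
    intro u k
    rw [← hzψ]
    simp [hf]
  set B := InnerProd.ofBasis f with hB
  have hon : IsONB B f := isONB_ofBasis f
  -- This is the functional ⟨·, y⟩ on W; as ψ is Q-orthonormal, y ↦ θ y turns Q into the metric on
  -- W-components.
  let θ : g → Module.Dual ℝ W := fun y => ∑ k, f.repr y (.inr k) • ψ k
  have hBθ : ∀ (u : W) (y : g), B.form u y = θ y u := by
    intro u y
    rw [hB, InnerProd.ofBasis_form, Fintype.sum_sum_type]
    simp only [reprl, reprr, zero_mul, Finset.sum_const_zero, zero_add, θ, LinearMap.sum_apply,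
      LinearMap.smul_apply, smul_eq_mul]
    exact Finset.sum_congr rfl fun _ _ => mul_comm _ _
  have hQθ : ∀ y y' : g, Q.form (θ y) (θ y')
      = ∑ k, f.repr y (.inr k) * f.repr y' (.inr k) := by
    intro y y'
    have hr : ∀ (y : g) k, ψ.repr (θ y) k = f.repr y (.inr k) := by
      intro y k
      exact congrFun (ψ.repr_sum_self fun k => f.repr y (.inr k)) k
    rw [hψ.form_eq]
    simp only [hψ.repr_eq, hr]
  have hric : ∀ y y' : g, ricci B y y' = -(1 / 2) * ∑ i, B.form ⁅y, f i⁆ ⁅y', f i⁆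
      + 1 / 4 * ∑ k, f.repr y (.inr k) * f.repr y' (.inr k) := by
    intro y y'
    rw [ricci_eq hon, ← hQθ]
    congr 2
    have hz0 : ∀ k (y : g), ⁅y, (z k : g)⁆ = 0 := fun k y => hcentral _ (z k).2 y
    have hz1 : ∀ k (y : g), ⁅(z k : g), y⁆ = 0 := fun k y => hcentral' _ (z k).2 y
    simp only [Fintype.sum_sum_type, fl, fr, hz0, hz1, map_zero, LinearMap.zero_apply, mul_zero,
      Finset.sum_const_zero, add_zero]
    refine Finset.sum_congr rfl fun i _ => Finset.sum_congr rfl fun j _ => ?_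
    rw [← hBθ, ← hBθ]
  have hform : ∀ y : g, B.form y y = ∑ i, f.repr y (.inl i) ^ 2 + ∑ k, f.repr y (.inr k) ^ 2 := by
    intro y
    rw [hB, InnerProd.ofBasis_form, Fintype.sum_sum_type]
    simp only [sq]
  have hx0 : ∀ y, ricci B x y = 1 / 4 * B.form x y := by
    intro y
    have h1 := hBθ ⟨x, hxW⟩ y
    rw [hric, hB, InnerProd.ofBasis_form, Fintype.sum_sum_type]
    have h2 : ∀ i, f.repr x (.inl i) = 0 := reprl ⟨x, hxW⟩
    simp [h2, hcentral' x hxW]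
  refine (mk_mem_ricciMaximal_iff hx).mpr ⟨B, 1 / 4, ?_, fun y => ?_⟩
  · have h1 : ∀ y, B.form (ricciOp B x - (1 / 4 : ℝ) • x) y = 0 := fun y => by
      rw [map_sub, LinearMap.sub_apply, form_ricciOp, hx0, map_smul, LinearMap.smul_apply,
        smul_eq_mul, sub_self]
    exact eq_of_sub_eq_zero (B.form_self_eq_zero.mp (h1 _))
  · rw [hric, hform]
    have h1 : 0 ≤ ∑ i, B.form ⁅y, f i⁆ ⁅y, f i⁆ :=
      Finset.sum_nonneg fun i _ => B.form_self_nonneg _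
    have h2 : 0 ≤ ∑ i, f.repr y (.inl i) ^ 2 := Finset.sum_nonneg fun i _ => sq_nonneg _
    simp only [← sq]
    linarith

end TwoStep

/-! ### Separating functionals and nonvanishing of quadratics. -/

section Dual

variable {V : Type*} [AddCommGroup V] [Module ℝ V]

theorem exists_dual_eq_one_of_notMem {p : Submodule ℝ V} {v : V} (hv : v ∉ p) :
    ∃ φ : Module.Dual ℝ V, φ v = 1 ∧ ∀ u ∈ p, φ u = 0 := by
  obtain ⟨f, hf, hp⟩ := p.exists_le_ker_of_notMem hv
  exact ⟨(f v)⁻¹ • f, by simp [hf], fun u hu => by simp [LinearMap.mem_ker.mp (hp hu)]⟩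

theorem exists_dual_ne_zero_pair {a b : V} (ha : a ≠ 0) (hb : b ≠ 0) :
    ∃ φ : Module.Dual ℝ V, φ a ≠ 0 ∧ φ b ≠ 0 := by
  obtain ⟨φ, hφ⟩ := Module.Projective.exists_dual_eq_one ℝ ha
  obtain ⟨ψ, hψ⟩ := Module.Projective.exists_dual_eq_one ℝ hb
  by_cases h1 : φ b = 0
  · by_cases h2 : ψ a = 0
    · exact ⟨φ + ψ, by simp [hφ, h2], by simp [hψ, h1]⟩
    · exact ⟨ψ, h2, by simp [hψ]⟩
  · exact ⟨φ, by simp [hφ], h1⟩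

theorem exists_eq_smul_of_dual {v u : V} (h : ∀ φ : Module.Dual ℝ V, φ v = 0 → φ u = 0) :
    ∃ c : ℝ, u = c • v := by
  by_contra! hne
  have hu : u ∉ Submodule.span ℝ {v} := fun hu => by
    obtain ⟨c, hc⟩ := Submodule.mem_span_singleton.mp hu
    exact hne c hc.symm
  obtain ⟨φ, h1, h2⟩ := exists_dual_eq_one_of_notMem hu
  rw [h φ (h2 v (Submodule.mem_span_singleton_self v))] at h1
  exact zero_ne_one h1

theorem eventually_quadratic_ne_zero {a b c : ℝ} (h : a ≠ 0 ∨ c ≠ 0) :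
    ∀ᶠ t in 𝓝[≠] (0 : ℝ), a + t * b + t ^ 2 * c ≠ 0 := by
  have hc : ∀ a b : ℝ, a ≠ 0 → ∀ᶠ t in 𝓝[≠] (0 : ℝ), a + t * b ≠ 0 := by
    intro a b ha
    have h1 : ContinuousAt (fun t : ℝ => a + t * b) 0 := by fun_prop
    exact nhdsWithin_le_nhds (h1.eventually_ne (by simpa using ha))
  by_cases ha : a = 0
  · have hcc := h.resolve_left (not_not.mpr ha)
    filter_upwards [self_mem_nhdsWithin, eventually_add_smul_ne_zero b hcc] with t ht h1
    rw [show a + t * b + t ^ 2 * c = t * (b + t • c) by rw [ha, smul_eq_mul]; ring]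
    exact mul_ne_zero ht h1
  · have h1 : ContinuousAt (fun t : ℝ => a + t * b + t ^ 2 * c) 0 := by fun_prop
    exact nhdsWithin_le_nhds (h1.eventually_ne (by simpa using ha))

end Dual

/-! ### Generic elements of a nilpotent Lie algebra. -/

section Generic

universe u
variable {g : Type u} [LieRing g] [LieAlgebra ℝ g]

/-- After pairing with a functional the expression is a quadratic polynomial in t whose constant or
leading coefficient is nonzero. -/
theorem eventually_lie_lie_ne_zero {a b : g} {z : g} (h : ⁅a, ⁅a, z⁆⁆ ≠ 0 ∨ ⁅b, ⁅b, z⁆⁆ ≠ 0) :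
    ∀ᶠ t in 𝓝[≠] (0 : ℝ), ⁅a + t • b, ⁅a + t • b, z⁆⁆ ≠ 0 := by
  obtain ⟨φ, hφ⟩ : ∃ φ : Module.Dual ℝ g, φ ⁅a, ⁅a, z⁆⁆ ≠ 0 ∨ φ ⁅b, ⁅b, z⁆⁆ ≠ 0 := by
    rcases h with h | h
    · obtain ⟨φ, hφ⟩ := Module.Projective.exists_dual_eq_one ℝ h
      exact ⟨φ, .inl (by simp [hφ])⟩
    · obtain ⟨φ, hφ⟩ := Module.Projective.exists_dual_eq_one ℝ h
      exact ⟨φ, .inr (by simp [hφ])⟩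
  filter_upwards [eventually_quadratic_ne_zero (b := φ ⁅a, ⁅b, z⁆⁆ + φ ⁅b, ⁅a, z⁆⁆) hφ]
    with t ht h0
  apply ht
  have h1 := congrArg φ h0
  simp only [add_lie, smul_lie, lie_add, lie_smul, map_add, map_smul, smul_eq_mul, map_zero] at h1
  linarith

theorem eventually_notMem {p : Submodule ℝ g} (a : g) {b : g} (hb : b ∉ p) :
    ∀ᶠ t in 𝓝[≠] (0 : ℝ), a + t • b ∉ p := by
  have hb' : p.mkQ b ≠ 0 := fun h => hb ((Submodule.Quotient.mk_eq_zero _).mp h)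
  filter_upwards [eventually_add_smul_ne_zero (p.mkQ a) hb'] with t ht h0
  apply ht
  rw [← map_smul, ← map_add]
  exact (Submodule.Quotient.mk_eq_zero _).mpr h0

/-- A 2-Engel real Lie algebra has class at most two. -/
theorem exists_lie_lie_ne_zero {x y z : g} (h : ⁅x, ⁅y, z⁆⁆ ≠ 0) :
    ∃ u v : g, ⁅u, ⁅u, v⁆⁆ ≠ 0 := by
  by_contra! h0
  have h1 : ∀ x y z : g, ⁅x, ⁅y, z⁆⁆ = -⁅y, ⁅x, z⁆⁆ := by
    intro x y z
    have := h0 (x + y) z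
    simp only [add_lie, lie_add, h0, zero_add, add_zero] at this
    rw [eq_neg_iff_add_eq_zero, ← this]
    abel
  have h2 := leibniz_lie x y z
  have h3 : ⁅⁅x, y⁆, z⁆ = -⁅x, ⁅y, z⁆⁆ := by
    rw [← lie_skew, h1 z, neg_neg, ← lie_skew z y, lie_neg]
  rw [h3, h1 y x z] at h2
  -- Polarization makes the triple bracket alternating, and the Jacobi identity then equates it with
  -- -2 times itself.
  have h4 : (3 : ℝ) • ⁅x, ⁅y, z⁆⁆ = 0 := by
    have : (3 : ℝ) • ⁅x, ⁅y, z⁆⁆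
      = ⁅x, ⁅y, z⁆⁆ - (-⁅x, ⁅y, z⁆⁆ + -⁅x, ⁅y, z⁆⁆) := by module
    rw [this, ← h2, sub_self]
  exact h ((smul_eq_zero.mp h4).resolve_left (by norm_num))

variable [LieRing.IsNilpotent g]

theorem exists_lie_lie_lie_eq_zero {x z : g} (h : ⁅x, ⁅x, z⁆⁆ ≠ 0) :
    ∃ y : g, ⁅x, ⁅x, y⁆⁆ ≠ 0 ∧ ⁅x, ⁅x, ⁅x, y⁆⁆⁆ = 0 := by
  set E := LieModule.toEnd ℝ g g x with hE
  -- The shift by two makes the least such n positive, and y is then E ^ (n - 1) z.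
  have hex : ∃ n, (E ^ (n + 2)) z = 0 := by
    obtain ⟨n, hn⟩ := LieModule.isNilpotent_toEnd_of_isNilpotent ℝ g g x
    rw [← hE] at hn
    exact ⟨n, by rw [add_comm, pow_add, hn, mul_zero, LinearMap.zero_apply]⟩
  classical
  have hs := Nat.find_spec hex
  have hm := fun k => Nat.find_min hex (m := k)
  generalize Nat.find hex = n at hs hm
  match n, hs, hm with
  | 0, hs, _ => exact absurd hs h
  | k + 1, hs, hm =>
    refine ⟨(E ^ k) z, ?_, ?_⟩
    · have := hm k (by omega)
      rwa [add_comm, pow_add, pow_two] at this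
    · rwa [show k + 1 + 2 = 3 + k by ring, pow_add, pow_succ, pow_two] at hs

theorem exists_notMem_derivedAlgebra [Nontrivial g] : ∃ x : g, x ∉ derivedAlgebra g := by
  by_contra! h
  have h1 : (⁅(⊤ : LieIdeal ℝ g), (⊤ : LieIdeal ℝ g)⁆ : LieIdeal ℝ g) = ⊤ :=
    eq_top_iff.mpr fun x _ => h x
  obtain ⟨k, hk⟩ := LieModule.isNilpotent_iff ℝ g g |>.mp inferInstance
  have h2 : ∀ n, LieModule.lowerCentralSeries ℝ g g n = ⊤ := by
    intro n
    induction n with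
    | zero => rfl
    | succ n ih => rw [LieModule.lowerCentralSeries_succ, ih, h1]
  rw [h2] at hk
  obtain ⟨x, hx⟩ := exists_ne (0 : g)
  have : x ∈ (⊤ : LieSubmodule ℝ g g) := LieSubmodule.mem_top x
  rw [hk] at this
  exact hx this

/-- The last nonzero term of the lower central series provides z. Adding multiples of z to a vector
adjusts the value of a functional without affecting any bracket. -/
theorem exists_central_mem_derivedAlgebra (h : ∃ x y : g, ⁅x, y⁆ ≠ 0) :
    ∃ z ∈ derivedAlgebra g, z ≠ 0 ∧ ∀ x : g, ⁅x, z⁆ = 0 := by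
  obtain ⟨p, q, hpq⟩ := h
  have : Nontrivial g := ⟨⁅p, q⁆, 0, hpq⟩
  have : Nontrivial (LieModule.lowerCentralSeriesLast ℝ g g) :=
    LieModule.nontrivial_lowerCentralSeriesLast ℝ g g
  obtain ⟨z, hz⟩ := exists_ne (0 : LieModule.lowerCentralSeriesLast ℝ g g)
  exact ⟨z, LieModule.lowerCentralSeriesLast_le_of_not_isTrivial ℝ g g
    (fun h => hpq (h.trivial p q)) z.2, by simpa using hz,
    fun x => LieModule.lowerCentralSeriesLast_le_max_triv ℝ g g z.2 x⟩

end Generic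

/-! ### Density in an abelian ideal of codimension one. -/

section CodimOne

universe u
variable {g : Type u} [LieRing g] [LieAlgebra ℝ g] [FiniteDimensional ℝ g]
  [LieRing.IsNilpotent g] [TopologicalSpace g] [IsTopologicalAddGroup g] [ContinuousSMul ℝ g]

/-- If (ad x)² killed a, all triple brackets would vanish; so generic y in a has [x, [x, y]] ≠ 0. By
nilpotency of ad x this vector is then independent of x, y, [x, y], and [y, [x, y]] = 0 because a is
abelian. The filiform model applies to x, y. -/
theorem IsCodimOneAbelian.mem_closure_ricciMaximal {a : LieIdeal ℝ g} (ha : IsCodimOneAbelian a)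
    (h : ∃ x y z : g, ⁅x, ⁅y, z⁆⁆ ≠ 0) {t : g} (ht : t ≠ 0) (hta : t ∈ a) :
    Projectivization.mk ℝ t ht ∈ closure (ricciMaximal g) := by
  obtain ⟨x, hx⟩ := ha.exists_notMem
  obtain ⟨s, hs, hxs⟩ : ∃ s ∈ a, ⁅x, ⁅x, s⁆⁆ ≠ 0 := by
    by_contra! h0
    obtain ⟨p, q, r, hpqr⟩ := h
    obtain ⟨c, hc⟩ := ha.exists_sub_smul_mem hx p
    obtain ⟨d, hd⟩ := ha.exists_sub_smul_mem hx q
    obtain ⟨e, he⟩ := ha.exists_sub_smul_mem hx r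
    have h1 := ha.1 _ hc _ (ha.lie_mem q r)
    have h2 := ha.1 _ hd _ he
    simp only [sub_lie, lie_sub, smul_lie, lie_smul, lie_self, smul_zero, sub_zero] at h2
    have h3 : ⁅q, r⁆ = e • ⁅q, x⁆ + d • ⁅x, r⁆ := by
      rw [← sub_eq_zero, ← h2]
      abel
    have h4 : ∀ u : g, ⁅x, ⁅x, u⁆⁆ = 0 := by
      intro u
      obtain ⟨f, hf⟩ := ha.exists_sub_smul_mem hx u
      have := h0 _ hf
      simpa using this
    have h5 : ⁅x, ⁅q, r⁆⁆ = 0 := by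
      rw [h3, ← lie_skew q x]
      simp only [lie_add, lie_smul, lie_neg, h4, neg_zero, smul_zero, add_zero]
    rw [sub_lie, smul_lie, h5, smul_zero, sub_zero] at h1
    exact hpqr h1
  have hev : ∀ᶠ c in 𝓝[≠] (0 : ℝ), ⁅x, ⁅x, t⁆⁆ + c • ⁅x, ⁅x, s⁆⁆ ≠ 0 :=
    eventually_add_smul_ne_zero _ hxs
  have h2 : ∀ c : ℝ, ⁅x, ⁅x, t + c • s⁆⁆ = ⁅x, ⁅x, t⁆⁆ + c • ⁅x, ⁅x, s⁆⁆ := fun c => by simp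
  rw [← closure_closure]
  refine mk_mem_closure_of_tendsto ht _ (tendsto_add_smul_zero t s) ?_ ?_
  · filter_upwards [hev] with c hc hne
    rw [← h2] at hc
    have hya : t + c • s ∈ a := a.add_mem hta (a.smul_mem c hs)
    generalize t + c • s = y at hc hne hya
    have hv : ⁅x, ⁅x, y⁆⁆ ∉ Submodule.span ℝ (Set.range ![x, y, ⁅x, y⁆]) := by
      intro hmem
      obtain ⟨k, hk⟩ := (Submodule.mem_span_range_iff_exists_fun ℝ).mp hmem
      simp only [Fin.sum_univ_three, Matrix.cons_val_zero, Matrix.cons_val_one,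
        Matrix.cons_val] at hk
      have h0 : k 0 = 0 := by
        by_contra hk0
        have : k 0 • x ∈ a := by
          rw [show k 0 • x = ⁅x, ⁅x, y⁆⁆ - (k 1 • y + k 2 • ⁅x, y⁆) by rw [← hk]; abel]
          exact a.sub_mem (ha.lie_mem _ _)
            (a.add_mem (a.smul_mem _ hya) (a.smul_mem _ (ha.lie_mem _ _)))
        exact hx (((a.toSubmodule).smul_mem_iff hk0).mp this)
      rw [h0, zero_smul, zero_add] at hk
      obtain ⟨h3, h4⟩ := eq_zero_of_isNilpotent_of_recurrence
        (LieModule.isNilpotent_toEnd_of_isNilpotent ℝ g g x) hne (a := k 2) (b := k 1)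
        (by simp only [LieModule.toEnd_apply_apply]; rw [← hk]; abel)
      rw [h3, zero_smul, zero_add] at hk
      rcases h4 with h4 | h4
      · rw [LieModule.toEnd_apply_apply] at h4
        rw [h4, lie_zero] at hc
        exact hc rfl
      · rw [h4, zero_smul] at hk
        exact hc hk.symm
    obtain ⟨φ, h3, h4⟩ := exists_dual_eq_one_of_notMem hv
    have h5 : ∀ i, φ (![x, y, ⁅x, y⁆] i) = 0 := fun i => h4 _ (Submodule.subset_span ⟨i, rfl⟩)
    refine mem_closure_ricciMaximal_of_filiform (x := x) hne φ (h5 0) (h5 1) (h5 2) h3 ?_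
    rw [ha.1 _ hya _ (ha.lie_mem _ _), map_zero]
  · filter_upwards [hev] with c hc h0
    rw [← h2, h0, lie_zero, lie_zero] at hc
    exact hc rfl

end CodimOne

/-! ### Quadratic bracket identities that produce an abelian ideal. -/

section BracketIdentity

universe u
variable {g : Type u} [LieRing g] [LieAlgebra ℝ g]

/-- The bracket identity below for `φ` off the zero sets of two vectors extends to all `φ`. -/
theorem dual_identity_of_generic {x v w z : g} (hv : v ≠ 0) (hz : z ≠ 0)
    (h : ∀ φ : Module.Dual ℝ g, φ v ≠ 0 → φ z ≠ 0 → ∀ p q : g,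
      φ v * φ ⁅p, q⁆ = φ ⁅x, p⁆ * φ ⁅w, q⁆ - φ ⁅x, q⁆ * φ ⁅w, p⁆)
    (φ : Module.Dual ℝ g) (p q : g) :
    φ v * φ ⁅p, q⁆ = φ ⁅x, p⁆ * φ ⁅w, q⁆ - φ ⁅x, q⁆ * φ ⁅w, p⁆ := by
  obtain ⟨χ, hχv, hχz⟩ := exists_dual_ne_zero_pair hv hz
  set F : Module.Dual ℝ g → ℝ := fun φ =>
    φ v * φ ⁅p, q⁆ - (φ ⁅x, p⁆ * φ ⁅w, q⁆ - φ ⁅x, q⁆ * φ ⁅w, p⁆) with hF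
  have hcont : Continuous fun t : ℝ => F (φ + t • χ) := by
    simp only [hF, LinearMap.add_apply, LinearMap.smul_apply, smul_eq_mul]
    fun_prop
  have hev : ∀ᶠ t in 𝓝[≠] (0 : ℝ), F (φ + t • χ) = 0 := by
    filter_upwards [eventually_add_smul_ne_zero (φ v) hχv, eventually_add_smul_ne_zero (φ z) hχz]
      with t h1 h2
    exact sub_eq_zero.mpr (h (φ + t • χ) h1 h2 p q)
  have h1 : Tendsto (fun t : ℝ => F (φ + t • χ)) (𝓝[≠] 0) (𝓝 (F φ)) := by
    have := hcont.tendsto 0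
    simp only [zero_smul, add_zero] at this
    exact this.mono_left nhdsWithin_le_nhds
  exact sub_eq_zero.mp (tendsto_nhds_unique (h1.congr' hev) tendsto_const_nhds)

/-- The centralizer of `w` is an abelian ideal of codimension one if the brackets are of the form
`v [p, q] = [x, p] [w, q] - [x, q] [w, p]` as quadratic forms on the dual. -/
theorem exists_isCodimOneAbelian_of_dual_identity {x v w : g} (hv : v ≠ 0) (hxw : ⁅x, w⁆ = v)
    (hwv : ⁅w, v⁆ = 0) (hw : ∀ q : g, ∃ c : ℝ, ⁅w, q⁆ = c • v)
    (h : ∀ (φ : Module.Dual ℝ g) (p q : g),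
      φ v * φ ⁅p, q⁆ = φ ⁅x, p⁆ * φ ⁅w, q⁆ - φ ⁅x, q⁆ * φ ⁅w, p⁆) :
    ∃ a : LieIdeal ℝ g, IsCodimOneAbelian a := by
  have hwx : ⁅w, x⁆ = -v := by rw [← lie_skew, hxw]
  have hab : ∀ p q : g, ⁅w, p⁆ = 0 → ⁅w, q⁆ = 0 → ⁅p, q⁆ = 0 := by
    intro p q hp hq
    -- The functionals vanishing on v form a hyperplane at most, so a nonzero [p, q] would be
    -- detected by some φ with φ v ≠ 0.
    by_contra hne
    obtain ⟨φ, h1, h2⟩ := exists_dual_ne_zero_pair hv hne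
    have := h φ p q
    rw [hp, hq, map_zero, mul_zero, mul_zero, sub_zero] at this
    exact mul_ne_zero h1 h2 this
  have hdec : ∀ u : g, ∃ c : ℝ, ⁅w, u - c • x⁆ = 0 := by
    intro u
    obtain ⟨c, hc⟩ := hw u
    exact ⟨-c, by rw [lie_sub, lie_smul, hc, hwx]; module⟩
  let a : LieIdeal ℝ g :=
    { LinearMap.ker (LieModule.toEnd ℝ g g w) with
      lie_mem := by
        intro u r hr
        change ⁅w, ⁅u, r⁆⁆ = 0
        replace hr : ⁅w, r⁆ = 0 := hr
        obtain ⟨c, hc⟩ := hdec u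
        have h1 : ⁅u, r⁆ = c • ⁅x, r⁆ := by
          have := hab _ _ hc hr
          rwa [sub_lie, smul_lie, sub_eq_zero] at this
        rw [h1, lie_smul, leibniz_lie, hwx, hr, neg_lie, hab v r hwv hr, neg_zero, lie_zero,
          add_zero, smul_zero] }
  have hmem : ∀ u : g, u ∈ a ↔ ⁅w, u⁆ = 0 := fun u => Iff.rfl
  have hxa : x ∉ a := fun h1 => hv (by rwa [hmem, hwx, neg_eq_zero] at h1)
  refine ⟨a, fun p hp q hq => hab p q hp hq, ?_⟩
  have hx0 : (Submodule.Quotient.mk x : g ⧸ a.toSubmodule) ≠ 0 := fun h1 =>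
    hxa ((Submodule.Quotient.mk_eq_zero _).mp h1)
  refine (finrank_eq_one_iff_of_nonzero' _ hx0).mpr fun u => ?_
  obtain ⟨u, rfl⟩ := Submodule.Quotient.mk_surjective _ u
  obtain ⟨c, hc⟩ := hdec u
  refine ⟨c, ?_⟩
  rw [← Submodule.Quotient.mk_smul]
  exact ((Submodule.Quotient.eq _).mpr hc).symm

variable [LieRing.IsNilpotent g]

/-- Put w = [x, y] and v = [x, w]. The relation gives [w, v] = c₁v and [y, v] = c₂v, so c₁ = c₂ = 0
by nilpotency. For y' = y - c₃x it leaves (ad y')²x = -c₀x, so c₀ = 0 as well. -/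
theorem lie_sub_smul_eq_zero {x y : g} (h2 : ⁅x, ⁅x, y⁆⁆ ≠ 0) (h3 : ⁅x, ⁅x, ⁅x, y⁆⁆⁆ = 0)
    {c₀ c₁ c₂ c₃ : ℝ}
    (h : ⁅y, ⁅x, y⁆⁆ = c₀ • x + c₁ • y + c₂ • ⁅x, y⁆ + c₃ • ⁅x, ⁅x, y⁆⁆) :
    ⁅y - c₃ • x, ⁅x, y⁆⁆ = 0 := by
  have hx : x ≠ 0 := by
    rintro rfl
    simp at h2
  have hyx : ⁅y, x⁆ = -⁅x, y⁆ := by rw [← lie_skew]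
  have hyv : ⁅y, ⁅x, ⁅x, y⁆⁆⁆ = ⁅x, ⁅y, ⁅x, y⁆⁆⁆ := by
    rw [leibniz_lie y x, hyx, neg_lie, lie_self, neg_zero, zero_add]
  have hwv : ⁅⁅x, y⁆, ⁅x, ⁅x, y⁆⁆⁆ = ⁅x, ⁅x, ⁅y, ⁅x, y⁆⁆⁆⁆ := by
    rw [lie_lie, hyv, h3, lie_zero, sub_zero]
  have hc1 : c₁ = 0 := by
    refine eq_zero_of_lie_eq_smul (v := ⁅x, y⁆) (w := ⁅x, ⁅x, y⁆⁆) ?_ h2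
    rw [hwv, h]
    simp only [lie_add, lie_smul, lie_self, h3, smul_zero, zero_add, add_zero]
  have hc2 : c₂ = 0 := by
    refine eq_zero_of_lie_eq_smul (v := y) (w := ⁅x, ⁅x, y⁆⁆) ?_ h2
    rw [hyv, h, hc1]
    simp only [lie_add, lie_smul, lie_self, h3, smul_zero, zero_smul, zero_add, add_zero]
  have hE : ⁅y - c₃ • x, ⁅x, y⁆⁆ = c₀ • x := by
    rw [sub_lie, smul_lie, h, hc1, hc2]
    module
  have hEx : ⁅y - c₃ • x, x⁆ = -⁅x, y⁆ := by
    rw [sub_lie, smul_lie, lie_self, smul_zero, sub_zero, hyx]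
  have := (eq_zero_of_isNilpotent_of_recurrence
    (LieModule.isNilpotent_toEnd_of_isNilpotent ℝ g g (y - c₃ • x)) hx (a := 0) (b := -c₀) (by
      simp only [LieModule.toEnd_apply_apply]
      rw [hEx, lie_neg, hE]
      module)).1
  rw [hE, neg_eq_zero.mp this, zero_smul]

end BracketIdentity

/-! ### Obstructions to lying in the closure of the Ricci-maximal lines. -/

section NotMaximal

universe u
variable {g : Type u} [LieRing g] [LieAlgebra ℝ g] [FiniteDimensional ℝ g]
  [LieRing.IsNilpotent g] [TopologicalSpace g] [IsTopologicalAddGroup g] [ContinuousSMul ℝ g]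

/-- If [y, [x, y]] were independent of x, y, [x, y], [x, [x, y]], then y acting on x would produce a
filiform model with x as its light vector. Otherwise `lie_sub_smul_eq_zero` applies. -/
theorem exists_lie_lie_eq_zero_of_notMem_closure {x y : g} (hx : x ≠ 0)
    (hM : Projectivization.mk ℝ x hx ∉ closure (ricciMaximal g))
    (h2 : ⁅x, ⁅x, y⁆⁆ ≠ 0) (h3 : ⁅x, ⁅x, ⁅x, y⁆⁆⁆ = 0) :
    ∃ c : ℝ, ⁅y - c • x, ⁅x, y⁆⁆ = 0 := by
  by_cases hmem : ⁅y, ⁅x, y⁆⁆ ∈ Submodule.span ℝ (Set.range ![x, y, ⁅x, y⁆, ⁅x, ⁅x, y⁆⁆])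
  · obtain ⟨c, hc⟩ := (Submodule.mem_span_range_iff_exists_fun ℝ).mp hmem
    simp only [Fin.sum_univ_four, Matrix.cons_val_zero, Matrix.cons_val_one,
      Matrix.cons_val] at hc
    exact ⟨c 3, lie_sub_smul_eq_zero h2 h3 hc.symm⟩
  · exfalso
    obtain ⟨φ, h4, h5⟩ := exists_dual_eq_one_of_notMem hmem
    have h6 : ∀ i, φ (![x, y, ⁅x, y⁆, ⁅x, ⁅x, y⁆⁆] i) = 0 := fun i =>
      h5 _ (Submodule.subset_span ⟨i, rfl⟩)
    have hyx : ⁅y, x⁆ = -⁅x, y⁆ := by rw [← lie_skew]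
    refine hM (mem_closure_ricciMaximal_of_filiform (x := y) hx (-φ) ?_ ?_ ?_ ?_ ?_)
    · rw [LinearMap.neg_apply, neg_eq_zero]
      exact h6 1
    · rw [LinearMap.neg_apply, neg_eq_zero]
      exact h6 0
    · rw [hyx, LinearMap.neg_apply, map_neg, neg_neg]
      exact h6 2
    · rw [hyx, LinearMap.neg_apply, lie_neg, map_neg, neg_neg]
      exact h4
    · rw [hyx, LinearMap.neg_apply, lie_neg, map_neg, neg_neg]
      exact h6 3

/-- If φ[y, q] ≠ 0, then x, y, q span the five-dimensional model after normalization. The condition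
x ∉ g' lets φ be corrected to vanish at x without changing it on brackets, and the central z lets y
and q be moved into its kernel. -/
theorem dual_lie_eq_zero_of_notMem_closure {x z : g} (hx : x ≠ 0) (hxg : x ∉ derivedAlgebra g)
    (hM : Projectivization.mk ℝ x hx ∉ closure (ricciMaximal g))
    (hzg : z ∈ derivedAlgebra g) (hz : ∀ u : g, ⁅u, z⁆ = 0) (φ : Module.Dual ℝ g) (hφz : φ z ≠ 0)
    {y q : g} (h1 : φ ⁅x, y⁆ = 0) (h2 : φ ⁅x, ⁅x, y⁆⁆ ≠ 0) (h3 : φ ⁅x, q⁆ = 0) :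
    φ ⁅y, q⁆ = 0 := by
  by_contra hyq
  apply hM
  obtain ⟨χ, hχx, hχ⟩ := exists_dual_eq_one_of_notMem hxg
  have hz' : ∀ u : g, ⁅z, u⁆ = 0 := fun u => by rw [← lie_skew, hz, neg_zero]
  set ψ : Module.Dual ℝ g := φ - φ x • χ with hψ
  have hψφ : ∀ u ∈ derivedAlgebra g, ψ u = φ u := fun u hu => by simp [hψ, hχ u hu]
  have hψl : ∀ u u' : g, ψ ⁅u, u'⁆ = φ ⁅u, u'⁆ := fun u u' => hψφ _ (lie_mem_derivedAlgebra _ _)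
  have hψz : ψ z ≠ 0 := by rwa [hψφ z hzg]
  have hψx : ψ x = 0 := by simp [hψ, hχx]
  set y' := y - (ψ y / ψ z) • z with hy'
  -- The factor equalizes the values of φ on [y, q'] and [x, [x, y]], as the model requires.
  set q' := (φ ⁅x, ⁅x, y⁆⁆ / φ ⁅y, q⁆) • (q - (ψ q / ψ z) • z) with hq'
  have hxy : ∀ u : g, ⁅u, y'⁆ = ⁅u, y⁆ := fun u => by simp [hy', hz]
  have hxq : ∀ u : g, ⁅u, q'⁆ = (φ ⁅x, ⁅x, y⁆⁆ / φ ⁅y, q⁆) • ⁅u, q⁆ := fun u => by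
    simp [hq', hz]
  have hyu : ∀ u : g, ⁅y', u⁆ = ⁅y, u⁆ := fun u => by simp [hy', hz']
  refine mem_closure_ricciMaximal_of_five (y := y') (q := q') hx ((φ ⁅x, ⁅x, y⁆⁆)⁻¹ • ψ)
    ?_ ?_ ?_ ?_ ?_ ?_ ?_
  · simp [hψx]
  · simp [hy', hψz]
  · simp [hxy, hψl, h1]
  · simp [hq', hψz]
  · simp [hxy, hψl, h2]
  · simp only [hxq, hyu, map_smul, LinearMap.smul_apply, hψl, smul_eq_mul]
    field_simp
  · simp [hxq, hψl, h3]

/-- The filiform obstruction yields y with w = [x, y], v = [x, w] ≠ 0, [x, v] = 0 and [y, w] = 0.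
The five-dimensional one says that generic φ vanishes on brackets of ker (φ ∘ ad x). Together they
force ad w to have image ℝv and an abelian kernel. -/
theorem exists_isCodimOneAbelian_of_notMem_closure {x : g} (hx : x ≠ 0)
    (hxg : x ∉ derivedAlgebra g)
    (hM : Projectivization.mk ℝ x hx ∉ closure (ricciMaximal g)) {y₀ : g}
    (hy₀ : ⁅x, ⁅x, y₀⁆⁆ ≠ 0) : ∃ a : LieIdeal ℝ g, IsCodimOneAbelian a := by
  obtain ⟨y₁, h2, h3⟩ := exists_lie_lie_lie_eq_zero hy₀
  obtain ⟨c, hc⟩ := exists_lie_lie_eq_zero_of_notMem_closure hx hM h2 h3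
  obtain ⟨y, hy, hyw⟩ : ∃ y : g, ⁅x, y⁆ = ⁅x, y₁⁆ ∧ ⁅y, ⁅x, y⁆⁆ = 0 := by
    have h1 : ⁅x, y₁ - c • x⁆ = ⁅x, y₁⁆ := by simp
    exact ⟨y₁ - c • x, h1, by rw [h1, hc]⟩
  rw [← hy] at h2 h3
  obtain ⟨z, hzg, hz0, hz⟩ := exists_central_mem_derivedAlgebra (g := g) ⟨_, _, h2⟩
  set w := ⁅x, y⁆ with hw
  set v := ⁅x, w⁆ with hv
  have hyx : ⁅y, x⁆ = -w := by rw [← lie_skew]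
  have hwv : ⁅w, v⁆ = 0 := by
    rw [hw, lie_lie, h3, lie_zero, sub_zero, hv, leibniz_lie y x, hyx, neg_lie, lie_self, hyw,
      lie_zero, neg_zero, zero_add, lie_zero]
  have hgen : ∀ φ : Module.Dual ℝ g, φ v ≠ 0 → φ z ≠ 0 → ∀ p q : g,
      φ ⁅x, p⁆ = 0 → φ ⁅x, q⁆ = 0 → φ ⁅p, q⁆ = 0 := by
    intro φ hφv hφz p q hp hq
    by_cases hpp : φ ⁅x, ⁅x, p⁆⁆ = 0
    -- When φ[x, [x, p]] = 0 the obstruction does not apply to p itself, but it does apply to y' and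
    -- to p + y'; subtract.
    · set y' := y - (φ w / φ v) • w with hy'
      have e1 : φ ⁅x, y'⁆ = 0 := by
        simp only [hy', lie_sub, lie_smul, map_sub, map_smul, smul_eq_mul, ← hw, ← hv]
        field_simp
        ring
      have e2 : φ ⁅x, ⁅x, y'⁆⁆ = φ v := by
        simp only [hy', lie_sub, lie_smul, ← hw, ← hv, h3, smul_zero, sub_zero]
      have e3 := dual_lie_eq_zero_of_notMem_closure hx hxg hM hzg hz φ hφz e1 (by rwa [e2]) hq
      have e4 := dual_lie_eq_zero_of_notMem_closure hx hxg hM hzg hz φ hφz (y := p + y')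
        (by rw [lie_add, map_add, hp, e1, add_zero])
        (by rw [lie_add, lie_add, map_add, hpp, e2, zero_add]; exact hφv) hq
      rwa [add_lie, map_add, e3, add_zero] at e4
    · exact dual_lie_eq_zero_of_notMem_closure hx hxg hM hzg hz φ hφz hp hpp hq
  have hid := dual_identity_of_generic (x := x) (w := w) h2 hz0 (by
    intro φ hφv hφz p q
    -- As [x, w] = v, these multiples of w project p and q into ker (φ ∘ ad x); clearing
    -- denominators gives the quadratic identity.
    have := hgen φ hφv hφz (p - (φ ⁅x, p⁆ / φ v) • w) (q - (φ ⁅x, q⁆ / φ v) • w)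
      (by simp only [lie_sub, lie_smul, map_sub, map_smul, smul_eq_mul, ← hv]; field_simp; ring)
      (by simp only [lie_sub, lie_smul, map_sub, map_smul, smul_eq_mul, ← hv]; field_simp; ring)
    rw [lie_sub, sub_lie, sub_lie] at this
    simp only [lie_smul, smul_lie, lie_self, smul_zero, sub_zero, map_sub, map_smul, smul_eq_mul]
      at this
    rw [← lie_skew p w, map_neg] at this
    field_simp at this
    linarith)
  refine exists_isCodimOneAbelian_of_dual_identity h2 hv.symm hwv (fun q => ?_) hid
  refine exists_eq_smul_of_dual fun φ hφ => ?_
  -- On the hyperplane φ v = 0 a product of two linear forms in φ vanishes, so one of them does. It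
  -- is not φ ↦ φ w, because w is not a multiple of v; hence [w, q] lies in ℝv.
  have hwφ : ∀ φ : Module.Dual ℝ g, φ v = 0 → φ w * φ ⁅w, q⁆ = 0 := by
    intro φ hφ
    have h4 := hid φ y q
    rw [hφ, zero_mul, ← hw, ← lie_skew w y, hyw, neg_zero, map_zero, mul_zero, sub_zero] at h4
    exact h4.symm
  by_contra hne
  have h4 := (mul_eq_zero.mp (hwφ φ hφ)).resolve_right hne
  have hwspan : w ∉ Submodule.span ℝ {v} := by
    intro hmem
    obtain ⟨c, hc⟩ := Submodule.mem_span_singleton.mp hmem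
    have h5 : v = 0 := by
      rw [hv, ← hc, lie_smul, h3, smul_zero]
    exact h2 h5
  obtain ⟨χ, h5, h6⟩ := exists_dual_eq_one_of_notMem hwspan
  have h7 := h6 v (Submodule.mem_span_singleton_self v)
  have h8 := hwφ χ h7
  have h9 := hwφ (φ + χ) (by simp [hφ, h7])
  rw [h5, one_mul] at h8
  rw [LinearMap.add_apply, LinearMap.add_apply, h4, h5, h8, zero_add, add_zero, one_mul] at h9
  exact hne h9

/-- A single direction u + t • y outside g' with nonzero squared ad makes both properties generic on
the line through x in that direction. At such points, absence from the closure would produce a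
forbidden ideal. -/
theorem mem_closure_ricciMaximal_of_forall_not (h : ∃ p q r : g, ⁅p, ⁅q, r⁆⁆ ≠ 0)
    (ha : ¬ ∃ a : LieIdeal ℝ g, IsCodimOneAbelian a) {x : g} (hx : x ≠ 0) :
    Projectivization.mk ℝ x hx ∈ closure (ricciMaximal g) := by
  obtain ⟨p, q, r, hpqr⟩ := h
  obtain ⟨u, v, huv⟩ := exists_lie_lie_ne_zero hpqr
  have : Nontrivial g := ⟨x, 0, hx⟩
  obtain ⟨y, hy⟩ := exists_notMem_derivedAlgebra (g := g)
  obtain ⟨t, h1, h2⟩ := ((eventually_notMem u hy).and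
    (eventually_lie_lie_ne_zero (b := y) (.inl huv))).exists
  rw [← closure_closure]
  refine mk_mem_closure_of_tendsto hx _ (tendsto_add_smul_zero x (u + t • y)) ?_ ?_
  · filter_upwards [eventually_notMem x h1, eventually_lie_lie_ne_zero (a := x) (.inr h2)]
      with s h3 h4 hne
    by_contra hM
    exact ha (exists_isCodimOneAbelian_of_notMem_closure hne h3 hM h4)
  · filter_upwards [eventually_notMem x h1] with s h3 h0
    exact h3 (h0 ▸ Submodule.zero_mem _)

end NotMaximal

/-! ### The abelian case. -/

section Abelian

universe u
variable {g : Type u} [LieRing g] [LieAlgebra ℝ g] [FiniteDimensional ℝ g]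

theorem ricciMaximal_eq_univ_of_abelian [LieRing.IsNilpotent g] (h : ∀ x y : g, ⁅x, y⁆ = 0) :
    ricciMaximal g = Set.univ := by
  refine Set.eq_univ_of_forall fun p => ?_
  induction p with | _ x hx
  refine (mk_mem_ricciMaximal_iff hx).mpr ⟨InnerProd.ofBasis (Module.finBasis ℝ g), 0, ?_,
    fun v => ?_⟩
  · refine (InnerProd.ofBasis (Module.finBasis ℝ g)).form_self_eq_zero.mp ?_ |>.trans
      (zero_smul ℝ x).symm
    rw [form_ricciOp, ricci_eq_zero_of_abelian h]
  · rw [ricci_eq_zero_of_abelian h, zero_mul]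

end Abelian
end RicciNil

end

/-! ### Assembly of the cases. -/

theorem theorem1p2 (g : Type*) [LieRing g] [LieAlgebra ℝ g] [FiniteDimensional ℝ g]
    [LieRing.IsNilpotent g]
    [TopologicalSpace g] [IsTopologicalAddGroup g] [ContinuousSMul ℝ g] [T2Space g] :
    (RicciNil.IsTwoStepNilpotent g →
      closure (RicciNil.ricciMaximal g) = RicciNil.projSet (RicciNil.derivedAlgebra g)) ∧
    (∀ a : LieIdeal ℝ g, RicciNil.IsCodimOneAbelian a →
      ¬ IsLieAbelian g → ¬ RicciNil.IsTwoStepNilpotent g →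
      closure (RicciNil.ricciMaximal g) = RicciNil.projSet a.toSubmodule) ∧
    (IsLieAbelian g ∨
        (¬ RicciNil.IsTwoStepNilpotent g ∧
          ¬ ∃ a : LieIdeal ℝ g, RicciNil.IsCodimOneAbelian a) →
      closure (RicciNil.ricciMaximal g) = Set.univ) ∧
    closure (RicciNil.ricciMinimal g) = Set.univ := by
  have h3 : ¬ IsLieAbelian g → ¬ RicciNil.IsTwoStepNilpotent g →
      ∃ x y z : g, ⁅x, ⁅y, z⁆⁆ ≠ 0 := by
    intro hab h2
    by_contra! h0
    refine h2 ⟨h0, ?_⟩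
    by_contra! h1
    exact hab ⟨h1⟩
  refine ⟨fun h => ?_, fun a ha hab h2 => ?_, fun h => ?_, RicciNil.closure_ricciMinimal⟩
  · refine Set.Subset.antisymm (closure_minimal (fun p hp => ?_) (RicciNil.isClosed_projSet _))
      fun p hp => subset_closure ?_
    · induction p with | _ x hx
      exact (RicciNil.mk_mem_projSet hx).mpr (RicciNil.mem_derivedAlgebra_of_mem_ricciMaximal h hx hp)
    · induction p with | _ x hx
      exact RicciNil.mem_ricciMaximal_of_mem_derivedAlgebra h.1 hx
        ((RicciNil.mk_mem_projSet hx).mp hp)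
  · obtain ⟨x, y, z, hxyz⟩ := h3 hab h2
    refine Set.Subset.antisymm (closure_minimal (fun p hp => ?_) (RicciNil.isClosed_projSet _))
      fun p hp => ?_
    · induction p with | _ t ht
      exact (RicciNil.mk_mem_projSet ht).mpr (ha.mem_of_mem_ricciMaximal ⟨_, _, hxyz⟩ ht hp)
    · induction p with | _ t ht
      exact ha.mem_closure_ricciMaximal ⟨x, y, z, hxyz⟩ ht ((RicciNil.mk_mem_projSet ht).mp hp)
  · by_cases hab : IsLieAbelian g
    · rw [RicciNil.ricciMaximal_eq_univ_of_abelian hab.trivial, closure_univ]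
    · obtain ⟨h2, ha⟩ := h.resolve_left hab
      refine Set.eq_univ_of_forall fun p => ?_
      induction p with | _ x hx
      exact RicciNil.mem_closure_ricciMaximal_of_forall_not (h3 hab h2) ha hx
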